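/- **Setting.** All manifolds are smooth, finite-dimensional, Hausdorff and without boundary; curves are smooth. Let $G$ be a Lie group. A *time-dependent principal bundle* $G\to Q\to S=Q/G$ consists of free $G$-actions $(g,q)\mapsto g\cdot_t q$ on $Q$ and surjective submersions $\pi_t\colon Q\to S$ onto a fixed manifold $S$, $t\in\mathbb R$, both depending smoothly on all variables including $t$, such that the fibres of $\pi_t$ are the orbits $\mathcal O_t(q)$ of the action at time $t$, and $\mathcal W_t|_q:=\ker d\pi_t(q)=T_q\mathcal O_t(q)$. Put $\underline\pi(q,t)=(\pi_t(q),t)$, a map $Q\times\mathbb R\to S\times\mathbb R$. The group $G$ acts on $Q\times\mathbb R$ by $g\cdot(q,t)=(g\cdot_t q,t)$. A *time-dependent $G$-Chaplygin system* $(Q,L,\mathbf F,\mathcal A,G)$ consists of such a bundle, a smooth Lagrangian $L\colon TQ\times\mathbb R\to\mathbb R$, a field of forces $\mathbf F(q,\dot q,t)\in T_q^*Q$, and a smooth time-dependent affine distribution $\mathcal A_t\subset TQ$ of rank $m=\dim S$, whose distribution of linear directions (virtual displacements) $\mathcal D_t$ satisfies $T_qQ=\mathcal D_t|_q\oplus\mathcal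 W_t|_q$. All data are $G$-invariant for the action on $Q\times\mathbb R$: velocities are transformed by $\xi\mapsto g_*\xi:=d(g\,\cdot_t)(\xi)+\frac{\partial}{\partial t}(g\cdot_t q)$ and virtual displacements by $\eta\mapsto d(g\,\cdot_t)(\eta)$; thus $L(g\cdot_t q,g_*\xi,t)=L(q,\xi,t)$, $\mathbf F(g\cdot_t q,g_*\xi,t)(d(g\,\cdot_t)\eta)=\mathbf F(q,\xi,t)(\eta)$ and $g_*(\mathcal A_t|_q)\subset\mathcal A_t|_{g\cdot_t q}$. (For a time-independent action $g_*=dg$.) Let $\underline{\mathcal A}_{(q,t)}$ be the span of the vectors $\xi+\frac{\partial}{\partial t}$, $\xi\in\mathcal A_t|_q$. It is a complement of $\mathcal W_t|_q=\ker d\underline\pi$ in $T_{(q,t)}(Q\times\mathbb R)$. For a tangent vector or vector field $X$ on $Q\times\mathbb R$ let $X^h$ be its component in $\underline{\mathcal A}$, let $\underline\Theta(X)=X-X^h$, and let $\underline B(X,Y)=-\underline\Theta([X^h,Y^h])$ be the curvature. For $\xi\in T_{\pi_t(q)}S$ and $\underline\xi\in T_{(\pi_t(q),t)}(S\times\mathbb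 R)$ let $\mathbb H^q_t(\xi)\in\mathcal D_t|_q$ and $\mathbb H^{(q,t)}(\underline\xi)\in\underline{\mathcal A}_{(q,t)}$ be the unique vectors with $d\pi_t(\mathbb H^q_t(\xi))=\xi$ and $d\underline\pi(\mathbb H^{(q,t)}(\underline\xi))=\underline\xi$. The affine horizontal lift $\mathbb A^q_t(\xi)\in\mathcal A_t|_q$ is defined by $\mathbb A^q_t(\xi)+\frac{\partial}{\partial t}=\mathbb H^{(q,t)}\big(\xi+\frac{\partial}{\partial t}\big)$. An affine horizontal lift of a curve $\Gamma(t)$ in $S$ is a curve $\gamma(t)$ in $Q$ with $\pi_t(\gamma(t))=\Gamma(t)$ and $\dot\gamma(t)=\mathbb A^{\gamma(t)}_t(\dot\Gamma(t))$. Write $\delta L(\eta)|_\gamma=\sum_i\big(\frac{\partial L}{\partial q^i}-\frac{d}{dt}\frac{\partial L}{\partial\dot q^i}\big)\eta^i$ and $\mathbb FL(q,\xi,t)(\eta)=\frac{d}{ds}\big|_{s=0}L(q,\xi+s\eta,t)$. A curve $\gamma$ on an open interval $J\subset\mathbb R$ is a *solution of the system* if for all $t\in J$ one has $\dot\gamma(t)\in\mathcal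 A_t$ and $\delta L(\eta)|_\gamma+\mathbf F(\gamma,\dot\gamma,t)(\eta)=0$ for all $\eta\in\mathcal D_t|_{\gamma(t)}$. The reduced data on $S$ are, with any $q\in\pi_t^{-1}(y)$, $$L_{red}(y,\dot y,t)=L(q,\mathbb A^q_t(\dot y),t),\qquad \mathbf F_{red}(y,\dot y,t)(\xi)=\mathbf F(q,\mathbb A^q_t(\dot y),t)(\mathbb H^q_t(\xi)),$$ $$\mathbf{JK}(y,\dot y,t)(\xi)=\mathbb FL(q,\mathbb A^q_t(\dot y),t)\Big(\underline B\big(\mathbb H^{(q,t)}(\dot y+\tfrac{\partial}{\partial t}),\mathbb H^q_t(\xi)\big)\Big).$$ A curve $\Gamma$ on $J$ is a *solution of the reduced system* if for all $t\in J$ and all $\xi\in T_{\Gamma(t)}S$ $$\delta L_{red}(\xi)|_\Gamma+\mathbf F_{red}(\Gamma,\dot\Gamma,t)(\xi)=\mathbf{JK}(\Gamma,\dot\Gamma,t)(\xi).$$ **Theorem.** $L_{red}$, $\mathbf F_{red}$ and $\mathbf{JK}$ do not depend on the choice of $q\in\pi_t^{-1}(y)$, and $L_{red}$ is smooth on $TS\times\mathbb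 R$. If $\gamma$ is a solution of the time-dependent $G$-Chaplygin system on an open interval $J$, then $\Gamma(t)=\pi_t(\gamma(t))$ is a solution of the reduced system on $J$. Conversely, let $\Gamma$ be a solution of the reduced system on an open interval $J\ni 0$ with $\Gamma(0)=y_0$, $\dot\Gamma(0)=Y_0\in T_{y_0}S$, and let $q_0\in\pi_0^{-1}(y_0)$. Then $\Gamma$ has a unique affine horizontal lift $\gamma$ on $J$ with $\gamma(0)=q_0$, and $\gamma$ is a solution of the original system with the initial conditions $\gamma(0)=q_0$, $\dot\gamma(0)=\mathbb A^{q_0}_0(Y_0)\in\mathcal A_0|_{q_0}$. -/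

import Mathlib

open scoped Manifold ContDiff Topology

noncomputable section

namespace Chaplygin

/-! ## Lagrangian mechanics on a manifold -/

section Mechanics

variable {E : Type*} [NormedAddCommGroup E] [NormedSpace ℝ E]
  {M : Type*} [TopologicalSpace M] [ChartedSpace E M]

/-- The velocity `γ'(t)` of a curve `γ` in `M`. -/
def velocity (γ : ℝ → M) (t : ℝ) : TangentSpace 𝓘(ℝ, E) (γ t) :=
  mfderiv 𝓘(ℝ, ℝ) 𝓘(ℝ, E) γ t (1 : ℝ)

/-- The curve `t ↦ (γ(t), γ'(t))` in the tangent bundle. -/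
def tangentLift (γ : ℝ → M) (t : ℝ) : TangentBundle 𝓘(ℝ, E) M :=
  ⟨γ t, velocity γ t⟩

/-- A time-dependent Lagrangian `L : TM × ℝ → ℝ` in the local coordinates `(x, v, s)` of
`TM × ℝ` given by the chart of `M` at `x₀`. -/
def localLagrangian (L : TangentBundle 𝓘(ℝ, E) M × ℝ → ℝ) (x₀ : M) (x v : E) (s : ℝ) : ℝ :=
  L (tangentMap 𝓘(ℝ, E) 𝓘(ℝ, E) (extChartAt 𝓘(ℝ, E) x₀).symm ⟨x, v⟩, s)

/-- The variational derivative
`δL(η)|_γ = ∑ᵢ (∂L/∂qⁱ - d/dt ∂L/∂q̇ⁱ) ηⁱ` of `L` along `γ` at time `t` in the direction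
`η ∈ T_{γ(t)} M`, computed in the chart at `γ(t)`. -/
def variationalDerivative (L : TangentBundle 𝓘(ℝ, E) M × ℝ → ℝ) (γ : ℝ → M) (t : ℝ)
    (η : TangentSpace 𝓘(ℝ, E) (γ t)) : ℝ :=
  let c : ℝ → E := fun s => extChartAt 𝓘(ℝ, E) (γ t) (γ s)
  let h : E := mfderiv 𝓘(ℝ, E) 𝓘(ℝ, E) (extChartAt 𝓘(ℝ, E) (γ t)) (γ t) η
  fderiv ℝ (fun x => localLagrangian L (γ t) x (deriv c t) t) (c t) h
    - deriv (fun s => fderiv ℝ (fun v => localLagrangian L (γ t) (c s) v s) (deriv c s) h) t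

/-- The fiber derivative `𝔽L(q, ξ, t)(η) = d/ds|_{s=0} L(q, ξ + s η, t)`. -/
def fiberDerivative (L : TangentBundle 𝓘(ℝ, E) M × ℝ → ℝ) (q : M)
    (ξ : TangentSpace 𝓘(ℝ, E) q) (t : ℝ) (η : TangentSpace 𝓘(ℝ, E) q) : ℝ :=
  deriv (fun s : ℝ => L (⟨q, ξ + s • η⟩, t)) 0

end Mechanics

/-! ## Space-time `M × ℝ` -/

section SpaceTime

variable {E : Type*} [NormedAddCommGroup E] [NormedSpace ℝ E]
  {M : Type*} [TopologicalSpace M] [ChartedSpace E M]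

/-- The tangent vector `ξ + τ ∂/∂t` to `M × ℝ` at `p`, for `ξ ∈ T_{p.1} M`. -/
def spaceTimeVector (p : M × ℝ) (ξ : TangentSpace 𝓘(ℝ, E) p.1) (τ : ℝ) :
    TangentSpace (𝓘(ℝ, E).prod 𝓘(ℝ, ℝ)) p :=
  ((ξ, τ) : E × ℝ)

/-- The component of a tangent vector to `M × ℝ` along `M`: `ξ + τ ∂/∂t ↦ ξ`. -/
def spacePart {p : M × ℝ} (v : TangentSpace (𝓘(ℝ, E).prod 𝓘(ℝ, ℝ)) p) :
    TangentSpace 𝓘(ℝ, E) p.1 :=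
  (show E × ℝ from v).1

/-- The component of a tangent vector to `M × ℝ` along `ℝ`: `ξ + τ ∂/∂t ↦ τ`. -/
def timePart {p : M × ℝ} (v : TangentSpace (𝓘(ℝ, E).prod 𝓘(ℝ, ℝ)) p) : ℝ :=
  (show E × ℝ from v).2

end SpaceTime

/-! ## Affine constraints -/

/-- A smooth time-dependent affine distribution `𝒜_t ⊂ TQ` of rank `m`: locally
`𝒜_t = χ_t + span (X₁, …, X_m)` with smooth time-dependent vector fields `χ, X₁, …, X_m`, the
fields `X₁, …, X_m` being linearly independent at each point. A point `p = (q, t)` is an element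
of `Q × ℝ`. -/
structure AffineDistribution (E : Type*) [NormedAddCommGroup E] [NormedSpace ℝ E]
    (Q : Type*) [TopologicalSpace Q] [ChartedSpace E Q] [IsManifold 𝓘(ℝ, E) ∞ Q] (m : ℕ) where
  /-- The affine subspace `𝒜_t|_q ⊂ T_q Q` at `p = (q, t)`. -/
  space : (p : Q × ℝ) → AffineSubspace ℝ (TangentSpace 𝓘(ℝ, E) p.1)
  exists_local_frame : ∀ p₀ : Q × ℝ, ∃ U : Set (Q × ℝ), IsOpen U ∧ p₀ ∈ U ∧
    ∃ (χ : (p : Q × ℝ) → TangentSpace 𝓘(ℝ, E) p.1)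
      (X : Fin m → (p : Q × ℝ) → TangentSpace 𝓘(ℝ, E) p.1),
      ContMDiffOn (𝓘(ℝ, E).prod 𝓘(ℝ, ℝ)) 𝓘(ℝ, E).tangent ∞
        (fun p : Q × ℝ => (⟨p.1, χ p⟩ : TangentBundle 𝓘(ℝ, E) Q)) U ∧
      (∀ i, ContMDiffOn (𝓘(ℝ, E).prod 𝓘(ℝ, ℝ)) 𝓘(ℝ, E).tangent ∞
        (fun p : Q × ℝ => (⟨p.1, X i p⟩ : TangentBundle 𝓘(ℝ, E) Q)) U) ∧
      ∀ p ∈ U, LinearIndependent ℝ (fun i => X i p) ∧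
        space p = AffineSubspace.mk' (χ p) (Submodule.span ℝ (Set.range fun i => X i p))

namespace AffineDistribution

variable {E : Type*} [NormedAddCommGroup E] [NormedSpace ℝ E]
  {Q : Type*} [TopologicalSpace Q] [ChartedSpace E Q] [IsManifold 𝓘(ℝ, E) ∞ Q] {m : ℕ}

/-- The virtual displacements `𝒟_t|_q`, the linear directions of `𝒜_t|_q`. -/
def virtual (A : AffineDistribution E Q m) (p : Q × ℝ) :
    Submodule ℝ (TangentSpace 𝓘(ℝ, E) p.1) :=
  (A.space p).direction

/-- The distribution `𝒜̲ ⊂ T(Q × ℝ)`: at `p = (q, t)` the span of the vectors `ξ + ∂/∂t` with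
`ξ ∈ 𝒜_t|_q`, that is, the set of all `η + μ (χ_t + ∂/∂t)` with `η ∈ 𝒟_t|_q`, `μ ∈ ℝ`. -/
def extended (A : AffineDistribution E Q m) (p : Q × ℝ) :
    Submodule ℝ (TangentSpace (𝓘(ℝ, E).prod 𝓘(ℝ, ℝ)) p) :=
  Submodule.span ℝ ((fun ξ => spaceTimeVector p ξ 1) '' (A.space p : Set _))

lemma exists_mem (A : AffineDistribution E Q m) (p : Q × ℝ) : ∃ χ, χ ∈ A.space p := by
  obtain ⟨U, -, hp, χ, X, -, -, h⟩ := A.exists_local_frame p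
  refine ⟨χ p, ?_⟩
  rw [(h p hp).2]
  exact AffineSubspace.self_mem_mk' _ _

lemma mem_extended_iff (A : AffineDistribution E Q m) (p : Q × ℝ)
    {χ : TangentSpace 𝓘(ℝ, E) p.1} (hχ : χ ∈ A.space p)
    (v : TangentSpace (𝓘(ℝ, E).prod 𝓘(ℝ, ℝ)) p) :
    v ∈ A.extended p ↔ spacePart v - timePart v • χ ∈ A.virtual p := by
  constructor
  · intro hv
    induction hv using Submodule.span_induction with
    | mem x hx =>
      obtain ⟨ξ, hξ, rfl⟩ := hx
      have h1 : ξ - χ ∈ A.virtual p := AffineSubspace.vsub_mem_direction hξ hχ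
      have h2 : spacePart (spaceTimeVector p ξ 1) - timePart (spaceTimeVector p ξ 1) • χ
          = ξ - (1 : ℝ) • χ := rfl
      rw [h2, one_smul]
      exact h1
    | zero =>
      have h2 : spacePart (0 : TangentSpace (𝓘(ℝ, E).prod 𝓘(ℝ, ℝ)) p)
          - timePart (0 : TangentSpace (𝓘(ℝ, E).prod 𝓘(ℝ, ℝ)) p) • χ = 0 - (0 : ℝ) • χ := rfl
      rw [h2, zero_smul, sub_zero]
      exact Submodule.zero_mem _
    | add x y _ _ hx hy =>
      have h2 : spacePart (x + y) - timePart (x + y) • χ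
          = (spacePart x + spacePart y) - (timePart x + timePart y) • χ := rfl
      rw [h2, add_smul, add_sub_add_comm]
      exact Submodule.add_mem _ hx hy
    | smul a x _ hx =>
      have h2 : spacePart (a • x) - timePart (a • x) • χ
          = a • spacePart x - (a * timePart x) • χ := rfl
      rw [h2, mul_smul, ← smul_sub]
      exact Submodule.smul_mem _ _ hx
  · intro hv
    have h1 : spaceTimeVector p (χ + (spacePart v - timePart v • χ)) 1 ∈ A.extended p := by
      apply Submodule.subset_span
      refine ⟨_, ?_, rfl⟩
      have := AffineSubspace.vadd_mem_of_mem_direction hv hχ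
      rwa [vadd_eq_add, add_comm] at this
    have h2 : spaceTimeVector p χ 1 ∈ A.extended p :=
      Submodule.subset_span ⟨_, hχ, rfl⟩
    have h3 : v = (spaceTimeVector p (χ + (spacePart v - timePart v • χ)) 1
        - spaceTimeVector p χ 1) + timePart v • spaceTimeVector p χ 1 := by
      change (spacePart v, timePart v)
        = ((χ + (spacePart v - timePart v • χ)) - χ + timePart v • χ, (1 : ℝ) - 1 + timePart v * 1)
      ext1
      · change spacePart v = (χ + (spacePart v - timePart v • χ)) - χ + timePart v • χ
        abel
      · change timePart v = (1 : ℝ) - 1 + timePart v * 1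
        ring
    rw [h3]
    exact Submodule.add_mem _ (Submodule.sub_mem _ h1 h2) (Submodule.smul_mem _ _ h2)

end AffineDistribution

/-! ## Time-dependent principal bundles -/

/-- A time-dependent principal bundle `G → Q → S = Q/G`: smoothly in `t ∈ ℝ`, a free action of the
Lie group `G` on `Q` and a surjective submersion `π_t : Q → S` onto a fixed manifold `S`, whose
fibers are the orbits `𝒪_t(q)` of the action at time `t`, with `ker dπ_t(q) = T_q 𝒪_t(q)`. -/
structure TimeDependentPrincipalBundle
    (EQ ES EG : Type*) [NormedAddCommGroup EQ] [NormedSpace ℝ EQ]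
    [NormedAddCommGroup ES] [NormedSpace ℝ ES] [NormedAddCommGroup EG] [NormedSpace ℝ EG]
    (Q : Type*) [TopologicalSpace Q] [ChartedSpace EQ Q] [IsManifold 𝓘(ℝ, EQ) ∞ Q]
    (S : Type*) [TopologicalSpace S] [ChartedSpace ES S] [IsManifold 𝓘(ℝ, ES) ∞ S]
    (G : Type*) [TopologicalSpace G] [ChartedSpace EG G] [Group G] [LieGroup 𝓘(ℝ, EG) ∞ G] where
  /-- The action at time `t`: `act g (q, t) = g ·_t q`. -/
  act : G → Q × ℝ → Q
  act_smooth : ContMDiff (𝓘(ℝ, EG).prod (𝓘(ℝ, EQ).prod 𝓘(ℝ, ℝ))) 𝓘(ℝ, EQ) ∞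
    (fun x : G × (Q × ℝ) => act x.1 x.2)
  act_one : ∀ (q : Q) (t : ℝ), act 1 (q, t) = q
  act_mul : ∀ (g h : G) (q : Q) (t : ℝ), act (g * h) (q, t) = act g (act h (q, t), t)
  act_free : ∀ (g : G) (q : Q) (t : ℝ), act g (q, t) = q → g = 1
  /-- The projection at time `t`: `proj (q, t) = π_t(q)`. -/
  proj : Q × ℝ → S
  proj_smooth : ContMDiff (𝓘(ℝ, EQ).prod 𝓘(ℝ, ℝ)) 𝓘(ℝ, ES) ∞ proj
  proj_surjective : ∀ (t : ℝ) (y : S), ∃ q : Q, proj (q, t) = y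
  proj_submersion : ∀ (q : Q) (t : ℝ),
    Function.Surjective (mfderiv 𝓘(ℝ, EQ) 𝓘(ℝ, ES) (fun q' : Q => proj (q', t)) q)
  proj_eq_iff : ∀ (q q' : Q) (t : ℝ), proj (q, t) = proj (q', t) ↔ ∃ g : G, act g (q, t) = q'
  ker_eq_tangent_orbit : ∀ (q : Q) (t : ℝ) (v : EQ),
    mfderiv 𝓘(ℝ, EQ) 𝓘(ℝ, ES) (fun q' : Q => proj (q', t)) q v = (0 : ES) ↔
      ∃ ζ : EG, mfderiv 𝓘(ℝ, EG) 𝓘(ℝ, EQ) (fun g : G => act g (q, t)) (1 : G) ζ = v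

namespace TimeDependentPrincipalBundle

variable {EQ ES EG : Type*} [NormedAddCommGroup EQ] [NormedSpace ℝ EQ]
  [NormedAddCommGroup ES] [NormedSpace ℝ ES] [NormedAddCommGroup EG] [NormedSpace ℝ EG]
  {Q : Type*} [TopologicalSpace Q] [ChartedSpace EQ Q] [IsManifold 𝓘(ℝ, EQ) ∞ Q]
  {S : Type*} [TopologicalSpace S] [ChartedSpace ES S] [IsManifold 𝓘(ℝ, ES) ∞ S]
  {G : Type*} [TopologicalSpace G] [ChartedSpace EG G] [Group G] [LieGroup 𝓘(ℝ, EG) ∞ G]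
  (P : TimeDependentPrincipalBundle EQ ES EG Q S G)

/-- The differential of `π_t : Q → S` at `q`, for `p = (q, t)`. -/
def dproj (p : Q × ℝ) : TangentSpace 𝓘(ℝ, EQ) p.1 →L[ℝ] TangentSpace 𝓘(ℝ, ES) (P.proj p) :=
  mfderiv 𝓘(ℝ, EQ) 𝓘(ℝ, ES) (fun q' : Q => P.proj (q', p.2)) p.1

/-- The vertical space `𝒲_t|_q = ker dπ_t(q)`, for `p = (q, t)`. -/
def vertical (p : Q × ℝ) : Submodule ℝ (TangentSpace 𝓘(ℝ, EQ) p.1) :=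
  LinearMap.ker (P.dproj p).toLinearMap

/-- The extended projection `π̲ : Q × ℝ → S × ℝ`, `π̲(q, t) = (π_t(q), t)`. -/
def extendedProj (p : Q × ℝ) : S × ℝ := (P.proj p, p.2)

/-- The differential of `π̲` at `p`. -/
def dextendedProj (p : Q × ℝ) : TangentSpace (𝓘(ℝ, EQ).prod 𝓘(ℝ, ℝ)) p →L[ℝ]
    TangentSpace (𝓘(ℝ, ES).prod 𝓘(ℝ, ℝ)) (P.extendedProj p) :=
  mfderiv (𝓘(ℝ, EQ).prod 𝓘(ℝ, ℝ)) (𝓘(ℝ, ES).prod 𝓘(ℝ, ℝ)) P.extendedProj p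

/-- The action of `G` on space-time `Q × ℝ`, `g · (q, t) = (g ·_t q, t)`, maps `ξ + τ ∂/∂t` at
`p = (q, t)` to `P.push g p ξ τ + τ ∂/∂t`. Thus `P.push g p ξ 1 = d(g ·_t)(ξ) + ∂/∂t (g ·_t q)`
is the transformation of velocities and `P.push g p η 0 = d(g ·_t)(η)` that of virtual
displacements; for a time-independent action the two agree. -/
def push (g : G) (p : Q × ℝ) (ξ : TangentSpace 𝓘(ℝ, EQ) p.1) (τ : ℝ) :
    TangentSpace 𝓘(ℝ, EQ) (P.act g p) :=
  mfderiv (𝓘(ℝ, EQ).prod 𝓘(ℝ, ℝ)) 𝓘(ℝ, EQ) (P.act g) p (spaceTimeVector p ξ τ)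

lemma dextendedProj_apply (p : Q × ℝ) (v : TangentSpace (𝓘(ℝ, EQ).prod 𝓘(ℝ, ℝ)) p) :
    P.dextendedProj p v = ((mfderiv (𝓘(ℝ, EQ).prod 𝓘(ℝ, ℝ)) 𝓘(ℝ, ES) P.proj p v, timePart v) :
      ES × ℝ) := by
  have h := mfderiv_prodMk (x := p)
    ((P.proj_smooth p).mdifferentiableAt (by simp)) (mdifferentiableAt_snd (I := 𝓘(ℝ, EQ))
      (I' := 𝓘(ℝ, ℝ)))
  have h' : P.dextendedProj p = _ := h
  rw [h']
  simp only [mfderiv_snd]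
  rfl

lemma mfderiv_proj_spaceTimeVector_zero (p : Q × ℝ) (η : TangentSpace 𝓘(ℝ, EQ) p.1) :
    mfderiv (𝓘(ℝ, EQ).prod 𝓘(ℝ, ℝ)) 𝓘(ℝ, ES) P.proj p (spaceTimeVector p η 0)
      = P.dproj p η := by
  rw [mfderiv_prod_eq_add_apply ((P.proj_smooth p).mdifferentiableAt (by simp))]
  have h1 : (spaceTimeVector p η 0 : EQ × ℝ).2 = 0 := rfl
  erw [h1, map_zero, add_zero]
  rfl

end TimeDependentPrincipalBundle

/-! ## Time-dependent Chaplygin systems -/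

/-- A time-dependent `G`-Chaplygin system `(Q, L, F, 𝒜, G)`. -/
structure ChaplyginSystem
    (EQ ES EG : Type*) [NormedAddCommGroup EQ] [NormedSpace ℝ EQ]
    [NormedAddCommGroup ES] [NormedSpace ℝ ES] [NormedAddCommGroup EG] [NormedSpace ℝ EG]
    (Q : Type*) [TopologicalSpace Q] [ChartedSpace EQ Q] [IsManifold 𝓘(ℝ, EQ) ∞ Q]
    (S : Type*) [TopologicalSpace S] [ChartedSpace ES S] [IsManifold 𝓘(ℝ, ES) ∞ S]
    (G : Type*) [TopologicalSpace G] [ChartedSpace EG G] [Group G] [LieGroup 𝓘(ℝ, EG) ∞ G]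
    extends TimeDependentPrincipalBundle EQ ES EG Q S G where
  /-- The Lagrangian `L : TQ × ℝ → ℝ`. -/
  lagrangian : TangentBundle 𝓘(ℝ, EQ) Q × ℝ → ℝ
  lagrangian_smooth : ContMDiff (𝓘(ℝ, EQ).tangent.prod 𝓘(ℝ, ℝ)) 𝓘(ℝ, ℝ) ∞ lagrangian
  lagrangian_invariant : ∀ (g : G) (p : Q × ℝ) (ξ : TangentSpace 𝓘(ℝ, EQ) p.1),
    lagrangian (⟨act g p, toTimeDependentPrincipalBundle.push g p ξ 1⟩, p.2)
      = lagrangian (⟨p.1, ξ⟩, p.2)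
  /-- The non-potential forces: the covector `F(q, q̇, t)` on `T_q Q`. -/
  force : (w : TangentBundle 𝓘(ℝ, EQ) Q) → ℝ → (TangentSpace 𝓘(ℝ, EQ) w.proj →ₗ[ℝ] ℝ)
  force_invariant : ∀ (g : G) (p : Q × ℝ) (ξ η : TangentSpace 𝓘(ℝ, EQ) p.1),
    force ⟨act g p, toTimeDependentPrincipalBundle.push g p ξ 1⟩ p.2
        (toTimeDependentPrincipalBundle.push g p η 0)
      = force ⟨p.1, ξ⟩ p.2 η
  /-- The affine constraints `𝒜_t`, of rank `m = dim S`. -/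
  constraint : AffineDistribution EQ Q (Module.finrank ℝ ES)
  /-- Transversality `T_q Q = 𝒟_t|_q ⊕ 𝒲_t|_q`. -/
  transversal : ∀ p : Q × ℝ,
    IsCompl (constraint.virtual p) (toTimeDependentPrincipalBundle.vertical p)
  constraint_invariant : ∀ (g : G) (p : Q × ℝ) (ξ : TangentSpace 𝓘(ℝ, EQ) p.1),
    ξ ∈ constraint.space p →
      toTimeDependentPrincipalBundle.push g p ξ 1 ∈ constraint.space (act g p, p.2)

namespace ChaplyginSystem

variable {EQ ES EG : Type*} [NormedAddCommGroup EQ] [NormedSpace ℝ EQ]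
  [NormedAddCommGroup ES] [NormedSpace ℝ ES] [NormedAddCommGroup EG] [NormedSpace ℝ EG]
  {Q : Type*} [TopologicalSpace Q] [ChartedSpace EQ Q] [IsManifold 𝓘(ℝ, EQ) ∞ Q]
  {S : Type*} [TopologicalSpace S] [ChartedSpace ES S] [IsManifold 𝓘(ℝ, ES) ∞ S]
  {G : Type*} [TopologicalSpace G] [ChartedSpace EG G] [Group G] [LieGroup 𝓘(ℝ, EG) ∞ G]
  (C : ChaplyginSystem EQ ES EG Q S G)

/-! ### Horizontal lifts, connection and curvature -/

lemma existsUnique_virtualLift (p : Q × ℝ) (ξ : TangentSpace 𝓘(ℝ, ES) (C.proj p)) :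
    ∃! η : TangentSpace 𝓘(ℝ, EQ) p.1, η ∈ C.constraint.virtual p ∧ C.dproj p η = ξ := by
  obtain ⟨v, hv⟩ := C.proj_submersion p.1 p.2 ξ
  have hcompl := C.transversal p
  obtain ⟨d, hd, k, hk, hdk⟩ := Submodule.mem_sup.1
    (hcompl.sup_eq_top.symm ▸ Submodule.mem_top (x := v) : v ∈ C.constraint.virtual p ⊔ C.vertical p)
  have hk' : C.dproj p k = 0 := hk
  refine ⟨d, ⟨hd, ?_⟩, ?_⟩
  · have h1 : C.dproj p (d + k) = ξ := by rw [hdk]; exact hv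
    rwa [map_add, hk', add_zero] at h1
  · rintro η ⟨hη, hη'⟩
    have h1 : C.dproj p (d + k) = ξ := by rw [hdk]; exact hv
    rw [map_add, hk', add_zero] at h1
    have h2 : η - d ∈ C.vertical p := by
      change C.dproj p (η - d) = 0
      rw [map_sub, hη', h1, sub_self]
    have h3 := Submodule.disjoint_def.1 hcompl.disjoint _ (Submodule.sub_mem _ hη hd) h2
    exact sub_eq_zero.1 h3

lemma existsUnique_horizontalLift (p : Q × ℝ)
    (w : TangentSpace (𝓘(ℝ, ES).prod 𝓘(ℝ, ℝ)) (C.extendedProj p)) :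
    ∃! v : TangentSpace (𝓘(ℝ, EQ).prod 𝓘(ℝ, ℝ)) p,
      v ∈ C.constraint.extended p ∧ C.dextendedProj p v = w := by
  obtain ⟨χ, hχ⟩ := C.constraint.exists_mem p
  have hsmooth := (C.proj_smooth p).mdifferentiableAt (by simp)
  have hcompl := C.transversal p
  have key : ∀ v : TangentSpace (𝓘(ℝ, EQ).prod 𝓘(ℝ, ℝ)) p,
      mfderiv (𝓘(ℝ, EQ).prod 𝓘(ℝ, ℝ)) 𝓘(ℝ, ES) C.proj p v
        = C.dproj p (spacePart v - timePart v • χ)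
          + timePart v • mfderiv (𝓘(ℝ, EQ).prod 𝓘(ℝ, ℝ)) 𝓘(ℝ, ES) C.proj p
              (spaceTimeVector p χ 1) := by
    intro v
    have hv : v = spaceTimeVector p (spacePart v - timePart v • χ) 0
        + timePart v • spaceTimeVector p χ 1 := by
      change (spacePart v, timePart v)
        = ((spacePart v - timePart v • χ) + timePart v • χ, (0 : ℝ) + timePart v * 1)
      ext1
      · change spacePart v = (spacePart v - timePart v • χ) + timePart v • χ
        abel
      · change timePart v = (0 : ℝ) + timePart v * 1
        ring
    conv_lhs => rw [hv]
    rw [map_add, map_smul, C.mfderiv_proj_spaceTimeVector_zero]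
  let w₁ : TangentSpace 𝓘(ℝ, ES) (C.proj p) := spacePart w
  obtain ⟨η, ⟨hη, hη'⟩, hu⟩ := C.existsUnique_virtualLift p
    (w₁ - timePart w • mfderiv (𝓘(ℝ, EQ).prod 𝓘(ℝ, ℝ)) 𝓘(ℝ, ES) C.proj p
      (spaceTimeVector p χ 1))
  have hdiff : ∀ (v : TangentSpace (𝓘(ℝ, EQ).prod 𝓘(ℝ, ℝ)) p),
      C.dextendedProj p v = w ↔ timePart v = timePart w ∧
        C.dproj p (spacePart v - timePart v • χ) = w₁
          - timePart w • mfderiv (𝓘(ℝ, EQ).prod 𝓘(ℝ, ℝ)) 𝓘(ℝ, ES) C.proj p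
            (spaceTimeVector p χ 1) := by
    intro v
    rw [C.dextendedProj_apply]
    have h1 : ((mfderiv (𝓘(ℝ, EQ).prod 𝓘(ℝ, ℝ)) 𝓘(ℝ, ES) C.proj p v, timePart v) : ES × ℝ) = w ↔
        mfderiv (𝓘(ℝ, EQ).prod 𝓘(ℝ, ℝ)) 𝓘(ℝ, ES) C.proj p v = w₁
          ∧ timePart v = timePart w :=
      Prod.ext_iff
    refine h1.trans ?_
    rw [and_comm, key v]
    refine and_congr_right fun h => ?_
    rw [h]
    exact eq_sub_iff_add_eq.symm
  refine ⟨spaceTimeVector p (η + timePart w • χ) (timePart w), ⟨?_, ?_⟩, ?_⟩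
  · rw [C.constraint.mem_extended_iff p hχ]
    change (η + timePart w • χ) - timePart w • χ ∈ C.constraint.virtual p
    rwa [add_sub_cancel_right]
  · rw [hdiff]
    refine ⟨rfl, ?_⟩
    change C.dproj p ((η + timePart w • χ) - timePart w • χ) = _
    rw [add_sub_cancel_right]
    exact hη'
  · rintro v ⟨hv, hv'⟩
    rw [C.constraint.mem_extended_iff p hχ] at hv
    rw [hdiff] at hv'
    have h2 := hu _ ⟨hv, hv'.2⟩
    have h3 : spacePart v = η + timePart w • χ := by
      rw [← hv'.1, ← h2, sub_add_cancel]
    change ((spacePart v, timePart v) : EQ × ℝ) = (η + timePart w • χ, timePart w)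
    exact Prod.ext h3 hv'.1

/-- The horizontal lift `ℍ^{(q,t)}(w) ∈ 𝒜̲_{(q,t)}` of `w ∈ T_{(π_t(q), t)}(S × ℝ)`: the unique
vector of `𝒜̲_{(q,t)}` that `dπ̲` maps to `w`. -/
def extendedLift (p : Q × ℝ) (w : TangentSpace (𝓘(ℝ, ES).prod 𝓘(ℝ, ℝ)) (C.extendedProj p)) :
    TangentSpace (𝓘(ℝ, EQ).prod 𝓘(ℝ, ℝ)) p :=
  (C.existsUnique_horizontalLift p w).choose

/-- The horizontal lift `ℍ^q_t(ξ) ∈ 𝒟_t|_q` of `ξ ∈ T_{π_t(q)} S`: the unique vector of `𝒟_t|_q`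
that `dπ_t` maps to `ξ`. -/
def horizontalLift (p : Q × ℝ) (ξ : TangentSpace 𝓘(ℝ, ES) (C.proj p)) :
    TangentSpace 𝓘(ℝ, EQ) p.1 :=
  (C.existsUnique_virtualLift p ξ).choose

/-- The affine horizontal lift `𝔸^q_t(ξ) ∈ 𝒜_t|_q` of `ξ ∈ T_{π_t(q)} S`, given by
`𝔸^q_t(ξ) + ∂/∂t = ℍ^{(q,t)}(ξ + ∂/∂t)`. -/
def affineLift (p : Q × ℝ) (ξ : TangentSpace 𝓘(ℝ, ES) (C.proj p)) :
    TangentSpace 𝓘(ℝ, EQ) p.1 :=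
  spacePart (C.extendedLift p (spaceTimeVector (C.extendedProj p) ξ 1))

/-- The horizontal component `v^h` of a tangent vector `v` to `Q × ℝ`: the vector of `𝒜̲` with the
same image under `dπ̲` as `v`. -/
def horizontalPart (p : Q × ℝ) (v : TangentSpace (𝓘(ℝ, EQ).prod 𝓘(ℝ, ℝ)) p) :
    TangentSpace (𝓘(ℝ, EQ).prod 𝓘(ℝ, ℝ)) p :=
  C.extendedLift p (C.dextendedProj p v)

/-- The connection form `Θ̲(v) = v^v = v - v^h`, the projection onto `ker dπ̲ = 𝒲_t|_q` along
`𝒜̲`. -/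
def connectionForm (p : Q × ℝ) (v : TangentSpace (𝓘(ℝ, EQ).prod 𝓘(ℝ, ℝ)) p) :
    TangentSpace (𝓘(ℝ, EQ).prod 𝓘(ℝ, ℝ)) p :=
  v - C.horizontalPart p v

/-- The curvature `B̲(u, v) = -Θ̲([X^h, Y^h])` at `p`, where `X` and `Y` are vector fields on
`Q × ℝ`, smooth near `p`, with `X(p) = u` and `Y(p) = v`. The value does not depend on the choice
of `X` and `Y`; here they have constant coefficients in the trivialization of the tangent bundle
at `p`. -/
def curvature (p : Q × ℝ) (u v : TangentSpace (𝓘(ℝ, EQ).prod 𝓘(ℝ, ℝ)) p) :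
    TangentSpace (𝓘(ℝ, EQ).prod 𝓘(ℝ, ℝ)) p :=
  -C.connectionForm p (VectorField.mlieBracket (𝓘(ℝ, EQ).prod 𝓘(ℝ, ℝ))
    (fun p' => C.horizontalPart p' (FiberBundle.extend (EQ × ℝ) u p'))
    (fun p' => C.horizontalPart p' (FiberBundle.extend (EQ × ℝ) v p')) p)

/-! ### The reduced system -/

/-- A point of the fiber of `π_t` over `y`. -/
def fiberPoint (y : S) (t : ℝ) : Q := (C.proj_surjective t y).choose

/-- The reduced Lagrangian `L_red(y, ẏ, t) = L(q, 𝔸^q_t(ẏ), t)`, with `π_t(q) = y`. -/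
def reducedLagrangian (w : TangentBundle 𝓘(ℝ, ES) S × ℝ) : ℝ :=
  let p : Q × ℝ := (C.fiberPoint w.1.proj w.2, w.2)
  C.lagrangian (⟨p.1, C.affineLift p w.1.2⟩, w.2)

/-- The reduced forces `F_red(y, ẏ, t)(ξ) = F(q, 𝔸^q_t(ẏ), t)(ℍ^q_t(ξ))`, with `π_t(q) = y`. -/
def reducedForce (w : TangentBundle 𝓘(ℝ, ES) S) (t : ℝ) (ξ : TangentSpace 𝓘(ℝ, ES) w.proj) : ℝ :=
  let p : Q × ℝ := (C.fiberPoint w.proj t, t)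
  C.force ⟨p.1, C.affineLift p w.2⟩ t (C.horizontalLift p ξ)

/-- The expression `𝔽L(q, 𝔸^q_t(ẏ), t)(B̲(ℍ^{(q,t)}(ẏ + ∂/∂t), ℍ^q_t(ξ)))` at `p = (q, t)`. -/
def jkAt (p : Q × ℝ) (Y ξ : TangentSpace 𝓘(ℝ, ES) (C.proj p)) : ℝ :=
  fiberDerivative C.lagrangian p.1 (C.affineLift p Y) p.2
    (spacePart (C.curvature p
      (C.extendedLift p (spaceTimeVector (C.extendedProj p) Y 1))
      (spaceTimeVector p (C.horizontalLift p ξ) 0)))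

/-- The JK term `JK(y, ẏ, t)(ξ)`, with `π_t(q) = y`. -/
def jkTerm (w : TangentBundle 𝓘(ℝ, ES) S) (t : ℝ) (ξ : TangentSpace 𝓘(ℝ, ES) w.proj) : ℝ :=
  C.jkAt (C.fiberPoint w.proj t, t) w.2 ξ

/-! ### Solutions -/

/-- `γ`, defined on the interval `J`, is a solution of `(Q, L, F, 𝒜)`: it is admissible and
satisfies `δL(η) + F(η) = 0` for all virtual displacements `η` along `γ`. -/
def IsSolution (J : Set ℝ) (γ : ℝ → Q) : Prop :=
  ContMDiffOn 𝓘(ℝ, ℝ) 𝓘(ℝ, EQ) ∞ γ J ∧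
  ∀ t ∈ J, velocity γ t ∈ C.constraint.space (γ t, t) ∧
    ∀ η ∈ C.constraint.virtual (γ t, t),
      variationalDerivative C.lagrangian γ t η + C.force (tangentLift γ t) t η = 0

/-- `Γ`, defined on the interval `J`, is a solution of the reduced system
`δL_red(ξ) + F_red(ξ) = JK(ξ)` for all `ξ ∈ T_{Γ(t)} S`. -/
def IsReducedSolution (J : Set ℝ) (Γ : ℝ → S) : Prop :=
  ContMDiffOn 𝓘(ℝ, ℝ) 𝓘(ℝ, ES) ∞ Γ J ∧
  ∀ t ∈ J, ∀ ξ : TangentSpace 𝓘(ℝ, ES) (Γ t),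
    variationalDerivative C.reducedLagrangian Γ t ξ + C.reducedForce (tangentLift Γ t) t ξ
      = C.jkTerm (tangentLift Γ t) t ξ

/-- `γ` is an affine horizontal lift of `Γ` on the interval `J`: `π_t(γ(t)) = Γ(t)` and
`γ'(t) = 𝔸^{γ(t)}_t(Γ'(t))`. -/
def IsAffineHorizontalLift (J : Set ℝ) (Γ : ℝ → S) (γ : ℝ → Q) : Prop :=
  ContMDiffOn 𝓘(ℝ, ℝ) 𝓘(ℝ, EQ) ∞ γ J ∧
  ∀ t ∈ J, C.proj (γ t, t) = Γ t ∧ velocity γ t = C.affineLift (γ t, t) (velocity Γ t)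

end ChaplyginSystem

end Chaplygin

end

/-!
The theorem rests on three facts about the horizontal lift `ℍ^{(q,t)}`, which is a linear map
`T(S × ℝ) → T(Q × ℝ)` with values in `𝒜̲` and a right inverse of `dπ̲`.

*Equivariance.* The action of `G` on space-time preserves `𝒜̲` and leaves `π̲` fixed, so it maps
horizontal lifts to horizontal lifts, and, by naturality of the Lie bracket, curvature to curvature.
Since the fibers of `π_t` are orbits, the reduced data may be computed at any point of a fiber
(`reducedLagrangian_eq`, `reducedForce_eq`, `jkTerm_eq`).

*Smoothness.* In charts the horizontal lift is a smooth family of linear maps, because the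
affine distribution has smooth local frames (`contDiffAt_localLift`). Composed with local sections
of the submersion `π̲`, this gives the smoothness of `L_red` (`contMDiff_reducedLagrangian`).

*Reduction of the Euler-Lagrange expression.* In charts write `K` for the horizontal lift and `π`
for the projection, so that `L(z, K_z(v, 1)) = L_red(π(z), v)`. Differentiating this identity in the
direction of a lifted vector, and with respect to `v`, and using that an admissible curve is the
lift of its projection, the Euler-Lagrange expressions of `L` and `L_red` differ by the fiber
derivative of `L` in the direction of the bracket `[K(v, 1), K(ζ, 0)]`
(`eulerLagrange_reduction`). These lifted fields project to constant fields, so the bracket is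
vertical and equals minus the curvature, and the difference is the term `JK`
(`variationalDerivative_horizontalLift`). The virtual displacements are exactly the horizontal
lifts, so the equations of motion on `Q` and on `S` correspond to each other
(`equation_horizontalLift`).

For the converse, a curve in `S` has to be lifted. In a chart of `Q × ℝ` the lifts are solutions of
an ordinary differential equation with smooth right-hand side, which gives local existence, local
uniqueness and smoothness. Uniqueness on an interval follows by connectedness. Lifts exist on the
whole interval because translates by `G` of one local lift over a neighborhood of `t` pass through
all points of the fibers over that neighborhood, so a lift never stops inside the interval
(`exists_isLiftAt_forall`).

Vectors tangent to `Q × ℝ` and `S × ℝ` are regarded throughout as elements of the model spaces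
`EQ × ℝ` and `ES × ℝ`.
-/

noncomputable section

namespace Chaplygin

/-! ### Tangent vectors in charts -/

section Charts

variable {E : Type*} [NormedAddCommGroup E] [NormedSpace ℝ E]
  {M : Type*} [TopologicalSpace M] [ChartedSpace E M]
  {F : Type*} [NormedAddCommGroup F] [NormedSpace ℝ F]

variable (E) in
/-- The derivative at `z` of the parametrization of `M` inverse to the chart at `x₀`, with its
values in a tangent space of `M` regarded as vectors of the model space `E`. -/
def paramDeriv (x₀ : M) (z : E) : E →L[ℝ] E :=
  mfderiv 𝓘(ℝ, E) 𝓘(ℝ, E) (extChartAt 𝓘(ℝ, E) x₀).symm z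

variable (E) in
/-- The derivative at `x` of the chart of `M` at `x₀`, as an endomorphism of the model space. -/
def chartDeriv (x₀ x : M) : E →L[ℝ] E :=
  mfderiv 𝓘(ℝ, E) 𝓘(ℝ, E) (extChartAt 𝓘(ℝ, E) x₀) x

variable [IsManifold 𝓘(ℝ, E) 1 M]

lemma chartDeriv_paramDeriv (x₀ : M) {z : E} (hz : z ∈ (extChartAt 𝓘(ℝ, E) x₀).target) (v : E) :
    chartDeriv E x₀ ((extChartAt 𝓘(ℝ, E) x₀).symm z) (paramDeriv E x₀ z v) = v := by
  have h := mfderiv_extChartAt_comp_mfderivWithin_extChartAt_symm (I := 𝓘(ℝ, E)) hz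
  have hr : Set.range 𝓘(ℝ, E) = Set.univ := ModelWithCorners.Boundaryless.range_eq_univ
  rw [hr, mfderivWithin_univ] at h
  exact congrArg (fun A : E →L[ℝ] E => A v) h

lemma paramDeriv_chartDeriv (x₀ : M) {x : M} (hx : x ∈ (extChartAt 𝓘(ℝ, E) x₀).source) (v : E) :
    paramDeriv E x₀ (extChartAt 𝓘(ℝ, E) x₀ x) (chartDeriv E x₀ x v) = v := by
  have h := mfderivWithin_extChartAt_symm_comp_mfderiv_extChartAt' (I := 𝓘(ℝ, E)) hx
  have hr : Set.range 𝓘(ℝ, E) = Set.univ := ModelWithCorners.Boundaryless.range_eq_univ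
  rw [hr, mfderivWithin_univ] at h
  exact congrArg (fun A : E →L[ℝ] E => A v) h

lemma chartDeriv_self (x₀ : M) : chartDeriv E x₀ x₀ = ContinuousLinearMap.id ℝ E :=
  mfderiv_extChartAt_self (I := 𝓘(ℝ, E)) (x := x₀)

lemma paramDeriv_self (x₀ : M) :
    paramDeriv E x₀ (extChartAt 𝓘(ℝ, E) x₀ x₀) = ContinuousLinearMap.id ℝ E := by
  ext v
  have h := paramDeriv_chartDeriv x₀ (mem_extChartAt_source (I := 𝓘(ℝ, E)) x₀) v
  rw [chartDeriv_self] at h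
  exact h

lemma paramDeriv_injective (x₀ : M) {z : E} (hz : z ∈ (extChartAt 𝓘(ℝ, E) x₀).target) :
    Function.Injective (paramDeriv E x₀ z) :=
  Function.LeftInverse.injective (g := chartDeriv E x₀ ((extChartAt 𝓘(ℝ, E) x₀).symm z))
    (chartDeriv_paramDeriv x₀ hz)

lemma hasMFDerivAt_chart_symm (x₀ : M) {z : E} (hz : z ∈ (extChartAt 𝓘(ℝ, E) x₀).target) :
    HasMFDerivAt 𝓘(ℝ, E) 𝓘(ℝ, E) (extChartAt 𝓘(ℝ, E) x₀).symm z (paramDeriv E x₀ z) := by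
  have h := mdifferentiableWithinAt_extChartAt_symm (I := 𝓘(ℝ, E)) hz
  have hr : Set.range 𝓘(ℝ, E) = Set.univ := ModelWithCorners.Boundaryless.range_eq_univ
  rw [hr, mdifferentiableWithinAt_univ] at h
  exact h.hasMFDerivAt

/-- The derivative of a map `g` into `M`, in terms of its expression in the chart at `x₀`. -/
lemma mfderiv_eq_paramDeriv (x₀ : M) {g : F → M} {z : F}
    (hg : MDifferentiableAt 𝓘(ℝ, F) 𝓘(ℝ, E) g z)
    (hz : g z ∈ (extChartAt 𝓘(ℝ, E) x₀).source) (v : F) :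
    (mfderiv 𝓘(ℝ, F) 𝓘(ℝ, E) g z : F →L[ℝ] E) v
      = paramDeriv E x₀ (extChartAt 𝓘(ℝ, E) x₀ (g z))
          (fderiv ℝ (fun y => extChartAt 𝓘(ℝ, E) x₀ (g y)) z v) := by
  have hz' : g z ∈ (chartAt E x₀).source := by rwa [← extChartAt_source 𝓘(ℝ, E)]
  have key : ∀ D : F →L[ℝ] E, HasMFDerivAt 𝓘(ℝ, F) 𝓘(ℝ, E) g z D →
      D v = paramDeriv E x₀ (extChartAt 𝓘(ℝ, E) x₀ (g z))
        (fderiv ℝ (fun y => extChartAt 𝓘(ℝ, E) x₀ (g y)) z v) := by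
    intro D hD
    have h1 := (mdifferentiableAt_extChartAt (I := 𝓘(ℝ, E)) hz').hasMFDerivAt.comp z hD
    have h2 : HasFDerivAt (fun y => extChartAt 𝓘(ℝ, E) x₀ (g y))
        ((chartDeriv E x₀ (g z)).comp D) z := hasMFDerivAt_iff_hasFDerivAt.1 h1
    rw [h2.fderiv]
    exact (paramDeriv_chartDeriv x₀ hz _).symm
  exact key _ hg.hasMFDerivAt

lemma differentiableAt_chart_comp (x₀ : M) {g : F → M} {z : F}
    (hg : MDifferentiableAt 𝓘(ℝ, F) 𝓘(ℝ, E) g z)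
    (hz : g z ∈ (extChartAt 𝓘(ℝ, E) x₀).source) :
    DifferentiableAt ℝ (fun y => extChartAt 𝓘(ℝ, E) x₀ (g y)) z := by
  have hz' : g z ∈ (chartAt E x₀).source := by rwa [← extChartAt_source 𝓘(ℝ, E)]
  have h1 := (mdifferentiableAt_extChartAt (I := 𝓘(ℝ, E)) hz').comp z hg
  exact mdifferentiableAt_iff_differentiableAt.1 h1

/-- The velocity of a curve, in terms of its expression in the chart at `x₀`. -/
lemma velocity_eq_paramDeriv (x₀ : M) {γ : ℝ → M} {t : ℝ}
    (hγ : MDifferentiableAt 𝓘(ℝ, ℝ) 𝓘(ℝ, E) γ t)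
    (ht : γ t ∈ (extChartAt 𝓘(ℝ, E) x₀).source) :
    (velocity γ t : E) = paramDeriv E x₀ (extChartAt 𝓘(ℝ, E) x₀ (γ t))
      (deriv (fun s => extChartAt 𝓘(ℝ, E) x₀ (γ s)) t) := by
  rw [← fderiv_apply_one_eq_deriv]
  exact mfderiv_eq_paramDeriv x₀ hγ ht 1

lemma trivializationAt_snd (x₀ : M) {w : TangentBundle 𝓘(ℝ, E) M}
    (hw : w.proj ∈ (extChartAt 𝓘(ℝ, E) x₀).source) :
    (trivializationAt E (TangentSpace 𝓘(ℝ, E)) x₀ w).2 = chartDeriv E x₀ w.proj w.2 := by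
  have hw' : w.proj ∈ (chartAt E x₀).source := by rwa [← extChartAt_source 𝓘(ℝ, E)]
  have h := TangentBundle.continuousLinearMapAt_trivializationAt (I := 𝓘(ℝ, E)) hw'
  have h2 : (trivializationAt E (TangentSpace 𝓘(ℝ, E)) x₀).continuousLinearMapAt ℝ w.proj w.2
      = chartDeriv E x₀ w.proj w.2 := congrArg (fun A : E →L[ℝ] E => A w.2) h
  rw [← h2, Bundle.Trivialization.continuousLinearMapAt_apply,
    Bundle.Trivialization.coe_linearMapAt_of_mem]
  exact hw'

/-- A map into the tangent bundle is smooth at a point over `x₀` if its expression in the chart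
at `x₀` is. -/
lemma contMDiffAt_paramDeriv {E' : Type*} [NormedAddCommGroup E'] [NormedSpace ℝ E']
    {H' : Type*} [TopologicalSpace H'] {J : ModelWithCorners ℝ E' H'}
    {N : Type*} [TopologicalSpace N] [ChartedSpace H' N] [IsManifold 𝓘(ℝ, E) ∞ M] (x₀ : M)
    {a u : N → E} {y₀ : N} (ha : ContMDiffAt J 𝓘(ℝ, E) ∞ a y₀) (hu : ContMDiffAt J 𝓘(ℝ, E) ∞ u y₀)
    (hy₀ : a y₀ = extChartAt 𝓘(ℝ, E) x₀ x₀) :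
    ContMDiffAt J 𝓘(ℝ, E).tangent ∞
      (fun y => (⟨(extChartAt 𝓘(ℝ, E) x₀).symm (a y), paramDeriv E x₀ (a y) (u y)⟩ :
        TangentBundle 𝓘(ℝ, E) M)) y₀ := by
  have hmem : a y₀ ∈ (extChartAt 𝓘(ℝ, E) x₀).target := by
    rw [hy₀]; exact mem_extChartAt_target x₀
  have hbase : (extChartAt 𝓘(ℝ, E) x₀).symm (a y₀) = x₀ := by
    rw [hy₀]; exact extChartAt_to_inv x₀
  have hev : ∀ᶠ y in 𝓝 y₀, a y ∈ (extChartAt 𝓘(ℝ, E) x₀).target :=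
    ha.continuousAt.eventually_mem ((isOpen_extChartAt_target x₀).mem_nhds hmem)
  refine (Bundle.contMDiffAt_totalSpace).2 ⟨?_, ?_⟩
  · exact ((contMDiffOn_extChartAt_symm x₀).contMDiffAt
      ((isOpen_extChartAt_target x₀).mem_nhds hmem)).comp y₀ ha
  · refine hu.congr_of_eventuallyEq ?_
    filter_upwards [hev] with y hy
    simp only [hbase]
    rw [trivializationAt_snd x₀ ((extChartAt 𝓘(ℝ, E) x₀).map_target hy)]
    exact chartDeriv_paramDeriv x₀ hy (u y)

/-- The expression in the chart at `x₀` of a map into the tangent bundle that is smooth at a point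
over `x₀`. -/
lemma contMDiffAt_chartDeriv {E' : Type*} [NormedAddCommGroup E'] [NormedSpace ℝ E']
    {H' : Type*} [TopologicalSpace H'] {J : ModelWithCorners ℝ E' H'}
    {N : Type*} [TopologicalSpace N] [ChartedSpace H' N] [IsManifold 𝓘(ℝ, E) ∞ M]
    {f : N → TangentBundle 𝓘(ℝ, E) M} {y₀ : N} (hf : ContMDiffAt J 𝓘(ℝ, E).tangent ∞ f y₀) :
    ContMDiffAt J 𝓘(ℝ, E) ∞ (fun y => chartDeriv E (f y₀).proj (f y).proj (f y).2) y₀ := by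
  obtain ⟨h1, h2⟩ := (Bundle.contMDiffAt_totalSpace).1 hf
  refine h2.congr_of_eventuallyEq ?_
  filter_upwards [h1.continuousAt.eventually_mem
    ((isOpen_extChartAt_source (I := 𝓘(ℝ, E)) (f y₀).proj).mem_nhds
      (mem_extChartAt_source (f y₀).proj))] with y hy
  exact (trivializationAt_snd _ hy).symm

end Charts

/-! ### Horizontal lifts as linear maps -/

namespace ChaplyginSystem

variable {EQ ES EG : Type*} [NormedAddCommGroup EQ] [NormedSpace ℝ EQ]
  [NormedAddCommGroup ES] [NormedSpace ℝ ES] [NormedAddCommGroup EG] [NormedSpace ℝ EG]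
  {Q : Type*} [TopologicalSpace Q] [ChartedSpace EQ Q] [IsManifold 𝓘(ℝ, EQ) ∞ Q]
  {S : Type*} [TopologicalSpace S] [ChartedSpace ES S] [IsManifold 𝓘(ℝ, ES) ∞ S]
  {G : Type*} [TopologicalSpace G] [ChartedSpace EG G] [Group G] [LieGroup 𝓘(ℝ, EG) ∞ G]
  (C : ChaplyginSystem EQ ES EG Q S G)

/-- The differential of the extended projection `π̲ : Q × ℝ → S × ℝ` at `p`, as a map of model
spaces. -/
def dProj (p : Q × ℝ) : EQ × ℝ →L[ℝ] ES × ℝ := C.dextendedProj p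

/-- The subspace `𝒜̲` at `p`, as a subspace of the model space of `Q × ℝ`. -/
def horizontal (p : Q × ℝ) : Submodule ℝ (EQ × ℝ) := C.constraint.extended p

lemma dProj_snd (p : Q × ℝ) (v : EQ × ℝ) : (C.dProj p v).2 = v.2 :=
  congrArg Prod.snd (C.dextendedProj_apply p v)

lemma dProj_fst (p : Q × ℝ) (v : EQ × ℝ) :
    (C.dProj p v).1 = (mfderiv (𝓘(ℝ, EQ).prod 𝓘(ℝ, ℝ)) 𝓘(ℝ, ES) C.proj p : EQ × ℝ → ES) v :=
  congrArg Prod.fst (C.dextendedProj_apply p v)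

/-- The horizontal lift `ℍ^p` from the model space of `S × ℝ` to that of `Q × ℝ`. -/
def hLift (p : Q × ℝ) (w : ES × ℝ) : EQ × ℝ := C.extendedLift p w

/-- Membership in `𝒜̲`, in terms of a vector `χ` of the affine space `𝒜_t|_q`. -/
lemma mem_horizontal_iff (p : Q × ℝ) {χ : TangentSpace 𝓘(ℝ, EQ) p.1} (hχ : χ ∈ C.constraint.space p)
    (ξ : TangentSpace 𝓘(ℝ, EQ) p.1) (τ : ℝ) :
    ((ξ, τ) : EQ × ℝ) ∈ C.horizontal p ↔ ξ - τ • χ ∈ C.constraint.virtual p :=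
  C.constraint.mem_extended_iff p hχ _

lemma hLift_mem (p : Q × ℝ) (w : ES × ℝ) : C.hLift p w ∈ C.horizontal p :=
  (C.existsUnique_horizontalLift p w).choose_spec.1.1

lemma dProj_hLift (p : Q × ℝ) (w : ES × ℝ) : C.dProj p (C.hLift p w) = w :=
  (C.existsUnique_horizontalLift p w).choose_spec.1.2

lemma hLift_dProj (p : Q × ℝ) {v : EQ × ℝ} (hv : v ∈ C.horizontal p) :
    C.hLift p (C.dProj p v) = v :=
  (C.existsUnique_horizontalLift p (C.dProj p v)).unique
    ⟨C.hLift_mem p _, C.dProj_hLift p _⟩ ⟨hv, rfl⟩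

lemma hLift_snd (p : Q × ℝ) (w : ES × ℝ) : (C.hLift p w).2 = w.2 := by
  rw [← C.dProj_snd p, C.dProj_hLift]

lemma hLift_add (p : Q × ℝ) (w w' : ES × ℝ) :
    C.hLift p (w + w') = C.hLift p w + C.hLift p w' := by
  have h := C.hLift_dProj p ((C.horizontal p).add_mem (C.hLift_mem p w) (C.hLift_mem p w'))
  rwa [map_add, C.dProj_hLift, C.dProj_hLift] at h

lemma hLift_smul (p : Q × ℝ) (a : ℝ) (w : ES × ℝ) :
    C.hLift p (a • w) = a • C.hLift p w := by
  have h := C.hLift_dProj p ((C.horizontal p).smul_mem a (C.hLift_mem p w))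
  rwa [map_smul, C.dProj_hLift] at h

lemma mem_virtual_iff (p : Q × ℝ) (η : TangentSpace 𝓘(ℝ, EQ) p.1) :
    η ∈ C.constraint.virtual p ↔ ((η, 0) : EQ × ℝ) ∈ C.horizontal p := by
  obtain ⟨χ, hχ⟩ := C.constraint.exists_mem p
  rw [C.mem_horizontal_iff p hχ, zero_smul, sub_zero]

lemma mem_space_iff (p : Q × ℝ) (ξ : TangentSpace 𝓘(ℝ, EQ) p.1) :
    ξ ∈ C.constraint.space p ↔ ((ξ, 1) : EQ × ℝ) ∈ C.horizontal p := by
  obtain ⟨χ, hχ⟩ := C.constraint.exists_mem p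
  rw [C.mem_horizontal_iff p hχ, one_smul]
  exact (AffineSubspace.vsub_right_mem_direction_iff_mem hχ ξ).symm

lemma dProj_zero (p : Q × ℝ) (η : TangentSpace 𝓘(ℝ, EQ) p.1) :
    C.dProj p ((η, 0) : EQ × ℝ) = ((C.dproj p η, 0) : ES × ℝ) :=
  Prod.ext ((C.dProj_fst p _).trans (C.mfderiv_proj_spaceTimeVector_zero p η)) (C.dProj_snd p _)

lemma mk_horizontalLift (p : Q × ℝ) (ξ : ES) :
    ((C.horizontalLift p ξ, 0) : EQ × ℝ) = C.hLift p (ξ, 0) := by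
  obtain ⟨h1, h2⟩ := (C.existsUnique_virtualLift p ξ).choose_spec.1
  have h4 := C.hLift_dProj p ((C.mem_virtual_iff p _).1 h1)
  rw [C.dProj_zero] at h4
  refine h4.symm.trans ?_
  exact congrArg (fun x : ES => C.hLift p (x, 0)) h2

lemma mk_affineLift (p : Q × ℝ) (ξ : ES) :
    ((C.affineLift p ξ, 1) : EQ × ℝ) = C.hLift p (ξ, 1) :=
  Prod.ext rfl (C.hLift_snd p (ξ, 1)).symm

lemma horizontalLift_eq (p : Q × ℝ) (ξ : ES) :
    (C.horizontalLift p ξ : EQ) = (C.hLift p (ξ, 0)).1 :=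
  congrArg Prod.fst (C.mk_horizontalLift p ξ)

lemma affineLift_mem (p : Q × ℝ) (ξ : TangentSpace 𝓘(ℝ, ES) (C.proj p)) :
    C.affineLift p ξ ∈ C.constraint.space p := by
  have h : ∀ x : ES, ((C.affineLift p x, 1) : EQ × ℝ) ∈ C.horizontal p := fun x => by
    rw [C.mk_affineLift p x]
    exact C.hLift_mem p _
  exact (C.mem_space_iff p _).2 (h ξ)

lemma horizontalLift_mem (p : Q × ℝ) (ξ : TangentSpace 𝓘(ℝ, ES) (C.proj p)) :
    C.horizontalLift p ξ ∈ C.constraint.virtual p :=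
  (C.existsUnique_virtualLift p ξ).choose_spec.1.1

/-- A virtual displacement is the horizontal lift of its projection. -/
lemma horizontalLift_dproj {p : Q × ℝ} {η : TangentSpace 𝓘(ℝ, EQ) p.1}
    (hη : η ∈ C.constraint.virtual p) : C.horizontalLift p (C.dproj p η) = η :=
  (C.existsUnique_virtualLift p (C.dproj p η)).unique
    (C.existsUnique_virtualLift p _).choose_spec.1 ⟨hη, rfl⟩

end ChaplyginSystem

/-! ### Space-time in charts -/

section SpaceTimeCharts

variable {E : Type*} [NormedAddCommGroup E] [NormedSpace ℝ E]
  {M : Type*} [TopologicalSpace M] [ChartedSpace E M]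
  {F : Type*} [NormedAddCommGroup F] [NormedSpace ℝ F]

/-- The parametrization of `M × ℝ` near `p₀` given by the chart of `M` at `p₀.1`. -/
def param (p₀ : M × ℝ) (z : E × ℝ) : M × ℝ := ((extChartAt 𝓘(ℝ, E) p₀.1).symm z.1, z.2)

/-- The point of the model space of `M × ℝ` that `param p₀` maps to `p₀`. -/
def center (E : Type*) [NormedAddCommGroup E] [NormedSpace ℝ E] {M : Type*} [TopologicalSpace M]
    [ChartedSpace E M] (p₀ : M × ℝ) : E × ℝ := (extChartAt 𝓘(ℝ, E) p₀.1 p₀.1, p₀.2)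

/-- The derivative of `param p₀` at `z`, as an endomorphism of the model space. -/
def dParam (p₀ : M × ℝ) (z : E × ℝ) : E × ℝ →L[ℝ] E × ℝ :=
  (paramDeriv E p₀.1 z.1).prodMap (ContinuousLinearMap.id ℝ ℝ)

lemma param_center (p₀ : M × ℝ) : param p₀ (center E p₀) = p₀ :=
  Prod.ext (extChartAt_to_inv p₀.1) rfl

lemma dParam_apply (p₀ : M × ℝ) (z v : E × ℝ) :
    dParam p₀ z v = (paramDeriv E p₀.1 z.1 v.1, v.2) := rfl

variable [IsManifold 𝓘(ℝ, E) ∞ M]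

lemma dParam_center (p₀ : M × ℝ) (v : E × ℝ) : dParam p₀ (center E p₀) v = v := by
  rw [dParam_apply]
  change (paramDeriv E p₀.1 (extChartAt 𝓘(ℝ, E) p₀.1 p₀.1) v.1, v.2) = v
  rw [paramDeriv_self]
  rfl

lemma dParam_injective (p₀ : M × ℝ) {z : E × ℝ}
    (hz : z.1 ∈ (extChartAt 𝓘(ℝ, E) p₀.1).target) : Function.Injective (dParam p₀ z) := by
  intro v w h
  rw [dParam_apply, dParam_apply, Prod.ext_iff] at h
  exact Prod.ext (paramDeriv_injective p₀.1 hz h.1) h.2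

lemma contMDiffAt_param (p₀ : M × ℝ) {z : E × ℝ}
    (hz : z.1 ∈ (extChartAt 𝓘(ℝ, E) p₀.1).target) :
    ContMDiffAt 𝓘(ℝ, E × ℝ) (𝓘(ℝ, E).prod 𝓘(ℝ, ℝ)) ∞ (param p₀) z := by
  refine ContMDiffAt.prodMk ?_ ?_
  · exact ((contMDiffOn_extChartAt_symm p₀.1).contMDiffAt
      ((isOpen_extChartAt_target p₀.1).mem_nhds hz)).comp z contDiffAt_fst.contMDiffAt
  · exact contDiffAt_snd.contMDiffAt

lemma hasMFDerivAt_param (p₀ : M × ℝ) {z : E × ℝ}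
    (hz : z.1 ∈ (extChartAt 𝓘(ℝ, E) p₀.1).target) :
    HasMFDerivAt 𝓘(ℝ, E × ℝ) (𝓘(ℝ, E).prod 𝓘(ℝ, ℝ)) (param p₀) z (dParam p₀ z) := by
  have h1 : HasMFDerivAt 𝓘(ℝ, E × ℝ) 𝓘(ℝ, E) (Prod.fst : E × ℝ → E) z
      (ContinuousLinearMap.fst ℝ E ℝ) := hasFDerivAt_fst.hasMFDerivAt
  have h2 : HasMFDerivAt 𝓘(ℝ, E × ℝ) 𝓘(ℝ, ℝ) (Prod.snd : E × ℝ → ℝ) z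
      (ContinuousLinearMap.snd ℝ E ℝ) := hasFDerivAt_snd.hasMFDerivAt
  exact ((hasMFDerivAt_chart_symm p₀.1 hz).comp z h1).prodMk h2

end SpaceTimeCharts

/-! ### The horizontal lift in charts -/

namespace ChaplyginSystem

variable {EQ ES EG : Type*} [NormedAddCommGroup EQ] [NormedSpace ℝ EQ]
  [NormedAddCommGroup ES] [NormedSpace ℝ ES] [NormedAddCommGroup EG] [NormedSpace ℝ EG]
  {Q : Type*} [TopologicalSpace Q] [ChartedSpace EQ Q] [IsManifold 𝓘(ℝ, EQ) ∞ Q]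
  {S : Type*} [TopologicalSpace S] [ChartedSpace ES S] [IsManifold 𝓘(ℝ, ES) ∞ S]
  {G : Type*} [TopologicalSpace G] [ChartedSpace EG G] [Group G] [LieGroup 𝓘(ℝ, EG) ∞ G]
  (C : ChaplyginSystem EQ ES EG Q S G)

/-- The points of the model space of `Q × ℝ` at which the charts at `p₀` and at its projection
apply. -/
def localDomain (p₀ : Q × ℝ) : Set (EQ × ℝ) :=
  {z | z.1 ∈ (extChartAt 𝓘(ℝ, EQ) p₀.1).target ∧
    C.proj (param p₀ z) ∈ (extChartAt 𝓘(ℝ, ES) (C.proj p₀)).source}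

/-- The projection `(q, t) ↦ π_t(q)` in the charts at `p₀` and at its projection. -/
def localProj (p₀ : Q × ℝ) (z : EQ × ℝ) : ES :=
  extChartAt 𝓘(ℝ, ES) (C.proj p₀) (C.proj (param p₀ z))

/-- The extended projection `π̲` in the charts at `p₀` and at its projection. -/
def localExtProj (p₀ : Q × ℝ) (z : EQ × ℝ) : ES × ℝ := (C.localProj p₀ z, z.2)

lemma center_mem_localDomain (p₀ : Q × ℝ) : center EQ p₀ ∈ C.localDomain p₀ := by
  refine ⟨mem_extChartAt_target p₀.1, ?_⟩
  rw [param_center]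
  exact mem_extChartAt_source _

lemma localDomain_mem_nhds (p₀ : Q × ℝ) {z : EQ × ℝ} (hz : z ∈ C.localDomain p₀) :
    C.localDomain p₀ ∈ 𝓝 z := by
  have h1 : ∀ᶠ z' : EQ × ℝ in 𝓝 z, z'.1 ∈ (extChartAt 𝓘(ℝ, EQ) p₀.1).target :=
    continuousAt_fst.eventually_mem ((isOpen_extChartAt_target p₀.1).mem_nhds hz.1)
  have h2 : ContinuousAt (fun z' : EQ × ℝ => C.proj (param p₀ z')) z :=
    C.proj_smooth.continuous.continuousAt.comp (contMDiffAt_param p₀ hz.1).continuousAt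
  exact h1.and (h2.eventually_mem
    ((isOpen_extChartAt_source (I := 𝓘(ℝ, ES)) (C.proj p₀)).mem_nhds hz.2))

lemma localExtProj_center (p₀ : Q × ℝ) :
    C.localExtProj p₀ (center EQ p₀) = center ES (C.extendedProj p₀) := by
  change (extChartAt 𝓘(ℝ, ES) (C.proj p₀) (C.proj (param p₀ (center EQ p₀))), p₀.2) = _
  rw [param_center]
  rfl

lemma contDiffAt_localProj (p₀ : Q × ℝ) {z : EQ × ℝ} (hz : z ∈ C.localDomain p₀) :
    ContDiffAt ℝ ∞ (C.localProj p₀) z := by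
  have h1 := (C.proj_smooth (param p₀ z)).comp z (contMDiffAt_param p₀ hz.1)
  have h2 := (contMDiffOn_extChartAt (I := 𝓘(ℝ, ES)) (n := ∞) (x := C.proj p₀)).contMDiffAt
    (x := C.proj (param p₀ z)) (by
      rw [← extChartAt_source 𝓘(ℝ, ES)]
      exact (isOpen_extChartAt_source (I := 𝓘(ℝ, ES)) (C.proj p₀)).mem_nhds hz.2)
  exact (h2.comp z h1).contDiffAt

/-- The differential of the extended projection, in charts. -/
lemma dProj_dParam (p₀ : Q × ℝ) {z : EQ × ℝ} (hz : z ∈ C.localDomain p₀) (v : EQ × ℝ) :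
    C.dProj (param p₀ z) (dParam p₀ z v)
      = dParam (C.extendedProj p₀) (C.localExtProj p₀ z) (fderiv ℝ (C.localProj p₀) z v, v.2) := by
  refine Prod.ext ?_ (C.dProj_snd _ _)
  rw [C.dProj_fst]
  have h1 : HasMFDerivAt 𝓘(ℝ, EQ × ℝ) 𝓘(ℝ, ES) (fun z => C.proj (param p₀ z)) z _ :=
    ((C.proj_smooth (param p₀ z)).mdifferentiableAt (by simp)).hasMFDerivAt.comp z
      (hasMFDerivAt_param p₀ hz.1)
  have h2 := mfderiv_eq_paramDeriv (C.proj p₀) h1.mdifferentiableAt hz.2 v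
  rw [h1.mfderiv] at h2
  exact h2

variable [FiniteDimensional ℝ ES]

/-- The horizontal lift in the charts at `p₀` and at its projection. -/
def localLift (p₀ : Q × ℝ) (z : EQ × ℝ) : ES × ℝ →L[ℝ] EQ × ℝ :=
  LinearMap.toContinuousLinearMap
    { toFun := fun w => (chartDeriv EQ p₀.1 (param p₀ z).1 (C.hLift (param p₀ z)
          (dParam (C.extendedProj p₀) (C.localExtProj p₀ z) w)).1, w.2)
      map_add' := fun w w' => by
        rw [map_add, C.hLift_add, Prod.fst_add, map_add]
        rfl
      map_smul' := fun a w => by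
        rw [map_smul, C.hLift_smul, Prod.smul_fst, map_smul]
        rfl }

lemma localLift_snd (p₀ : Q × ℝ) (z : EQ × ℝ) (w : ES × ℝ) : (C.localLift p₀ z w).2 = w.2 := rfl

lemma dParam_localLift (p₀ : Q × ℝ) {z : EQ × ℝ} (hz : z ∈ C.localDomain p₀) (w : ES × ℝ) :
    dParam p₀ z (C.localLift p₀ z w) = C.hLift (param p₀ z)
      (dParam (C.extendedProj p₀) (C.localExtProj p₀ z) w) := by
  refine Prod.ext ?_ ?_
  · have h := paramDeriv_chartDeriv p₀.1 ((extChartAt 𝓘(ℝ, EQ) p₀.1).map_target hz.1)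
      (C.hLift (param p₀ z) (dParam (C.extendedProj p₀) (C.localExtProj p₀ z) w)).1
    rw [(extChartAt 𝓘(ℝ, EQ) p₀.1).right_inv hz.1] at h
    exact h
  · rw [C.hLift_snd]
    rfl

/-- In charts, a horizontal vector is the lift of its projection. -/
lemma eq_localLift (p₀ : Q × ℝ) {z : EQ × ℝ} (hz : z ∈ C.localDomain p₀) {v : EQ × ℝ}
    (hv : dParam p₀ z v ∈ C.horizontal (param p₀ z)) :
    C.localLift p₀ z (fderiv ℝ (C.localProj p₀) z v, v.2) = v := by
  apply dParam_injective p₀ hz.1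
  rw [C.dParam_localLift p₀ hz, ← C.dProj_dParam p₀ hz, C.hLift_dProj _ hv]

lemma fderiv_localProj_localLift (p₀ : Q × ℝ) {z : EQ × ℝ} (hz : z ∈ C.localDomain p₀)
    (w : ES × ℝ) : fderiv ℝ (C.localProj p₀) z (C.localLift p₀ z w) = w.1 := by
  have h := C.dProj_dParam p₀ hz (C.localLift p₀ z w)
  rw [C.dParam_localLift p₀ hz, C.dProj_hLift] at h
  have h2 := dParam_injective (C.extendedProj p₀)
    ((extChartAt 𝓘(ℝ, ES) (C.proj p₀)).map_source hz.2) h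
  exact (congrArg Prod.fst h2).symm

lemma localLift_center (p₀ : Q × ℝ) (w : ES × ℝ) :
    C.localLift p₀ (center EQ p₀) w = C.hLift p₀ w := by
  have h := C.dParam_localLift p₀ (C.center_mem_localDomain p₀) w
  rw [dParam_center, C.localExtProj_center, dParam_center, param_center] at h
  exact h

end ChaplyginSystem

/-! ### Smoothness of the horizontal lift -/

lemma contDiffAt_clm_prod {Z X Y V : Type*} [NormedAddCommGroup Z] [NormedSpace ℝ Z]
    [NormedAddCommGroup X] [NormedSpace ℝ X] [NormedAddCommGroup Y] [NormedSpace ℝ Y]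
    [NormedAddCommGroup V] [NormedSpace ℝ V] {f : Z → X →L[ℝ] Y} {g : Z → X →L[ℝ] V} {z₀ : Z}
    (hf : ContDiffAt ℝ ∞ f z₀) (hg : ContDiffAt ℝ ∞ g z₀) :
    ContDiffAt ℝ ∞ (fun z => (f z).prod (g z)) z₀ := by
  have h : (fun z => (f z).prod (g z)) = fun z => (ContinuousLinearMap.inl ℝ Y V).comp (f z)
      + (ContinuousLinearMap.inr ℝ Y V).comp (g z) := by
    funext z
    ext x <;> simp
  rw [h]
  exact (contDiffAt_const.clm_comp hf).add (contDiffAt_const.clm_comp hg)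

/-- If `K ∘ A = W` where `A` is surjective between spaces of equal finite dimension, then
`K = W ∘ A⁻¹`; hence `K` depends smoothly on a parameter if `A` and `W` do. -/
lemma contDiffAt_of_comp_eq {Z X Y V : Type*} [NormedAddCommGroup Z] [NormedSpace ℝ Z]
    [NormedAddCommGroup X] [NormedSpace ℝ X] [FiniteDimensional ℝ X]
    [NormedAddCommGroup Y] [NormedSpace ℝ Y] [FiniteDimensional ℝ Y]
    [NormedAddCommGroup V] [NormedSpace ℝ V]
    (hdim : Module.finrank ℝ X = Module.finrank ℝ Y)
    {A : Z → X →L[ℝ] Y} {W : Z → X →L[ℝ] V} {K : Z → Y →L[ℝ] V} {z₀ : Z}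
    (hA : ContDiffAt ℝ ∞ A z₀) (hW : ContDiffAt ℝ ∞ W z₀)
    (hsurj : ∀ᶠ z in 𝓝 z₀, Function.Surjective (A z))
    (hcomp : ∀ᶠ z in 𝓝 z₀, (K z).comp (A z) = W z) : ContDiffAt ℝ ∞ K z₀ := by
  have heq : ∀ z, Function.Surjective (A z) → ∃ e : X ≃L[ℝ] Y, (e : X →L[ℝ] Y) = A z := by
    intro z hz
    have hinj : Function.Injective (A z).toLinearMap :=
      (LinearMap.injective_iff_surjective_of_finrank_eq_finrank hdim).2 hz
    exact ⟨(LinearEquiv.ofBijective (A z).toLinearMap ⟨hinj, hz⟩).toContinuousLinearEquiv, rfl⟩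
  have : CompleteSpace X := FiniteDimensional.complete ℝ X
  obtain ⟨e, he⟩ := heq z₀ hsurj.self_of_nhds
  have hinv : ContDiffAt ℝ ∞ (fun z => (A z).inverse) z₀ :=
    ContDiffAt.comp z₀ (g := ContinuousLinearMap.inverse)
      (by rw [← he]; exact contDiffAt_map_inverse e) hA
  refine (hW.clm_comp hinv).congr_of_eventuallyEq ?_
  filter_upwards [hsurj, hcomp] with z hz hz'
  obtain ⟨e, he⟩ := heq z hz
  rw [← hz', ← he, ContinuousLinearMap.inverse_equiv]
  ext y
  simp

namespace ChaplyginSystem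

variable {EQ ES EG : Type*} [NormedAddCommGroup EQ] [NormedSpace ℝ EQ]
  [NormedAddCommGroup ES] [NormedSpace ℝ ES] [NormedAddCommGroup EG] [NormedSpace ℝ EG]
  {Q : Type*} [TopologicalSpace Q] [ChartedSpace EQ Q] [IsManifold 𝓘(ℝ, EQ) ∞ Q]
  {S : Type*} [TopologicalSpace S] [ChartedSpace ES S] [IsManifold 𝓘(ℝ, ES) ∞ S]
  {G : Type*} [TopologicalSpace G] [ChartedSpace EG G] [Group G] [LieGroup 𝓘(ℝ, EG) ∞ G]
  (C : ChaplyginSystem EQ ES EG Q S G)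

/-- In the chart at `p₀`, the distribution `𝒜̲` is spanned by smooth frame fields. -/
lemma exists_local_frame_chart (p₀ : Q × ℝ) :
    ∃ (χ : EQ × ℝ → EQ) (X : Fin (Module.finrank ℝ ES) → EQ × ℝ → EQ),
      ContDiffAt ℝ ∞ χ (center EQ p₀) ∧ (∀ i, ContDiffAt ℝ ∞ (X i) (center EQ p₀)) ∧
      ∀ᶠ z in 𝓝 (center EQ p₀), ∀ v : EQ × ℝ, dParam p₀ z v ∈ C.horizontal (param p₀ z) ↔
        ∃ a : Fin (Module.finrank ℝ ES) → ℝ, v.1 = ∑ i, a i • X i z + v.2 • χ z := by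
  obtain ⟨U, hU, hp₀, χ, X, hχ, hX, hspace⟩ := C.constraint.exists_local_frame p₀
  have hz₀ : (center EQ p₀).1 ∈ (extChartAt 𝓘(ℝ, EQ) p₀.1).target := mem_extChartAt_target p₀.1
  have hsmooth : ∀ Y : (p : Q × ℝ) → TangentSpace 𝓘(ℝ, EQ) p.1,
      ContMDiffOn (𝓘(ℝ, EQ).prod 𝓘(ℝ, ℝ)) 𝓘(ℝ, EQ).tangent ∞
        (fun p : Q × ℝ => (⟨p.1, Y p⟩ : TangentBundle 𝓘(ℝ, EQ) Q)) U →
      ContDiffAt ℝ ∞ (fun z => chartDeriv EQ p₀.1 (param p₀ z).1 (Y (param p₀ z)))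
        (center EQ p₀) := by
    intro Y hY
    have h1 := contMDiffAt_chartDeriv (hY.contMDiffAt (hU.mem_nhds hp₀))
    have h2 : ContMDiffAt 𝓘(ℝ, EQ × ℝ) (𝓘(ℝ, EQ).prod 𝓘(ℝ, ℝ)) ∞ (param p₀) (center EQ p₀) :=
      contMDiffAt_param p₀ hz₀
    exact (ContMDiffAt.comp_of_eq h1 h2 (param_center p₀)).contDiffAt
  refine ⟨_, fun i z => _, hsmooth χ hχ, fun i => hsmooth (X i) (hX i), ?_⟩
  have hev : ∀ᶠ z in 𝓝 (center EQ p₀), param p₀ z ∈ U :=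
    (contMDiffAt_param p₀ hz₀).continuousAt.eventually_mem
      (by rw [param_center]; exact hU.mem_nhds hp₀)
  filter_upwards [hev, continuousAt_fst.eventually_mem
    ((isOpen_extChartAt_target p₀.1).mem_nhds hz₀)] with z hz hz' v
  obtain ⟨-, hsp⟩ := hspace _ hz
  have hχz : χ (param p₀ z) ∈ C.constraint.space (param p₀ z) := by
    rw [hsp]; exact AffineSubspace.self_mem_mk' _ _
  have hdir : C.constraint.virtual (param p₀ z)
      = Submodule.span ℝ (Set.range fun i => X i (param p₀ z)) := by
    change (C.constraint.space (param p₀ z)).direction = _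
    rw [hsp, AffineSubspace.direction_mk']
  have h1 : dParam p₀ z v ∈ C.horizontal (param p₀ z) ↔ _ :=
    C.mem_horizontal_iff (param p₀ z) hχz (paramDeriv EQ p₀.1 z.1 v.1) v.2
  rw [h1, hdir, Submodule.mem_span_range_iff_exists_fun]
  have hinv : ∀ x : EQ, paramDeriv EQ p₀.1 z.1 (chartDeriv EQ p₀.1 (param p₀ z).1 x) = x := by
    intro x
    have h := paramDeriv_chartDeriv p₀.1 ((extChartAt 𝓘(ℝ, EQ) p₀.1).map_target hz') x
    rwa [(extChartAt 𝓘(ℝ, EQ) p₀.1).right_inv hz'] at h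
  have key : ∀ (Y : Fin (Module.finrank ℝ ES) → EQ) (ψ : EQ) (a : Fin (Module.finrank ℝ ES) → ℝ),
      ∑ i, a i • Y i = paramDeriv EQ p₀.1 z.1 v.1 - v.2 • ψ ↔
        v.1 = ∑ i, a i • chartDeriv EQ p₀.1 (param p₀ z).1 (Y i)
          + v.2 • chartDeriv EQ p₀.1 (param p₀ z).1 ψ := by
    intro Y ψ a
    rw [eq_sub_iff_add_eq, ← (paramDeriv_injective p₀.1 hz').eq_iff (a := v.1)]
    simp only [map_add, map_sum, map_smul, hinv]
    exact eq_comm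
  exact exists_congr fun a => key (fun i => X i (param p₀ z)) (χ (param p₀ z)) a

variable [FiniteDimensional ℝ ES]

/-- In charts, the horizontal lift is a smooth family of linear maps. A smooth frame of `𝒜̲` gives
isomorphisms `W` of a fixed vector space with the spaces `𝒜̲`, and the lift is `W ∘ (dπ̲ ∘ W)⁻¹`. -/
lemma contDiffAt_localLift (p₀ : Q × ℝ) :
    ContDiffAt ℝ ∞ (C.localLift p₀) (center EQ p₀) := by
  obtain ⟨χ, X, hχ, hX, hframe⟩ := C.exists_local_frame_chart p₀
  let n := Module.finrank ℝ ES
  let W : EQ × ℝ → ((Fin n → ℝ) × ℝ) →L[ℝ] EQ × ℝ := fun z =>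
    (∑ i, ((ContinuousLinearMap.proj i).comp
        (ContinuousLinearMap.fst ℝ (Fin n → ℝ) ℝ)).smulRight (X i z)
      + (ContinuousLinearMap.snd ℝ (Fin n → ℝ) ℝ).smulRight (χ z)).prod
      (ContinuousLinearMap.snd ℝ (Fin n → ℝ) ℝ)
  have hWapply : ∀ z a, W z a = (∑ i, a.1 i • X i z + a.2 • χ z, a.2) := by
    intro z a
    simp [W]
  let A : EQ × ℝ → ((Fin n → ℝ) × ℝ) →L[ℝ] ES × ℝ := fun z =>
    ((fderiv ℝ (C.localProj p₀) z).prod (ContinuousLinearMap.snd ℝ EQ ℝ)).comp (W z)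
  have hW : ContDiffAt ℝ ∞ W (center EQ p₀) := by
    refine contDiffAt_clm_prod ?_ contDiffAt_const
    refine ContDiffAt.add (ContDiffAt.sum fun i _ => ?_) ?_
    · exact contDiffAt_const.smulRight (hX i)
    · exact contDiffAt_const.smulRight hχ
  have hA : ContDiffAt ℝ ∞ A (center EQ p₀) := by
    refine ContDiffAt.clm_comp ?_ hW
    refine contDiffAt_clm_prod ?_ contDiffAt_const
    exact (C.contDiffAt_localProj p₀ (C.center_mem_localDomain p₀)).fderiv_right (by simp)
  refine contDiffAt_of_comp_eq (by simp [n]) hA hW ?_ ?_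
  · filter_upwards [hframe, C.localDomain_mem_nhds p₀ (C.center_mem_localDomain p₀)] with z hz hz' w
    have h1 : dParam p₀ z (C.localLift p₀ z w) ∈ C.horizontal (param p₀ z) := by
      rw [C.dParam_localLift p₀ hz']
      exact C.hLift_mem _ _
    obtain ⟨a, ha⟩ := (hz _).1 h1
    refine ⟨(a, w.2), ?_⟩
    have h2 : W z (a, w.2) = C.localLift p₀ z w := by
      rw [hWapply]
      exact Prod.ext ha.symm rfl
    change (fderiv ℝ (C.localProj p₀) z (W z (a, w.2)), (W z (a, w.2)).2) = w
    rw [h2, C.fderiv_localProj_localLift p₀ hz']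
    rfl
  · filter_upwards [hframe, C.localDomain_mem_nhds p₀ (C.center_mem_localDomain p₀)] with z hz hz'
    refine ContinuousLinearMap.ext fun a => ?_
    refine C.eq_localLift p₀ hz' ((hz _).2 ⟨a.1, ?_⟩)
    exact congrArg Prod.fst (hWapply z a)

end ChaplyginSystem

/-! ### The curvature in charts -/

section BracketCharts

variable {E : Type*} [NormedAddCommGroup E] [NormedSpace ℝ E]
  {M : Type*} [TopologicalSpace M] [ChartedSpace E M] [IsManifold 𝓘(ℝ, E) ∞ M]

lemma mfderiv_param (p₀ : M × ℝ) {z : E × ℝ}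
    (hz : z.1 ∈ (extChartAt 𝓘(ℝ, E) p₀.1).target) :
    (mfderivWithin 𝓘(ℝ, E × ℝ) (𝓘(ℝ, E).prod 𝓘(ℝ, ℝ))
      (extChartAt (𝓘(ℝ, E).prod 𝓘(ℝ, ℝ)) p₀).symm (Set.range (𝓘(ℝ, E).prod 𝓘(ℝ, ℝ))) z :
        E × ℝ →L[ℝ] E × ℝ) = dParam p₀ z := by
  have hr : Set.range (𝓘(ℝ, E).prod 𝓘(ℝ, ℝ)) = Set.univ :=
    ModelWithCorners.Boundaryless.range_eq_univ
  have h : ((extChartAt (𝓘(ℝ, E).prod 𝓘(ℝ, ℝ)) p₀).symm : E × ℝ → M × ℝ) = param p₀ := by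
    rw [extChartAt_prod]
    rfl
  rw [hr, mfderivWithin_univ, h]
  exact (hasMFDerivAt_param p₀ hz).mfderiv

lemma dParam_inverse (p₀ : M × ℝ) {z : E × ℝ}
    (hz : z.1 ∈ (extChartAt 𝓘(ℝ, E) p₀.1).target) (v : E × ℝ) :
    (dParam p₀ z).inverse (dParam p₀ z v) = v := by
  have h : (dParam p₀ z).inverse
      = (chartDeriv E p₀.1 (param p₀ z).1).prodMap (ContinuousLinearMap.id ℝ ℝ) := by
    refine ContinuousLinearMap.inverse_eq ?_ ?_
    · refine ContinuousLinearMap.ext fun w => Prod.ext ?_ rfl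
      have h := paramDeriv_chartDeriv p₀.1 ((extChartAt 𝓘(ℝ, E) p₀.1).map_target hz) w.1
      rwa [(extChartAt 𝓘(ℝ, E) p₀.1).right_inv hz] at h
    · refine ContinuousLinearMap.ext fun w => Prod.ext ?_ rfl
      exact chartDeriv_paramDeriv p₀.1 hz w.1
  rw [h]
  exact Prod.ext (chartDeriv_paramDeriv p₀.1 hz v.1) rfl

/-- The Lie bracket of two vector fields on `M × ℝ`, from their expressions in the chart at
`p₀`. -/
lemma mlieBracket_eq_lieBracket (p₀ : M × ℝ)
    {V W : (p : M × ℝ) → TangentSpace (𝓘(ℝ, E).prod 𝓘(ℝ, ℝ)) p} {v w : E × ℝ → E × ℝ}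
    (hv : ∀ᶠ z in 𝓝 (center E p₀), dParam p₀ z (v z) = V (param p₀ z))
    (hw : ∀ᶠ z in 𝓝 (center E p₀), dParam p₀ z (w z) = W (param p₀ z)) :
    (VectorField.mlieBracket (𝓘(ℝ, E).prod 𝓘(ℝ, ℝ)) V W p₀ : E × ℝ)
      = VectorField.lieBracket ℝ v w (center E p₀) := by
  have hr : Set.range (𝓘(ℝ, E).prod 𝓘(ℝ, ℝ)) = Set.univ :=
    ModelWithCorners.Boundaryless.range_eq_univ
  have hpull : ∀ (V : (p : M × ℝ) → TangentSpace (𝓘(ℝ, E).prod 𝓘(ℝ, ℝ)) p) (v : E × ℝ → E × ℝ),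
      (∀ᶠ z in 𝓝 (center E p₀), dParam p₀ z (v z) = V (param p₀ z)) →
      VectorField.mpullbackWithin 𝓘(ℝ, E × ℝ) (𝓘(ℝ, E).prod 𝓘(ℝ, ℝ))
        (extChartAt (𝓘(ℝ, E).prod 𝓘(ℝ, ℝ)) p₀).symm V (Set.range (𝓘(ℝ, E).prod 𝓘(ℝ, ℝ)))
        =ᶠ[𝓝 (center E p₀)] v := by
    intro V v hv
    filter_upwards [hv, continuousAt_fst.eventually_mem
      ((isOpen_extChartAt_target p₀.1).mem_nhds
        (mem_extChartAt_target (I := 𝓘(ℝ, E)) p₀.1))] with z hz hz'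
    have h1 := congrArg (fun A : E × ℝ →L[ℝ] E × ℝ => A.inverse (dParam p₀ z (v z)))
      (mfderiv_param p₀ hz')
    have h2 : ((extChartAt (𝓘(ℝ, E).prod 𝓘(ℝ, ℝ)) p₀).symm : E × ℝ → M × ℝ) = param p₀ := by
      rw [extChartAt_prod]
      rfl
    rw [VectorField.mpullbackWithin_apply]
    have h3 : V ((extChartAt (𝓘(ℝ, E).prod 𝓘(ℝ, ℝ)) p₀).symm z) = dParam p₀ z (v z) := by
      rw [h2, hz]
    exact (congrArg _ h3).trans (h1.trans (dParam_inverse p₀ hz' (v z)))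
  have hcenter : extChartAt (𝓘(ℝ, E).prod 𝓘(ℝ, ℝ)) p₀ p₀ = center E p₀ := by
    rw [extChartAt_prod]
    rfl
  rw [← VectorField.mlieBracketWithin_univ, VectorField.mlieBracketWithin_apply]
  have h1 : (mfderiv (𝓘(ℝ, E).prod 𝓘(ℝ, ℝ)) 𝓘(ℝ, E × ℝ)
      (extChartAt (𝓘(ℝ, E).prod 𝓘(ℝ, ℝ)) p₀) p₀ : E × ℝ →L[ℝ] E × ℝ)
        = ContinuousLinearMap.id ℝ (E × ℝ) := mfderiv_extChartAt_self
  have h2 : ∀ (A : E × ℝ →L[ℝ] E × ℝ) (x : E × ℝ), A = ContinuousLinearMap.id ℝ (E × ℝ) →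
      A.inverse x = x := by
    rintro A x rfl
    rw [ContinuousLinearMap.inverse_id]
    rfl
  have h3 : ∀ v' w' : E × ℝ → E × ℝ, v' =ᶠ[𝓝 (center E p₀)] v → w' =ᶠ[𝓝 (center E p₀)] w →
      VectorField.lieBracketWithin ℝ v' w' Set.univ (center E p₀)
        = VectorField.lieBracket ℝ v w (center E p₀) := by
    intro v' w' hv' hw'
    rw [VectorField.lieBracketWithin_univ]
    exact hv'.lieBracket_vectorField_eq hw'
  refine (h2 _ _ h1).trans ?_
  rw [hcenter, hr, Set.inter_univ, Set.preimage_univ]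
  rw [hr] at hpull
  exact h3 _ _ (hpull V v hv) (hpull W w hw)

/-- Near `p₀`, the extension of a tangent vector at `p₀` has constant coefficients in the chart at
`p₀`. -/
lemma extend_param (p₀ : M × ℝ) (u : E × ℝ) {z : E × ℝ}
    (hz : z.1 ∈ (extChartAt 𝓘(ℝ, E) p₀.1).target) :
    (FiberBundle.extend (E × ℝ) (E := TangentSpace (𝓘(ℝ, E).prod 𝓘(ℝ, ℝ))) (x := p₀) u
      (param p₀ z) : E × ℝ) = dParam p₀ z u := by
  have hz' : (param p₀ z).1 ∈ (extChartAt 𝓘(ℝ, E) p₀.1).source :=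
    (extChartAt 𝓘(ℝ, E) p₀.1).map_target hz
  have hsrc : param p₀ z ∈ (chartAt (ModelProd E ℝ) p₀).source := by
    rw [← extChartAt_source (𝓘(ℝ, E).prod 𝓘(ℝ, ℝ)), extChartAt_prod]
    exact ⟨hz', by simp [chartAt_self_eq]⟩
  have hcoord : extChartAt (𝓘(ℝ, E).prod 𝓘(ℝ, ℝ)) p₀ (param p₀ z) = z := by
    rw [extChartAt_prod]
    exact Prod.ext ((extChartAt 𝓘(ℝ, E) p₀.1).right_inv hz) rfl
  have h1 := TangentBundle.symmL_trivializationAt (I := 𝓘(ℝ, E).prod 𝓘(ℝ, ℝ)) hsrc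
  rw [hcoord] at h1
  have h2 : ∀ x : E × ℝ, (trivializationAt (E × ℝ) (TangentSpace (𝓘(ℝ, E).prod 𝓘(ℝ, ℝ)))
      p₀).symm (param p₀ z) x = dParam p₀ z x := by
    intro x
    have h3 := congrArg (fun A : E × ℝ →L[ℝ] E × ℝ => A x) (h1.trans (mfderiv_param p₀ hz))
    exact (Bundle.Trivialization.symmL_apply _ (by exact hsrc) x).symm.trans h3
  have h4 : (trivializationAt (E × ℝ) (TangentSpace (𝓘(ℝ, E).prod 𝓘(ℝ, ℝ))) p₀
      ⟨p₀, u⟩).2 = u := by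
    have h5 := TangentBundle.continuousLinearMapAt_trivializationAt
      (I := 𝓘(ℝ, E).prod 𝓘(ℝ, ℝ)) (mem_chart_source (ModelProd E ℝ) p₀)
    have h6 := congrArg (fun A : E × ℝ →L[ℝ] E × ℝ => A u) (h5.trans mfderiv_extChartAt_self)
    have h7 : (trivializationAt (E × ℝ) (TangentSpace (𝓘(ℝ, E).prod 𝓘(ℝ, ℝ)))
      p₀).continuousLinearMapAt ℝ p₀ u = u := h6
    rwa [Bundle.Trivialization.continuousLinearMapAt_apply,
      Bundle.Trivialization.coe_linearMapAt_of_mem] at h7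
    exact FiberBundle.mem_baseSet_trivializationAt' p₀
  have h8 := h2 (trivializationAt (E × ℝ) (TangentSpace (𝓘(ℝ, E).prod 𝓘(ℝ, ℝ))) p₀
      ⟨p₀, u⟩).2
  exact h8.trans (congrArg _ h4)

end BracketCharts

lemma two_le_infty : (2 : WithTop ℕ∞) ≤ ∞ :=
  WithTop.coe_le_coe.2 (le_top : (2 : ℕ∞) ≤ ⊤)

/-- The Lie bracket of two fields `z ↦ K(z) f(z)`, in terms of the bracket of the fields with
`f` frozen at `z₀`. -/
lemma lieBracket_clm_apply {E Y : Type*} [NormedAddCommGroup E] [NormedSpace ℝ E]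
    [NormedAddCommGroup Y] [NormedSpace ℝ Y] {K : E → Y →L[ℝ] E} {f g : E → Y} {z₀ : E}
    (hK : DifferentiableAt ℝ K z₀) (hf : DifferentiableAt ℝ f z₀) (hg : DifferentiableAt ℝ g z₀) :
    VectorField.lieBracket ℝ (fun z => K z (f z)) (fun z => K z (g z)) z₀
      = VectorField.lieBracket ℝ (fun z => K z (f z₀)) (fun z => K z (g z₀)) z₀
        + K z₀ (fderiv ℝ g z₀ (K z₀ (f z₀)) - fderiv ℝ f z₀ (K z₀ (g z₀))) := by
  have h : ∀ h : E → Y, DifferentiableAt ℝ h z₀ → ∀ v, fderiv ℝ (fun z => K z (h z)) z₀ v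
      = fderiv ℝ (fun z => K z (h z₀)) z₀ v + K z₀ (fderiv ℝ h z₀ v) := by
    intro h hh v
    rw [fderiv_clm_apply hK hh, fderiv_clm_apply hK (differentiableAt_const _)]
    simp [add_comm]
  rw [VectorField.lieBracket_eq, VectorField.lieBracket_eq]
  dsimp only
  rw [h f hf, h g hg, map_sub]
  abel

namespace ChaplyginSystem

variable {EQ ES EG : Type*} [NormedAddCommGroup EQ] [NormedSpace ℝ EQ]
  [NormedAddCommGroup ES] [NormedSpace ℝ ES] [NormedAddCommGroup EG] [NormedSpace ℝ EG]
  {Q : Type*} [TopologicalSpace Q] [ChartedSpace EQ Q] [IsManifold 𝓘(ℝ, EQ) ∞ Q]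
  {S : Type*} [TopologicalSpace S] [ChartedSpace ES S] [IsManifold 𝓘(ℝ, ES) ∞ S]
  {G : Type*} [TopologicalSpace G] [ChartedSpace EG G] [Group G] [LieGroup 𝓘(ℝ, EG) ∞ G]
  (C : ChaplyginSystem EQ ES EG Q S G)

lemma contDiffAt_localExtProj (p₀ : Q × ℝ) {z : EQ × ℝ} (hz : z ∈ C.localDomain p₀) :
    ContDiffAt ℝ ∞ (C.localExtProj p₀) z :=
  (C.contDiffAt_localProj p₀ hz).prodMk contDiffAt_snd

lemma fderiv_localExtProj (p₀ : Q × ℝ) {z : EQ × ℝ} (hz : z ∈ C.localDomain p₀) (v : EQ × ℝ) :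
    fderiv ℝ (C.localExtProj p₀) z v = (fderiv ℝ (C.localProj p₀) z v, v.2) := by
  have h : HasFDerivAt (C.localExtProj p₀) _ z :=
    ((C.contDiffAt_localProj p₀ hz).differentiableAt (by simp)).hasFDerivAt.prodMk hasFDerivAt_snd
  rw [h.fderiv]
  rfl

lemma dProj_eq_fderiv (p₀ : Q × ℝ) (v : EQ × ℝ) :
    C.dProj p₀ v = fderiv ℝ (C.localExtProj p₀) (center EQ p₀) v := by
  have h := C.dProj_dParam p₀ (C.center_mem_localDomain p₀) v
  rw [C.localExtProj_center, dParam_center, dParam_center, param_center] at h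
  rw [h, C.fderiv_localExtProj p₀ (C.center_mem_localDomain p₀)]

variable [FiniteDimensional ℝ ES]

/-- The Lie bracket, in charts, of the horizontal lifts of the constant vector fields `w`, `w'`
on `S × ℝ`. -/
def localBracket (p₀ : Q × ℝ) (w w' : ES × ℝ) : EQ × ℝ :=
  VectorField.lieBracket ℝ (fun z => C.localLift p₀ z w) (fun z => C.localLift p₀ z w')
    (center EQ p₀)

/-- The lifted fields project to constant fields, so their bracket is vertical. -/
lemma dProj_localBracket (p₀ : Q × ℝ) (w w' : ES × ℝ) :
    C.dProj p₀ (C.localBracket p₀ w w') = 0 := by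
  have hz₀ := C.center_mem_localDomain p₀
  have hd : ∀ w, DifferentiableAt ℝ (fun z => C.localLift p₀ z w) (center EQ p₀) := fun w =>
    ((C.contDiffAt_localLift p₀).differentiableAt (by simp)).clm_apply (differentiableAt_const w)
  have hconst : ∀ w, (fun z => fderiv ℝ (C.localExtProj p₀) z (C.localLift p₀ z w))
      =ᶠ[𝓝 (center EQ p₀)] fun _ => w := by
    intro w
    filter_upwards [C.localDomain_mem_nhds p₀ hz₀] with z hz
    rw [C.fderiv_localExtProj p₀ hz, C.fderiv_localProj_localLift p₀ hz, C.localLift_snd]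
  rw [C.dProj_eq_fderiv, localBracket,
    VectorField.fderiv_apply_lieBracket (C.contDiffAt_localExtProj p₀ hz₀)
      (by simpa using two_le_infty) (hd w') (hd w),
    (hconst w).fderiv_eq, (hconst w').fderiv_eq]
  simp

/-- The curvature `B̲(u, v)` is minus the bracket of the lifts of any fields on `S × ℝ`, here
constant ones, with the values `dπ̲(u)` and `dπ̲(v)`. -/
lemma curvature_eq (p₀ : Q × ℝ) (u v : EQ × ℝ) :
    (C.curvature p₀ u v : EQ × ℝ) = -C.localBracket p₀ (C.dProj p₀ u) (C.dProj p₀ v) := by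
  have hz₀ := C.center_mem_localDomain p₀
  let f : EQ × ℝ → EQ × ℝ → ES × ℝ := fun u z => fderiv ℝ (C.localExtProj p₀) z u
  have hf : ∀ u, DifferentiableAt ℝ (f u) (center EQ p₀) := by
    intro u
    have h : ContDiffAt ℝ ∞ (fderiv ℝ (C.localExtProj p₀)) (center EQ p₀) :=
      (C.contDiffAt_localExtProj p₀ hz₀).fderiv_right (by simp)
    exact (h.differentiableAt (by simp)).clm_apply (differentiableAt_const u)
  have hfield : ∀ u : EQ × ℝ, ∀ᶠ z in 𝓝 (center EQ p₀),
      dParam p₀ z (C.localLift p₀ z (f u z)) = C.horizontalPart (param p₀ z)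
        (FiberBundle.extend (EQ × ℝ) (E := TangentSpace (𝓘(ℝ, EQ).prod 𝓘(ℝ, ℝ))) (x := p₀) u
          (param p₀ z)) := by
    intro u
    filter_upwards [C.localDomain_mem_nhds p₀ hz₀] with z hz
    have h1 := congrArg (fun x : EQ × ℝ => C.hLift (param p₀ z) (C.dProj (param p₀ z) x))
      (extend_param p₀ u hz.1)
    refine Eq.trans ?_ h1.symm
    rw [C.dParam_localLift p₀ hz, C.dProj_dParam p₀ hz]
    simp only [f, C.fderiv_localExtProj p₀ hz]
  have hbr := mlieBracket_eq_lieBracket (E := EQ) p₀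
    (V := fun p' => C.horizontalPart p' (FiberBundle.extend (EQ × ℝ)
      (E := TangentSpace (𝓘(ℝ, EQ).prod 𝓘(ℝ, ℝ))) (x := p₀) u p'))
    (W := fun p' => C.horizontalPart p' (FiberBundle.extend (EQ × ℝ)
      (E := TangentSpace (𝓘(ℝ, EQ).prod 𝓘(ℝ, ℝ))) (x := p₀) v p')) (hfield u) (hfield v)
  rw [lieBracket_clm_apply ((C.contDiffAt_localLift p₀).differentiableAt (by simp)) (hf u)
    (hf v)] at hbr
  have hcurv : ∀ X Y : EQ × ℝ, X = Y → (C.connectionForm p₀ X : EQ × ℝ)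
      = Y - C.hLift p₀ (C.dProj p₀ Y) := by
    rintro X Y rfl
    rfl
  have hvert : ∀ (B : EQ × ℝ) (y : ES × ℝ), C.dProj p₀ B = 0 →
      B + C.localLift p₀ (center EQ p₀) y
        - C.hLift p₀ (C.dProj p₀ (B + C.localLift p₀ (center EQ p₀) y)) = B := by
    intro B y hB
    rw [map_add, hB, zero_add, C.localLift_center, C.dProj_hLift, add_sub_cancel_right]
  rw [C.dProj_eq_fderiv p₀ u, C.dProj_eq_fderiv p₀ v]
  exact congrArg (fun X : EQ × ℝ => -X)
    ((hcurv _ _ hbr).trans (hvert _ _ (C.dProj_localBracket p₀ _ _)))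

end ChaplyginSystem

/-! ### Invariance under the action -/

namespace ChaplyginSystem

variable {EQ ES EG : Type*} [NormedAddCommGroup EQ] [NormedSpace ℝ EQ]
  [NormedAddCommGroup ES] [NormedSpace ℝ ES] [NormedAddCommGroup EG] [NormedSpace ℝ EG]
  {Q : Type*} [TopologicalSpace Q] [ChartedSpace EQ Q] [IsManifold 𝓘(ℝ, EQ) ∞ Q]
  {S : Type*} [TopologicalSpace S] [ChartedSpace ES S] [IsManifold 𝓘(ℝ, ES) ∞ S]
  {G : Type*} [TopologicalSpace G] [ChartedSpace EG G] [Group G] [LieGroup 𝓘(ℝ, EG) ∞ G]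
  (C : ChaplyginSystem EQ ES EG Q S G)

/-- The action of `G` on space-time, `g · (q, t) = (g ·_t q, t)`. -/
def actST (g : G) (p : Q × ℝ) : Q × ℝ := (C.act g p, p.2)

/-- The differential of the action of `g` on space-time. -/
def dAct (g : G) (p : Q × ℝ) : EQ × ℝ →L[ℝ] EQ × ℝ :=
  ContinuousLinearMap.prod (mfderiv (𝓘(ℝ, EQ).prod 𝓘(ℝ, ℝ)) 𝓘(ℝ, EQ) (C.act g) p)
    (ContinuousLinearMap.snd ℝ EQ ℝ)

lemma dAct_snd (g : G) (p : Q × ℝ) (v : EQ × ℝ) : (C.dAct g p v).2 = v.2 := rfl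

lemma contMDiff_act (g : G) : ContMDiff (𝓘(ℝ, EQ).prod 𝓘(ℝ, ℝ)) 𝓘(ℝ, EQ) ∞ (C.act g) :=
  C.act_smooth.comp (contMDiff_const.prodMk contMDiff_id)

lemma proj_actST (g : G) (p : Q × ℝ) : C.proj (C.actST g p) = C.proj p :=
  ((C.proj_eq_iff p.1 (C.act g p) p.2).2 ⟨g, rfl⟩).symm

lemma extendedProj_actST (g : G) (p : Q × ℝ) : C.extendedProj (C.actST g p) = C.extendedProj p :=
  Prod.ext (C.proj_actST g p) rfl

lemma dProj_dAct (g : G) (p : Q × ℝ) (v : EQ × ℝ) :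
    C.dProj (C.actST g p) (C.dAct g p v) = C.dProj p v := by
  refine Prod.ext ?_ ?_
  · rw [C.dProj_fst, C.dProj_fst]
    have h1 : HasMFDerivAt (𝓘(ℝ, EQ).prod 𝓘(ℝ, ℝ)) (𝓘(ℝ, EQ).prod 𝓘(ℝ, ℝ)) (C.actST g) p
        (C.dAct g p) :=
      (((C.contMDiff_act g) p).mdifferentiableAt (by simp)).hasMFDerivAt.prodMk
        (hasMFDerivAt_snd p)
    have h2 := ((C.proj_smooth (C.actST g p)).mdifferentiableAt (by simp)).hasMFDerivAt.comp p h1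
    have h3 : C.proj ∘ C.actST g = C.proj := funext (C.proj_actST g)
    rw [h3] at h2
    exact congrArg (fun A : EQ × ℝ →L[ℝ] ES => A v) h2.mfderiv.symm
  · rw [C.dProj_snd, C.dProj_snd, C.dAct_snd]

lemma dAct_mem (g : G) (p : Q × ℝ) {v : EQ × ℝ} (hv : v ∈ C.horizontal p) :
    C.dAct g p v ∈ C.horizontal (C.actST g p) := by
  have h : C.horizontal p ≤ (C.horizontal (C.actST g p)).comap (C.dAct g p).toLinearMap := by
    refine Submodule.span_le.2 ?_
    rintro _ ⟨ξ, hξ, rfl⟩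
    exact (C.mem_space_iff (C.actST g p) _).1 (C.constraint_invariant g p ξ hξ)
  exact h hv

/-- Horizontal lifts are mapped to horizontal lifts. -/
lemma hLift_actST (g : G) (p : Q × ℝ) (w : ES × ℝ) :
    C.hLift (C.actST g p) w = C.dAct g p (C.hLift p w) := by
  have h := C.hLift_dProj (C.actST g p) (C.dAct_mem g p (C.hLift_mem p w))
  rwa [C.dProj_dAct, C.dProj_hLift] at h

lemma affineLift_actST (g : G) (p : Q × ℝ) (Y : ES) :
    (C.affineLift (C.actST g p) Y : EQ) = C.push g p (C.affineLift p Y) 1 := by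
  have h := congrArg Prod.fst (C.hLift_actST g p (Y, 1))
  rw [← C.mk_affineLift p Y] at h
  exact h

lemma horizontalLift_actST (g : G) (p : Q × ℝ) (ξ : ES) :
    (C.horizontalLift (C.actST g p) ξ : EQ) = C.push g p (C.horizontalLift p ξ) 0 := by
  have h := congrArg Prod.fst (C.hLift_actST g p (ξ, 0))
  rw [← C.mk_horizontalLift p ξ, ← C.mk_horizontalLift (C.actST g p) ξ] at h
  exact h

lemma lagrangian_actST (g : G) (p : Q × ℝ) (ξ : EQ) :
    C.lagrangian (⟨C.act g p, (C.dAct g p (ξ, 1)).1⟩, p.2) = C.lagrangian (⟨p.1, ξ⟩, p.2) :=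
  C.lagrangian_invariant g p ξ

lemma fiberDerivative_actST (g : G) (p : Q × ℝ) (ξ η : EQ) :
    fiberDerivative C.lagrangian (C.act g p) (C.dAct g p (ξ, 1)).1 p.2 (C.dAct g p (η, 0)).1
      = fiberDerivative C.lagrangian p.1 ξ p.2 η := by
  unfold fiberDerivative
  congr 1
  funext s
  refine Eq.trans ?_ (C.lagrangian_actST g p (ξ + s • η))
  have h : (C.dAct g p (ξ, 1)).1 + s • (C.dAct g p (η, 0)).1 = (C.dAct g p (ξ + s • η, 1)).1 := by
    rw [← Prod.smul_fst, ← map_smul, ← Prod.fst_add, ← map_add]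
    simp
  exact congrArg (fun x : EQ => C.lagrangian (⟨C.act g p, x⟩, p.2)) h

/-- The action of `g` on space-time, in the charts at `p₀` and `g · p₀`. -/
def localAct (g : G) (p₀ : Q × ℝ) (z : EQ × ℝ) : EQ × ℝ :=
  (extChartAt 𝓘(ℝ, EQ) (C.act g p₀) (C.act g (param p₀ z)), z.2)

/-- The points at which the charts at `p₀` and `g · p₀` and at their projection apply. -/
def actDomain (g : G) (p₀ : Q × ℝ) : Set (EQ × ℝ) :=
  {z | z ∈ C.localDomain p₀ ∧ C.act g (param p₀ z) ∈ (extChartAt 𝓘(ℝ, EQ) (C.act g p₀)).source}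

lemma center_mem_actDomain (g : G) (p₀ : Q × ℝ) : center EQ p₀ ∈ C.actDomain g p₀ := by
  refine ⟨C.center_mem_localDomain p₀, ?_⟩
  rw [param_center]
  exact mem_extChartAt_source _

lemma contMDiffAt_act_param (g : G) (p₀ : Q × ℝ) {z : EQ × ℝ} (hz : z ∈ C.localDomain p₀) :
    ContMDiffAt 𝓘(ℝ, EQ × ℝ) 𝓘(ℝ, EQ) ∞ (fun z => C.act g (param p₀ z)) z :=
  (C.contMDiff_act g (param p₀ z)).comp z (contMDiffAt_param p₀ hz.1)

lemma actDomain_mem_nhds (g : G) (p₀ : Q × ℝ) {z : EQ × ℝ} (hz : z ∈ C.actDomain g p₀) :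
    C.actDomain g p₀ ∈ 𝓝 z :=
  Filter.Eventually.and (C.localDomain_mem_nhds p₀ hz.1)
    ((C.contMDiffAt_act_param g p₀ hz.1).continuousAt.eventually_mem
      ((isOpen_extChartAt_source (I := 𝓘(ℝ, EQ)) (C.act g p₀)).mem_nhds hz.2))

lemma contDiffAt_localAct (g : G) (p₀ : Q × ℝ) {z : EQ × ℝ} (hz : z ∈ C.actDomain g p₀) :
    ContDiffAt ℝ ∞ (C.localAct g p₀) z := by
  have h2 := (contMDiffOn_extChartAt (I := 𝓘(ℝ, EQ)) (n := ∞) (x := C.act g p₀)).contMDiffAt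
    (x := C.act g (param p₀ z)) (by
      rw [← extChartAt_source 𝓘(ℝ, EQ)]
      exact (isOpen_extChartAt_source (I := 𝓘(ℝ, EQ)) (C.act g p₀)).mem_nhds hz.2)
  exact (h2.comp z (C.contMDiffAt_act_param g p₀ hz.1)).contDiffAt.prodMk contDiffAt_snd

lemma param_localAct (g : G) (p₀ : Q × ℝ) {z : EQ × ℝ} (hz : z ∈ C.actDomain g p₀) :
    param (C.actST g p₀) (C.localAct g p₀ z) = C.actST g (param p₀ z) :=
  Prod.ext ((extChartAt 𝓘(ℝ, EQ) (C.act g p₀)).left_inv hz.2) rfl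

lemma localAct_center (g : G) (p₀ : Q × ℝ) :
    C.localAct g p₀ (center EQ p₀) = center EQ (C.actST g p₀) := by
  change (extChartAt 𝓘(ℝ, EQ) (C.act g p₀) (C.act g (param p₀ (center EQ p₀))), p₀.2) = _
  rw [param_center]
  rfl

lemma dParam_localAct (g : G) (p₀ : Q × ℝ) {z : EQ × ℝ} (hz : z ∈ C.actDomain g p₀)
    (v : EQ × ℝ) :
    dParam (C.actST g p₀) (C.localAct g p₀ z) (fderiv ℝ (C.localAct g p₀) z v)
      = C.dAct g (param p₀ z) (dParam p₀ z v) := by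
  have h1 : HasMFDerivAt 𝓘(ℝ, EQ × ℝ) 𝓘(ℝ, EQ) (fun z => C.act g (param p₀ z)) z _ :=
    (((C.contMDiff_act g) (param p₀ z)).mdifferentiableAt (by simp)).hasMFDerivAt.comp z
      (hasMFDerivAt_param p₀ hz.1.1)
  have h2 := mfderiv_eq_paramDeriv (C.act g p₀) h1.mdifferentiableAt hz.2 v
  rw [h1.mfderiv] at h2
  have h3 : HasFDerivAt (C.localAct g p₀) _ z :=
    (differentiableAt_chart_comp (C.act g p₀) h1.mdifferentiableAt hz.2).hasFDerivAt.prodMk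
      hasFDerivAt_snd
  rw [h3.fderiv]
  exact Prod.ext h2.symm rfl

lemma fderiv_localAct_center (g : G) (p₀ : Q × ℝ) (v : EQ × ℝ) :
    fderiv ℝ (C.localAct g p₀) (center EQ p₀) v = C.dAct g p₀ v := by
  have h := C.dParam_localAct g p₀ (C.center_mem_actDomain g p₀) v
  rwa [C.localAct_center, dParam_center, dParam_center, param_center] at h

lemma localAct_mem (g : G) (p₀ : Q × ℝ) {z : EQ × ℝ} (hz : z ∈ C.actDomain g p₀) :
    C.localAct g p₀ z ∈ C.localDomain (C.actST g p₀) := by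
  refine ⟨(extChartAt 𝓘(ℝ, EQ) (C.act g p₀)).map_source hz.2, ?_⟩
  rw [C.param_localAct g p₀ hz, C.proj_actST, C.proj_actST]
  exact hz.1.2

variable [FiniteDimensional ℝ ES]

lemma localLift_localAct (g : G) (p₀ : Q × ℝ) {z : EQ × ℝ} (hz : z ∈ C.actDomain g p₀)
    (w : ES × ℝ) : C.localLift (C.actST g p₀) (C.localAct g p₀ z) w
      = fderiv ℝ (C.localAct g p₀) z (C.localLift p₀ z w) := by
  have hz' := C.localAct_mem g p₀ hz
  apply dParam_injective (C.actST g p₀) hz'.1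
  have h : C.localExtProj (C.actST g p₀) (C.localAct g p₀ z) = C.localExtProj p₀ z := by
    refine Prod.ext ?_ rfl
    change extChartAt 𝓘(ℝ, ES) (C.proj (C.actST g p₀)) (C.proj (param (C.actST g p₀)
      (C.localAct g p₀ z))) = extChartAt 𝓘(ℝ, ES) (C.proj p₀) (C.proj (param p₀ z))
    rw [C.param_localAct g p₀ hz, C.proj_actST, C.proj_actST]
  rw [C.dParam_localLift _ hz', C.dParam_localAct g p₀ hz, C.dParam_localLift _ hz.1,
    ← C.hLift_actST, C.param_localAct g p₀ hz, h, C.extendedProj_actST]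

lemma localBracket_actST (g : G) (p₀ : Q × ℝ) (w w' : ES × ℝ) :
    C.localBracket (C.actST g p₀) w w' = C.dAct g p₀ (C.localBracket p₀ w w') := by
  have hz₀ := C.center_mem_actDomain g p₀
  have hd : ∀ w, DifferentiableAt ℝ (fun z => C.localLift p₀ z w) (center EQ p₀) := fun w =>
    ((C.contDiffAt_localLift p₀).differentiableAt (by simp)).clm_apply (differentiableAt_const w)
  have hd' : ∀ w, DifferentiableAt ℝ (fun z => C.localLift (C.actST g p₀) z w)
      (C.localAct g p₀ (center EQ p₀)) := fun w => by
    rw [C.localAct_center]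
    exact ((C.contDiffAt_localLift _).differentiableAt (by simp)).clm_apply
      (differentiableAt_const w)
  have hA : DifferentiableAt ℝ (C.localAct g p₀) (center EQ p₀) :=
    (C.contDiffAt_localAct g p₀ hz₀).differentiableAt (by simp)
  have hrel : ∀ w, (fun z => fderiv ℝ (C.localAct g p₀) z (C.localLift p₀ z w))
      =ᶠ[𝓝 (center EQ p₀)] fun z => C.localLift (C.actST g p₀) (C.localAct g p₀ z) w := by
    intro w
    filter_upwards [C.actDomain_mem_nhds g p₀ hz₀] with z hz
    exact (C.localLift_localAct g p₀ hz w).symm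
  have hder : ∀ w v, fderiv ℝ (fun z => C.localLift (C.actST g p₀) (C.localAct g p₀ z) w)
      (center EQ p₀) v = fderiv ℝ (fun z => C.localLift (C.actST g p₀) z w)
        (center EQ (C.actST g p₀)) (fderiv ℝ (C.localAct g p₀) (center EQ p₀) v) := by
    intro w v
    have h := fderiv_comp (center EQ p₀) (hd' w) hA
    rw [C.localAct_center] at h
    exact congrArg (fun A : EQ × ℝ →L[ℝ] EQ × ℝ => A v) h
  rw [← C.fderiv_localAct_center, localBracket, localBracket,
    VectorField.fderiv_apply_lieBracket (C.contDiffAt_localAct g p₀ hz₀)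
      (by simpa using two_le_infty) (hd w') (hd w), (hrel w).fderiv_eq, (hrel w').fderiv_eq,
    hder, hder, VectorField.lieBracket_eq]
  dsimp only
  rw [← C.localLift_localAct g p₀ hz₀, ← C.localLift_localAct g p₀ hz₀, C.localAct_center]

/-- The term `JK` is given by the bracket of lifts of constant fields. -/
lemma jkAt_eq (p : Q × ℝ) (Y ξ : ES) :
    C.jkAt p Y ξ = fiberDerivative C.lagrangian p.1 (C.hLift p (Y, 1)).1 p.2
      (-C.localBracket p (Y, 1) (ξ, 0)).1 := by
  have h := C.curvature_eq p (C.hLift p (Y, 1)) (C.hLift p (ξ, 0))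
  rw [C.dProj_hLift, C.dProj_hLift] at h
  rw [← h, ← C.mk_horizontalLift p ξ]
  rfl

lemma jkAt_actST (g : G) (p : Q × ℝ) (Y ξ : ES) :
    C.jkAt (C.actST g p) Y ξ = C.jkAt p Y ξ := by
  rw [C.jkAt_eq, C.jkAt_eq, C.hLift_actST, C.localBracket_actST, ← map_neg]
  have h1 : C.hLift p (Y, 1) = ((C.hLift p (Y, 1)).1, 1) := Prod.ext rfl (C.hLift_snd p _)
  have h2 : -C.localBracket p (Y, 1) (ξ, 0) = ((-C.localBracket p (Y, 1) (ξ, 0)).1, 0) := by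
    refine Prod.ext rfl ?_
    rw [← C.dProj_snd p, map_neg, C.dProj_localBracket, neg_zero]
    rfl
  have h := C.fiberDerivative_actST g p (C.hLift p (Y, 1)).1 (-C.localBracket p (Y, 1) (ξ, 0)).1
  rw [← h1, ← h2] at h
  exact h

end ChaplyginSystem

/-! ### The reduced data -/

/-- A right inverse of the derivative of a smooth map integrates to a smooth local section. -/
lemma exists_contDiffAt_section {E F : Type*} [NormedAddCommGroup E] [NormedSpace ℝ E]
    [NormedAddCommGroup F] [NormedSpace ℝ F] [CompleteSpace F] {f : E → F} {z₀ : E}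
    (hf : ContDiffAt ℝ ∞ f z₀) {R : F →L[ℝ] E} (hR : ∀ w, fderiv ℝ f z₀ (R w) = w) :
    ∃ σ : F → E, ContDiffAt ℝ ∞ σ (f z₀) ∧ σ (f z₀) = z₀ ∧ ∀ᶠ w in 𝓝 (f z₀), f (σ w) = w := by
  let h : F → E := fun w => z₀ + R w
  have h0 : h 0 = z₀ := by simp [h]
  have hh : ContDiffAt ℝ ∞ h 0 := contDiffAt_const.add R.contDiff.contDiffAt
  have hfh : ContDiffAt ℝ ∞ (f ∘ h) 0 := ContDiffAt.comp 0 (by rwa [h0]) hh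
  have hder : HasFDerivAt (f ∘ h) ((ContinuousLinearEquiv.refl ℝ F : F ≃L[ℝ] F) : F →L[ℝ] F) 0 := by
    have h1 : HasFDerivAt h R 0 := R.hasFDerivAt.const_add z₀
    have h2 : HasFDerivAt f (fderiv ℝ f z₀) (h 0) := by
      rw [h0]
      exact (hf.differentiableAt (by simp)).hasFDerivAt
    have h3 := h2.comp 0 h1
    have h4 : (fderiv ℝ f z₀).comp R
        = ((ContinuousLinearEquiv.refl ℝ F : F ≃L[ℝ] F) : F →L[ℝ] F) :=
      ContinuousLinearMap.ext hR
    rwa [h4] at h3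
  have hval : (f ∘ h) 0 = f z₀ := by simp [h0]
  let i := hfh.localInverse hder (by simp)
  have hi : ContDiffAt ℝ ∞ i (f z₀) := by
    rw [← hval]
    exact hfh.to_localInverse hder (by simp)
  have hi0 : i (f z₀) = 0 := by
    rw [← hval]
    exact hfh.localInverse_apply_image hder (by simp)
  refine ⟨fun w => h (i w), ContDiffAt.comp (g := h) _ (by rwa [hi0]) hi,
    (congrArg h hi0).trans h0, ?_⟩
  have h5 := (hfh.hasStrictFDerivAt' hder (by simp)).eventually_right_inverse
  rw [hval] at h5
  exact h5

section

variable {E : Type*} [NormedAddCommGroup E] [NormedSpace ℝ E]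
  {M : Type*} [TopologicalSpace M] [ChartedSpace E M] [IsManifold 𝓘(ℝ, E) ∞ M]

lemma contMDiffAt_chart_proj_fst (y₀ : M) (Y : E) (t : ℝ) :
    ContMDiffAt (𝓘(ℝ, E).tangent.prod 𝓘(ℝ, ℝ)) 𝓘(ℝ, E) ∞
      (fun w : TangentBundle 𝓘(ℝ, E) M × ℝ => extChartAt 𝓘(ℝ, E) y₀ w.1.proj)
      (⟨y₀, Y⟩, t) := by
  have h1 : ContMDiffAt (𝓘(ℝ, E).tangent.prod 𝓘(ℝ, ℝ)) 𝓘(ℝ, E) ∞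
      (fun w : TangentBundle 𝓘(ℝ, E) M × ℝ => w.1.proj) (⟨y₀, Y⟩, t) :=
    (Bundle.contMDiff_proj (TangentSpace 𝓘(ℝ, E)) _).comp _ contMDiffAt_fst
  exact (contMDiffAt_extChartAt (x := y₀)).comp ((⟨y₀, Y⟩, t) : TangentBundle 𝓘(ℝ, E) M × ℝ) h1

lemma contMDiffAt_chartDeriv_fst (y₀ : M) (Y : E) (t : ℝ) :
    ContMDiffAt (𝓘(ℝ, E).tangent.prod 𝓘(ℝ, ℝ)) 𝓘(ℝ, E) ∞
      (fun w : TangentBundle 𝓘(ℝ, E) M × ℝ => chartDeriv E y₀ w.1.proj w.1.2)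
      (⟨y₀, Y⟩, t) :=
  contMDiffAt_chartDeriv (f := fun w : TangentBundle 𝓘(ℝ, E) M × ℝ => w.1)
    (y₀ := (⟨y₀, Y⟩, t)) contMDiffAt_fst

end

namespace ChaplyginSystem

variable {EQ ES EG : Type*} [NormedAddCommGroup EQ] [NormedSpace ℝ EQ]
  [NormedAddCommGroup ES] [NormedSpace ℝ ES] [NormedAddCommGroup EG] [NormedSpace ℝ EG]
  {Q : Type*} [TopologicalSpace Q] [ChartedSpace EQ Q] [IsManifold 𝓘(ℝ, EQ) ∞ Q]
  {S : Type*} [TopologicalSpace S] [ChartedSpace ES S] [IsManifold 𝓘(ℝ, ES) ∞ S]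
  {G : Type*} [TopologicalSpace G] [ChartedSpace EG G] [Group G] [LieGroup 𝓘(ℝ, EG) ∞ G]
  (C : ChaplyginSystem EQ ES EG Q S G)

/-- The chosen point of a fiber is a translate of any other point of it. -/
lemma exists_actST_eq_fiberPoint (p : Q × ℝ) :
    ∃ g : G, ((C.fiberPoint (C.proj p) p.2, p.2) : Q × ℝ) = C.actST g p := by
  have h : C.proj (p.1, p.2) = C.proj (C.fiberPoint (C.proj p) p.2, p.2) :=
    ((C.proj_surjective p.2 (C.proj p)).choose_spec).symm
  obtain ⟨g, hg⟩ := (C.proj_eq_iff _ _ p.2).1 h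
  exact ⟨g, Prod.ext hg.symm rfl⟩

/-- The reduced Lagrangian may be computed at any point of the fiber. -/
lemma reducedLagrangian_eq (p : Q × ℝ) (Y : TangentSpace 𝓘(ℝ, ES) (C.proj p)) :
    C.reducedLagrangian (⟨C.proj p, Y⟩, p.2)
      = C.lagrangian (⟨p.1, C.affineLift p Y⟩, p.2) := by
  obtain ⟨g, hg⟩ := C.exists_actST_eq_fiberPoint p
  have h : ∀ (p' : Q × ℝ) (Y : ES), p' = C.actST g p →
      C.lagrangian (⟨p'.1, C.affineLift p' Y⟩, p.2)
        = C.lagrangian (⟨p.1, C.affineLift p Y⟩, p.2) := by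
    rintro _ Y rfl
    rw [← C.lagrangian_invariant g p]
    exact congrArg (fun x : EQ => C.lagrangian (⟨C.act g p, x⟩, p.2)) (C.affineLift_actST g p Y)
  exact h _ Y hg

lemma reducedForce_eq (p : Q × ℝ) (Y ξ : TangentSpace 𝓘(ℝ, ES) (C.proj p)) :
    C.reducedForce ⟨C.proj p, Y⟩ p.2 ξ
      = C.force ⟨p.1, C.affineLift p Y⟩ p.2 (C.horizontalLift p ξ) := by
  obtain ⟨g, hg⟩ := C.exists_actST_eq_fiberPoint p
  have h : ∀ (p' : Q × ℝ) (Y ξ : ES), p' = C.actST g p →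
      C.force ⟨p'.1, C.affineLift p' Y⟩ p.2 (C.horizontalLift p' ξ)
        = C.force ⟨p.1, C.affineLift p Y⟩ p.2 (C.horizontalLift p ξ) := by
    rintro _ Y ξ rfl
    rw [← C.force_invariant g p]
    have h' : ∀ x x' y y' : EQ, x = x' → y = y' →
        C.force ⟨C.act g p, x⟩ p.2 y = C.force ⟨C.act g p, x'⟩ p.2 y' := by
      rintro x _ y _ rfl rfl
      rfl
    exact h' _ _ _ _ (C.affineLift_actST g p Y) (C.horizontalLift_actST g p ξ)
  exact h _ Y ξ hg

variable [FiniteDimensional ℝ ES]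

lemma jkTerm_eq (p : Q × ℝ) (Y ξ : TangentSpace 𝓘(ℝ, ES) (C.proj p)) :
    C.jkTerm ⟨C.proj p, Y⟩ p.2 ξ = C.jkAt p Y ξ := by
  obtain ⟨g, hg⟩ := C.exists_actST_eq_fiberPoint p
  have h : ∀ (p' : Q × ℝ) (Y ξ : ES), p' = C.actST g p → C.jkAt p' Y ξ = C.jkAt p Y ξ := by
    rintro _ Y ξ rfl
    exact C.jkAt_actST g p Y ξ
  exact h _ Y ξ hg

/-- The affine lift, in the charts at `p₀` and at its projection. -/
lemma affineLift_param (p₀ : Q × ℝ) {z : EQ × ℝ} (hz : z ∈ C.localDomain p₀) (v : ES) :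
    (C.affineLift (param p₀ z) (paramDeriv ES (C.proj p₀) (C.localProj p₀ z) v) : EQ)
      = paramDeriv EQ p₀.1 z.1 (C.localLift p₀ z (v, 1)).1 :=
  (congrArg Prod.fst (C.dParam_localLift p₀ hz (v, 1))).symm

/-- The extended projection has smooth local sections. -/
lemma exists_local_section (p₀ : Q × ℝ) : ∃ σ : ES × ℝ → EQ × ℝ,
    ContDiffAt ℝ ∞ σ (center ES (C.extendedProj p₀)) ∧
    σ (center ES (C.extendedProj p₀)) = center EQ p₀ ∧
    ∀ᶠ w in 𝓝 (center ES (C.extendedProj p₀)), C.localExtProj p₀ (σ w) = w := by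
  have hz₀ := C.center_mem_localDomain p₀
  have : CompleteSpace ES := FiniteDimensional.complete ℝ ES
  rw [← C.localExtProj_center]
  exact exists_contDiffAt_section (C.contDiffAt_localExtProj p₀ hz₀)
    (R := C.localLift p₀ (center EQ p₀)) (fun w => by
      rw [C.fderiv_localExtProj p₀ hz₀, C.fderiv_localProj_localLift p₀ hz₀, C.localLift_snd])

/-- The defining relation of the reduced Lagrangian, in charts. -/
lemma reducedLagrangian_param (p₀ : Q × ℝ) {z : EQ × ℝ} (hz : z ∈ C.localDomain p₀) (v : ES) :
    C.reducedLagrangian (⟨C.proj (param p₀ z), paramDeriv ES (C.proj p₀) (C.localProj p₀ z) v⟩,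
      z.2) = C.lagrangian (⟨(extChartAt 𝓘(ℝ, EQ) p₀.1).symm z.1,
        paramDeriv EQ p₀.1 z.1 (C.localLift p₀ z (v, 1)).1⟩, z.2) :=
  (C.reducedLagrangian_eq (param p₀ z) _).trans
    (congrArg (fun x : EQ => C.lagrangian (⟨(param p₀ z).1, x⟩, z.2)) (C.affineLift_param p₀ hz v))

/-- The reduced Lagrangian is smooth: a local section `σ` of `π̲` through `p₀` expresses it as the
composition of `L` with the affine lift of velocities at the points of `σ`. -/
lemma contMDiffAt_reducedLagrangian (p₀ : Q × ℝ) (Y : ES) :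
    ContMDiffAt (𝓘(ℝ, ES).tangent.prod 𝓘(ℝ, ℝ)) 𝓘(ℝ, ℝ) ∞ C.reducedLagrangian
      (⟨C.proj p₀, Y⟩, p₀.2) := by
  obtain ⟨w₀, hw₀⟩ : ∃ w₀ : TangentBundle 𝓘(ℝ, ES) S × ℝ, w₀ = (⟨C.proj p₀, Y⟩, p₀.2) := ⟨_, rfl⟩
  obtain ⟨σ, hσ, hσ0, hσr⟩ := C.exists_local_section p₀
  obtain ⟨b, hb_def⟩ : ∃ b : TangentBundle 𝓘(ℝ, ES) S × ℝ → ES × ℝ,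
      b = fun w => (extChartAt 𝓘(ℝ, ES) (C.proj p₀) w.1.proj, w.2) := ⟨_, rfl⟩
  have htime : ContMDiffAt (𝓘(ℝ, ES).tangent.prod 𝓘(ℝ, ℝ)) 𝓘(ℝ, ℝ) ∞
      (fun w : TangentBundle 𝓘(ℝ, ES) S × ℝ => w.2) w₀ := contMDiffAt_snd
  have hvel : ContMDiffAt (𝓘(ℝ, ES).tangent.prod 𝓘(ℝ, ℝ)) 𝓘(ℝ, ES) ∞
      (fun w : TangentBundle 𝓘(ℝ, ES) S × ℝ => chartDeriv ES (C.proj p₀) w.1.proj w.1.2) w₀ := by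
    rw [hw₀]
    exact contMDiffAt_chartDeriv_fst _ _ _
  have hb : ContMDiffAt (𝓘(ℝ, ES).tangent.prod 𝓘(ℝ, ℝ)) 𝓘(ℝ, ES × ℝ) ∞ b w₀ := by
    rw [hb_def]
    refine ContMDiffAt.prodMk_space ?_ htime
    rw [hw₀]
    exact contMDiffAt_chart_proj_fst _ _ _
  have hb0 : b w₀ = center ES (C.extendedProj p₀) := by
    rw [hb_def, hw₀]
    rfl
  have hσb : ContMDiffAt (𝓘(ℝ, ES).tangent.prod 𝓘(ℝ, ℝ)) 𝓘(ℝ, EQ × ℝ) ∞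
      (fun w => σ (b w)) w₀ :=
    ContMDiffAt.comp w₀ (g := σ) (by rw [hb0]; exact hσ.contMDiffAt) hb
  have hσb0 : σ (b w₀) = center EQ p₀ := by rw [hb0, hσ0]
  have hlift : ContMDiffAt (𝓘(ℝ, ES).tangent.prod 𝓘(ℝ, ℝ)) 𝓘(ℝ, ES × ℝ →L[ℝ] EQ × ℝ) ∞
      (fun w => C.localLift p₀ (σ (b w))) w₀ :=
    ContMDiffAt.comp w₀ (g := C.localLift p₀)
      (by rw [hσb0]; exact (C.contDiffAt_localLift p₀).contMDiffAt) hσb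
  have hu : ContMDiffAt (𝓘(ℝ, ES).tangent.prod 𝓘(ℝ, ℝ)) 𝓘(ℝ, EQ) ∞
      (fun w : TangentBundle 𝓘(ℝ, ES) S × ℝ =>
        (C.localLift p₀ (σ (b w)) (chartDeriv ES (C.proj p₀) w.1.proj w.1.2, 1)).1) w₀ :=
    contDiff_fst.contMDiff.contMDiffAt.comp w₀
      (hlift.clm_apply (hvel.prodMk_space (contMDiffAt_const (c := (1 : ℝ)))))
  have ha : ContMDiffAt (𝓘(ℝ, ES).tangent.prod 𝓘(ℝ, ℝ)) 𝓘(ℝ, EQ) ∞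
      (fun w => (σ (b w)).1) w₀ := contDiff_fst.contMDiff.contMDiffAt.comp w₀ hσb
  have hTQ := contMDiffAt_paramDeriv p₀.1 ha hu (congrArg Prod.fst hσb0)
  have hL := ContMDiffAt.comp w₀ (g := C.lagrangian) (C.lagrangian_smooth _) (hTQ.prodMk htime)
  rw [← hw₀]
  refine hL.congr_of_eventuallyEq ?_
  have hev : ∀ᶠ w in 𝓝 w₀, C.localExtProj p₀ (σ (b w)) = b w :=
    hb.continuousAt.eventually (by rw [hb0]; exact hσr)
  have hev' : ∀ᶠ w in 𝓝 w₀, σ (b w) ∈ C.localDomain p₀ :=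
    hσb.continuousAt.eventually_mem
      (by rw [hσb0]; exact C.localDomain_mem_nhds p₀ (C.center_mem_localDomain p₀))
  have hev'' : ∀ᶠ w : TangentBundle 𝓘(ℝ, ES) S × ℝ in 𝓝 w₀,
      w.1.proj ∈ (extChartAt 𝓘(ℝ, ES) (C.proj p₀)).source := by
    refine ((FiberBundle.continuous_proj ES (TangentSpace 𝓘(ℝ, ES))).comp
      continuous_fst).continuousAt.eventually_mem
        ((isOpen_extChartAt_source (I := 𝓘(ℝ, ES)) (C.proj p₀)).mem_nhds ?_)
    rw [hw₀]
    exact mem_extChartAt_source (C.proj p₀)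
  filter_upwards [hev, hev', hev''] with w hw hw' hw''
  have h1 : C.localProj p₀ (σ (b w)) = extChartAt 𝓘(ℝ, ES) (C.proj p₀) w.1.proj := by
    rw [hb_def] at hw ⊢
    exact congrArg Prod.fst hw
  have h2 : (σ (b w)).2 = w.2 := by
    rw [hb_def] at hw ⊢
    exact congrArg Prod.snd hw
  have h3 : C.proj (param p₀ (σ (b w))) = w.1.proj :=
    (extChartAt 𝓘(ℝ, ES) (C.proj p₀)).injOn hw'.2 hw'' h1
  have h4 := C.reducedLagrangian_param p₀ hw' (chartDeriv ES (C.proj p₀) w.1.proj w.1.2)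
  have h5 : ∀ (y : S) (V : ES) (t : ℝ), y = w.1.proj → V = w.1.2 → t = w.2 →
      C.reducedLagrangian (⟨y, V⟩, t) = C.reducedLagrangian w := by
    rintro _ _ _ rfl rfl rfl
    rfl
  have h6 : paramDeriv ES (C.proj p₀) (C.localProj p₀ (σ (b w)))
      (chartDeriv ES (C.proj p₀) w.1.proj w.1.2) = w.1.2 := by
    rw [h1]
    exact paramDeriv_chartDeriv (C.proj p₀) hw'' _
  refine ((h5 _ _ _ h3 h6 h2).symm.trans h4).trans ?_
  rw [h2]
  rfl

lemma contMDiff_reducedLagrangian :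
    ContMDiff (𝓘(ℝ, ES).tangent.prod 𝓘(ℝ, ℝ)) 𝓘(ℝ, ℝ) ∞ C.reducedLagrangian := by
  rintro ⟨⟨y, Y⟩, t⟩
  obtain ⟨q, rfl⟩ := C.proj_surjective t y
  exact C.contMDiffAt_reducedLagrangian (q, t) Y

end ChaplyginSystem

/-! ### The variational derivative of the reduced Lagrangian -/

section Calculus

variable {E F : Type*} [NormedAddCommGroup E] [NormedSpace ℝ E]
  [NormedAddCommGroup F] [NormedSpace ℝ F]

lemma fderiv_position {L : (E × E) × ℝ → ℝ} {x v : E} {t : ℝ}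
    (hL : DifferentiableAt ℝ L ((x, v), t)) (h : E) :
    fderiv ℝ (fun x => L ((x, v), t)) x h = fderiv ℝ L ((x, v), t) ((h, 0), 0) := by
  have h1 : HasFDerivAt (fun x : E => ((x, v), t)) _ x :=
    ((hasFDerivAt_id (𝕜 := ℝ) x : HasFDerivAt (fun x : E => x) _ x).prodMk
      (hasFDerivAt_const v x)).prodMk (hasFDerivAt_const t x)
  have h2 : HasFDerivAt (fun x : E => L ((x, v), t)) _ x :=
    HasFDerivAt.comp x (g := L) hL.hasFDerivAt h1
  exact congrArg (fun A : E →L[ℝ] ℝ => A h) h2.fderiv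

lemma fderiv_velocity {L : (E × E) × ℝ → ℝ} {x v : E} {t : ℝ}
    (hL : DifferentiableAt ℝ L ((x, v), t)) (h : E) :
    fderiv ℝ (fun v => L ((x, v), t)) v h = fderiv ℝ L ((x, v), t) ((0, h), 0) := by
  have h1 : HasFDerivAt (fun v : E => ((x, v), t)) _ v :=
    ((hasFDerivAt_const x v).prodMk
      (hasFDerivAt_id (𝕜 := ℝ) v : HasFDerivAt (fun v : E => v) _ v)).prodMk (hasFDerivAt_const t v)
  have h2 : HasFDerivAt (fun v : E => L ((x, v), t)) _ v :=
    HasFDerivAt.comp v (g := L) hL.hasFDerivAt h1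
  exact congrArg (fun A : E →L[ℝ] ℝ => A h) h2.fderiv

lemma eventually_differentiableAt {f : E → F} {x : E} (hf : ContDiffAt ℝ ∞ f x) :
    ∀ᶠ y in 𝓝 x, DifferentiableAt ℝ f y :=
  ((hf.of_le (m := 1) (by exact le_trans one_le_two two_le_infty)).eventually (by simp)).mono
    fun _ h => h.differentiableAt (by simp)

/-- The lift `(A (v, 1)).1` of a velocity is affine in `v`, with linear part
`ζ ↦ (A (ζ, 0)).1`. -/
lemma hasFDerivAt_lift_velocity (A : F × ℝ →L[ℝ] E × ℝ) (v : F) :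
    HasFDerivAt (fun v : F => (A (v, 1)).1)
      ((ContinuousLinearMap.fst ℝ E ℝ).comp (A.comp (ContinuousLinearMap.inl ℝ F ℝ))) v := by
  have h : (fun v : F => (A (v, 1)).1) = fun v =>
      ((ContinuousLinearMap.fst ℝ E ℝ).comp (A.comp (ContinuousLinearMap.inl ℝ F ℝ))) v
        + (A (0, 1)).1 := by
    funext v
    change (A (v, 1)).1 = (A (v, 0)).1 + (A (0, 1)).1
    rw [← Prod.fst_add, ← map_add]
    simp
  rw [h]
  exact (ContinuousLinearMap.hasFDerivAt _).add_const _

/-- The relation between the Euler-Lagrange expressions of `L` and of the reduced Lagrangian `R`.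
Let `K` lift vectors along the projection `π` and let `R(π z, v) = L(z, K_z(v))`. Along a curve
that is the lift of its projection, the two expressions differ by the fiber derivative of `L` in the
direction of a Lie bracket of lifted fields. Both expressions are compared by differentiating the
relation between `L` and `R`, in the direction of a lifted vector and with respect to the
velocity, the latter along the curve. -/
lemma eulerLagrange_reduction {L : (E × E) × ℝ → ℝ} {R : (F × F) × ℝ → ℝ} {π : E × ℝ → F}
    {K : E × ℝ → F × ℝ →L[ℝ] E × ℝ} {c : ℝ → E} {b : ℝ → F} {t₀ : ℝ}
    (hb : b =ᶠ[𝓝 t₀] fun t => π (c t, t))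
    (hL : ContDiffAt ℝ ∞ L ((c t₀, deriv c t₀), t₀))
    (hR : ContDiffAt ℝ ∞ R ((b t₀, deriv b t₀), t₀))
    (hK : ContDiffAt ℝ ∞ K (c t₀, t₀)) (hπ : ContDiffAt ℝ ∞ π (c t₀, t₀))
    (hc : ContDiffAt ℝ ∞ c t₀) (hsnd : ∀ z w, (K z w).2 = w.2)
    (hproj : ∀ w, fderiv ℝ π (c t₀, t₀) (K (c t₀, t₀) w) = w.1)
    (hadm : ∀ᶠ t in 𝓝 t₀, deriv c t = (K (c t, t) (deriv b t, 1)).1)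
    (hred : ∀ᶠ z in 𝓝 (c t₀, t₀), ∀ v, L ((z.1, (K z (v, 1)).1), z.2) = R ((π z, v), z.2))
    (ζ : F) :
    fderiv ℝ (fun x => L ((x, deriv c t₀), t₀)) (c t₀) (K (c t₀, t₀) (ζ, 0)).1
        - deriv (fun t => fderiv ℝ (fun v => L ((c t, v), t)) (deriv c t)
            (K (c t₀, t₀) (ζ, 0)).1) t₀
      = fderiv ℝ (fun y => R ((y, deriv b t₀), t₀)) (b t₀) ζ
        - deriv (fun t => fderiv ℝ (fun v => R ((b t, v), t)) (deriv b t) ζ) t₀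
        + fderiv ℝ (fun v => L ((c t₀, v), t₀)) (deriv c t₀)
            (VectorField.lieBracket ℝ (fun z => K z (deriv b t₀, 1)) (fun z => K z (ζ, 0))
              (c t₀, t₀)).1 := by
  have hct : ContDiffAt ℝ ∞ (fun t => (c t, t)) t₀ := hc.prodMk contDiffAt_id
  have hbs : ContDiffAt ℝ ∞ b t₀ :=
    (ContDiffAt.comp t₀ (g := π) (f := fun t => (c t, t)) hπ hct).congr_of_eventuallyEq hb
  have hc' : ContDiffAt ℝ ∞ (deriv c) t₀ := by
    have h : ContDiffAt ℝ ∞ (fderiv ℝ c) t₀ := hc.fderiv_right (by simp)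
    exact h.clm_apply contDiffAt_const
  have hb' : ContDiffAt ℝ ∞ (deriv b) t₀ := by
    have h : ContDiffAt ℝ ∞ (fderiv ℝ b) t₀ := hbs.fderiv_right (by simp)
    exact h.clm_apply contDiffAt_const
  let q : ℝ → (E × E) × ℝ := fun t => ((c t, deriv c t), t)
  let r : ℝ → (F × F) × ℝ := fun t => ((b t, deriv b t), t)
  have hq : ContDiffAt ℝ ∞ q t₀ := (hc.prodMk hc').prodMk contDiffAt_id
  have hr : ContDiffAt ℝ ∞ r t₀ := (hbs.prodMk hb').prodMk contDiffAt_id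
  have hLev : ∀ᶠ t in 𝓝 t₀, DifferentiableAt ℝ L (q t) :=
    hq.continuousAt.eventually (eventually_differentiableAt hL)
  have hRev : ∀ᶠ t in 𝓝 t₀, DifferentiableAt ℝ R (r t) :=
    hr.continuousAt.eventually (eventually_differentiableAt hR)
  have hL0 := hL.differentiableAt (by simp : (∞ : WithTop ℕ∞) ≠ 0)
  have hR0 := hR.differentiableAt (by simp : (∞ : WithTop ℕ∞) ≠ 0)
  have hb0 : b t₀ = π (c t₀, t₀) := hb.self_of_nhds
  -- the fiber derivatives of `L` and `R` agree along the curve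
  have hfib : ∀ᶠ t in 𝓝 t₀, fderiv ℝ L (q t) ((0, (K (c t, t) (ζ, 0)).1), 0)
      = fderiv ℝ R (r t) ((0, ζ), 0) := by
    filter_upwards [hLev, hRev, hadm, hb, hct.continuousAt.eventually hred]
      with t hLt hRt hat hbt hrt
    have h1 : (fun v => L ((c t, (K (c t, t) (v, 1)).1), t)) = fun v => R ((b t, v), t) := by
      funext v
      rw [hbt]
      exact hrt v
    have h2 : HasFDerivAt (fun v : F => ((c t, (K (c t, t) (v, 1)).1), t)) _ (deriv b t) :=
      ((hasFDerivAt_const (c t) _).prodMk (hasFDerivAt_lift_velocity (K (c t, t)) _)).prodMk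
        (hasFDerivAt_const t _)
    have h3 : HasFDerivAt (fun v => L ((c t, (K (c t, t) (v, 1)).1), t)) _ (deriv b t) :=
      HasFDerivAt.comp (deriv b t) (g := L) (by rw [← hat]; exact hLt.hasFDerivAt) h2
    have h4 := h3.fderiv
    rw [h1] at h4
    rw [← fderiv_velocity hRt, h4]
    rfl
  -- the derivative of this relation along the curve
  have hZ : HasDerivAt (fun t => ((((0 : E), (K (c t, t) (ζ, 0)).1), (0 : ℝ)) : (E × E) × ℝ))
      ((0, (fderiv ℝ (fun z => K z (ζ, 0)) (c t₀, t₀) (deriv c t₀, 1)).1), 0) t₀ := by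
    have h1 : HasDerivAt (fun t => (c t, t)) (deriv c t₀, 1) t₀ :=
      (hc.differentiableAt (by simp)).hasDerivAt.prodMk (hasDerivAt_id t₀)
    have h2 : DifferentiableAt ℝ (fun z => K z (ζ, 0)) (c t₀, t₀) :=
      (hK.differentiableAt (by simp)).clm_apply (differentiableAt_const _)
    have h3 := HasFDerivAt.comp_hasDerivAt (f := fun t => (c t, t)) t₀ h2.hasFDerivAt h1
    have h4 := (ContinuousLinearMap.fst ℝ E ℝ).hasFDerivAt.comp_hasDerivAt t₀ h3
    exact ((hasDerivAt_const t₀ (0 : E)).prodMk h4).prodMk (hasDerivAt_const t₀ (0 : ℝ))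
  have hDL : DifferentiableAt ℝ (fun t => fderiv ℝ L (q t)) t₀ := by
    have h : ContDiffAt ℝ ∞ (fderiv ℝ L) (q t₀) := hL.fderiv_right (by simp)
    exact (h.differentiableAt (by simp)).comp t₀ (hq.differentiableAt (by simp))
  have htime : deriv (fun t => fderiv ℝ R (r t) ((0, ζ), 0)) t₀
      = deriv (fun t => fderiv ℝ L (q t) ((0, (K (c t₀, t₀) (ζ, 0)).1), 0)) t₀
        + fderiv ℝ L (q t₀)
          ((0, (fderiv ℝ (fun z => K z (ζ, 0)) (c t₀, t₀) (deriv c t₀, 1)).1), 0) := by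
    rw [← Filter.EventuallyEq.deriv_eq hfib, (hDL.hasDerivAt.clm_apply hZ).deriv,
      (hDL.hasDerivAt.clm_apply (hasDerivAt_const t₀ _)).deriv, map_zero, add_zero]
  -- the relation between `L` and `R` differentiated in the direction of the lifted vector
  have hpos : fderiv ℝ L (q t₀) (((K (c t₀, t₀) (ζ, 0)).1,
        (fderiv ℝ (fun z => K z (deriv b t₀, 1)) (c t₀, t₀) (K (c t₀, t₀) (ζ, 0))).1), 0)
      = fderiv ℝ R (r t₀) ((ζ, 0), 0) := by
    have hU : DifferentiableAt ℝ (fun z => K z (deriv b t₀, 1)) (c t₀, t₀) :=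
      (hK.differentiableAt (by simp)).clm_apply (differentiableAt_const _)
    have h1 : (fun z : E × ℝ => L ((z.1, (K z (deriv b t₀, 1)).1), z.2)) =ᶠ[𝓝 (c t₀, t₀)]
        fun z => R ((π z, deriv b t₀), z.2) := hred.mono fun z hz => hz _
    have h2 : HasFDerivAt (fun z : E × ℝ => ((z.1, (K z (deriv b t₀, 1)).1), z.2)) _
        (c t₀, t₀) :=
      (hasFDerivAt_fst.prodMk hU.hasFDerivAt.fst).prodMk hasFDerivAt_snd
    have h3 : HasFDerivAt (fun z : E × ℝ => L ((z.1, (K z (deriv b t₀, 1)).1), z.2)) _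
        (c t₀, t₀) :=
      HasFDerivAt.comp (c t₀, t₀) (g := L)
        (by rw [← hadm.self_of_nhds]; exact hL0.hasFDerivAt) h2
    have h4 : HasFDerivAt (fun z : E × ℝ => ((π z, deriv b t₀), z.2))
        (((fderiv ℝ π (c t₀, t₀)).prod 0).prod (ContinuousLinearMap.snd ℝ E ℝ)) (c t₀, t₀) :=
      ((hπ.differentiableAt (by simp)).hasFDerivAt.prodMk (hasFDerivAt_const _ _)).prodMk
        hasFDerivAt_snd
    have hR0' : HasFDerivAt R (fderiv ℝ R ((b t₀, deriv b t₀), t₀))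
        ((π (c t₀, t₀), deriv b t₀), t₀) := by
      rw [← hb0]
      exact hR0.hasFDerivAt
    have h5 : HasFDerivAt (fun z : E × ℝ => R ((π z, deriv b t₀), z.2)) _ (c t₀, t₀) :=
      HasFDerivAt.comp (c t₀, t₀) (g := R) hR0' h4
    have h6 := h1.fderiv_eq (𝕜 := ℝ)
    rw [h3.fderiv, h5.fderiv] at h6
    have h7 := congrArg (fun A : E × ℝ →L[ℝ] ℝ => A (K (c t₀, t₀) (ζ, 0))) h6
    have h8 : (K (c t₀, t₀) (ζ, 0)).2 = 0 := hsnd _ _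
    have h9 := hproj (ζ, 0)
    simp only [ContinuousLinearMap.comp_apply, ContinuousLinearMap.prod_apply,
      ContinuousLinearMap.coe_fst', ContinuousLinearMap.coe_snd', h8, h9,
      zero_apply] at h7
    exact h7
  -- the direction in which the fields are differentiated along the curve is itself a lift, so the
  -- derivatives of the lifted fields combine to their bracket
  have hvel : (deriv c t₀, (1 : ℝ)) = K (c t₀, t₀) (deriv b t₀, 1) :=
    Prod.ext hadm.self_of_nhds (hsnd (c t₀, t₀) (deriv b t₀, 1)).symm
  have e1 : deriv (fun t => fderiv ℝ (fun v => L ((c t, v), t)) (deriv c t)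
      (K (c t₀, t₀) (ζ, 0)).1) t₀
      = deriv (fun t => fderiv ℝ L (q t) ((0, (K (c t₀, t₀) (ζ, 0)).1), 0)) t₀ :=
    Filter.EventuallyEq.deriv_eq (hLev.mono fun t ht => fderiv_velocity ht _)
  have e2 : deriv (fun t => fderiv ℝ (fun v => R ((b t, v), t)) (deriv b t) ζ) t₀
      = deriv (fun t => fderiv ℝ R (r t) ((0, ζ), 0)) t₀ :=
    Filter.EventuallyEq.deriv_eq (hRev.mono fun t ht => fderiv_velocity ht _)
  rw [e1, e2, fderiv_position hL0, fderiv_position hR0, fderiv_velocity hL0, htime]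
  have e3 : fderiv ℝ R ((b t₀, deriv b t₀), t₀) ((ζ, 0), 0) = _ := hpos.symm
  rw [e3, hvel, VectorField.lieBracket_eq]
  dsimp only
  have e4 : ∀ x y : E, fderiv ℝ L (q t₀) ((x, y), 0) = fderiv ℝ L (q t₀) ((x, 0), 0)
      + fderiv ℝ L (q t₀) ((0, y), 0) := by
    intro x y
    rw [← map_add]
    simp
  have e5 : ∀ x y : E, fderiv ℝ L (q t₀) ((0, x - y), 0) = fderiv ℝ L (q t₀) ((0, x), 0)
      - fderiv ℝ L (q t₀) ((0, y), 0) := by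
    intro x y
    rw [← map_sub]
    simp
  rw [show fderiv ℝ L ((c t₀, deriv c t₀), t₀) = fderiv ℝ L (q t₀) from rfl, Prod.fst_sub, e5,
    e4 _ (fderiv ℝ (fun z => K z (deriv b t₀, 1)) (c t₀, t₀) (K (c t₀, t₀) (ζ, 0))).1]
  ring

end Calculus

/-! ### The variational derivative in charts -/

section Variational

variable {E : Type*} [NormedAddCommGroup E] [NormedSpace ℝ E]
  {M : Type*} [TopologicalSpace M] [ChartedSpace E M] [IsManifold 𝓘(ℝ, E) ∞ M]

omit [IsManifold 𝓘(ℝ, E) ∞ M] in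
lemma localLagrangian_eq (L : TangentBundle 𝓘(ℝ, E) M × ℝ → ℝ) (x₀ : M) (x v : E) (s : ℝ) :
    localLagrangian L x₀ x v s
      = L (⟨(extChartAt 𝓘(ℝ, E) x₀).symm x, paramDeriv E x₀ x v⟩, s) := rfl

lemma localLagrangian_self (L : TangentBundle 𝓘(ℝ, E) M × ℝ → ℝ) (x₀ : M) (v : E) (s : ℝ) :
    localLagrangian L x₀ (extChartAt 𝓘(ℝ, E) x₀ x₀) v s = L (⟨x₀, v⟩, s) := by
  rw [localLagrangian_eq, paramDeriv_self]
  have h : ∀ x : M, x = x₀ → L (⟨x, v⟩, s) = L (⟨x₀, v⟩, s) := by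
    rintro x rfl
    rfl
  exact h _ (extChartAt_to_inv x₀)

lemma contDiffAt_localLagrangian {L : TangentBundle 𝓘(ℝ, E) M × ℝ → ℝ}
    (hL : ContMDiff (𝓘(ℝ, E).tangent.prod 𝓘(ℝ, ℝ)) 𝓘(ℝ, ℝ) ∞ L) (x₀ : M) (v : E) (s : ℝ) :
    ContDiffAt ℝ ∞ (fun q : (E × E) × ℝ => localLagrangian L x₀ q.1.1 q.1.2 q.2)
      ((extChartAt 𝓘(ℝ, E) x₀ x₀, v), s) := by
  obtain ⟨q₀, hq₀⟩ : ∃ q₀ : (E × E) × ℝ, q₀ = ((extChartAt 𝓘(ℝ, E) x₀ x₀, v), s) := ⟨_, rfl⟩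
  rw [← hq₀]
  have h1 : ContMDiffAt 𝓘(ℝ, (E × E) × ℝ) 𝓘(ℝ, E) ∞ (fun q : (E × E) × ℝ => q.1.1) q₀ :=
    (contDiff_fst.fst).contMDiff.contMDiffAt
  have h2 : ContMDiffAt 𝓘(ℝ, (E × E) × ℝ) 𝓘(ℝ, E) ∞ (fun q : (E × E) × ℝ => q.1.2) q₀ :=
    (contDiff_fst.snd).contMDiff.contMDiffAt
  have h3 : ContMDiffAt 𝓘(ℝ, (E × E) × ℝ) 𝓘(ℝ, ℝ) ∞ (fun q : (E × E) × ℝ => q.2) q₀ :=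
    contDiff_snd.contMDiff.contMDiffAt
  have h4 := contMDiffAt_paramDeriv x₀ h1 h2 (by rw [hq₀])
  exact (ContMDiffAt.comp q₀ (g := L) (hL _) (h4.prodMk h3)).contDiffAt

/-- The fiber derivative as a derivative in the chart at the base point. -/
lemma fiberDerivative_eq_fderiv {L : TangentBundle 𝓘(ℝ, E) M × ℝ → ℝ}
    (hL : ContMDiff (𝓘(ℝ, E).tangent.prod 𝓘(ℝ, ℝ)) 𝓘(ℝ, ℝ) ∞ L) (x₀ : M) (v η : E) (s : ℝ) :
    fiberDerivative L x₀ v s η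
      = fderiv ℝ (fun v => localLagrangian L x₀ (extChartAt 𝓘(ℝ, E) x₀ x₀) v s) v η := by
  have h1 : DifferentiableAt ℝ
      (fun v => localLagrangian L x₀ (extChartAt 𝓘(ℝ, E) x₀ x₀) v s) v := by
    have h2 := (contDiffAt_localLagrangian hL x₀ v s).differentiableAt (by simp)
    have h3 : DifferentiableAt ℝ (fun v : E => ((extChartAt 𝓘(ℝ, E) x₀ x₀, v), s)) v := by
      fun_prop
    exact DifferentiableAt.comp v
      (g := fun q : (E × E) × ℝ => localLagrangian L x₀ q.1.1 q.1.2 q.2) h2 h3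
  rw [← h1.lineDeriv_eq_fderiv]
  have h4 : ∀ f : E → ℝ, (∀ w : E, f w = L (⟨x₀, w⟩, s)) →
      fiberDerivative L x₀ v s η = lineDeriv ℝ f v η := by
    intro f hf
    unfold lineDeriv
    simp only [hf]
    rfl
  exact h4 _ fun w => localLagrangian_self L x₀ w s

/-- The definition of the variational derivative, with the derivative of the chart at its center
replaced by the identity. -/
lemma variationalDerivative_eq (L : TangentBundle 𝓘(ℝ, E) M × ℝ → ℝ) (γ : ℝ → M) (t : ℝ) (η : E)
    {c : ℝ → E} (hc : c = fun s => extChartAt 𝓘(ℝ, E) (γ t) (γ s)) :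
    variationalDerivative L γ t η
      = fderiv ℝ (fun x => localLagrangian L (γ t) x (deriv c t) t) (c t) η
        - deriv (fun s => fderiv ℝ (fun v => localLagrangian L (γ t) (c s) v s) (deriv c s) η)
          t := by
  subst hc
  have h : ∀ h : E, h = η → fderiv ℝ (fun x => localLagrangian L (γ t) x
        (deriv (fun s => extChartAt 𝓘(ℝ, E) (γ t) (γ s)) t) t) (extChartAt 𝓘(ℝ, E) (γ t) (γ t)) h
      - deriv (fun s => fderiv ℝ (fun v => localLagrangian L (γ t)
        (extChartAt 𝓘(ℝ, E) (γ t) (γ s)) v s)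
          (deriv (fun s => extChartAt 𝓘(ℝ, E) (γ t) (γ s)) s) h) t
      = fderiv ℝ (fun x => localLagrangian L (γ t) x
        (deriv (fun s => extChartAt 𝓘(ℝ, E) (γ t) (γ s)) t) t) (extChartAt 𝓘(ℝ, E) (γ t) (γ t)) η
      - deriv (fun s => fderiv ℝ (fun v => localLagrangian L (γ t)
        (extChartAt 𝓘(ℝ, E) (γ t) (γ s)) v s)
          (deriv (fun s => extChartAt 𝓘(ℝ, E) (γ t) (γ s)) s) η) t := by
    rintro h rfl
    rfl
  exact h (chartDeriv E (γ t) (γ t) η) (by rw [chartDeriv_self]; rfl)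

lemma variationalDerivative_congr (L : TangentBundle 𝓘(ℝ, E) M × ℝ → ℝ) {γ γ' : ℝ → M} {t : ℝ}
    (h : γ =ᶠ[𝓝 t] γ') (η : E) :
    variationalDerivative L γ t η = variationalDerivative L γ' t η := by
  rw [variationalDerivative_eq L γ t η rfl, variationalDerivative_eq L γ' t η rfl,
    h.self_of_nhds]
  have hc : (fun s => extChartAt 𝓘(ℝ, E) (γ' t) (γ s))
      =ᶠ[𝓝 t] fun s => extChartAt 𝓘(ℝ, E) (γ' t) (γ' s) := h.mono fun s hs => by
    dsimp only
    rw [hs]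
  rw [hc.deriv_eq]
  congr 1
  refine Filter.EventuallyEq.deriv_eq ?_
  filter_upwards [hc, hc.deriv] with s hs hs'
  rw [hs, hs']

omit [IsManifold 𝓘(ℝ, E) ∞ M] in
lemma velocity_congr {γ γ' : ℝ → M} {t : ℝ} (h : γ =ᶠ[𝓝 t] γ') :
    (velocity γ t : E) = velocity γ' t :=
  congrArg (fun A : ℝ →L[ℝ] E => A 1) h.mfderiv_eq

lemma velocity_eq_deriv {γ : ℝ → M} {t : ℝ} (hγ : MDifferentiableAt 𝓘(ℝ, ℝ) 𝓘(ℝ, E) γ t) :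
    (velocity γ t : E) = deriv (fun s => extChartAt 𝓘(ℝ, E) (γ t) (γ s)) t := by
  rw [velocity_eq_paramDeriv (γ t) hγ (mem_extChartAt_source (γ t)), paramDeriv_self]
  rfl

omit [IsManifold 𝓘(ℝ, E) ∞ M] in
lemma contDiffAt_chart_comp {γ : ℝ → M} {t : ℝ}
    (hγ : ContMDiffAt 𝓘(ℝ, ℝ) 𝓘(ℝ, E) ∞ γ t) :
    ContDiffAt ℝ ∞ (fun s => extChartAt 𝓘(ℝ, E) (γ t) (γ s)) t :=
  ((contMDiffAt_extChartAt (x := γ t)).comp t hγ).contDiffAt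

lemma eventually_mdifferentiableAt {γ : ℝ → M} {t : ℝ}
    (hγ : ContMDiffAt 𝓘(ℝ, ℝ) 𝓘(ℝ, E) ∞ γ t) :
    ∀ᶠ s in 𝓝 t, MDifferentiableAt 𝓘(ℝ, ℝ) 𝓘(ℝ, E) γ s :=
  (contMDiffAt_iff_contMDiffAt_nhds (by simp) |>.1 (hγ.of_le (m := 1) (by simp))).mono
    fun _ h => h.mdifferentiableAt (by simp)

end Variational

namespace ChaplyginSystem

variable {EQ ES EG : Type*} [NormedAddCommGroup EQ] [NormedSpace ℝ EQ]
  [NormedAddCommGroup ES] [NormedSpace ℝ ES] [NormedAddCommGroup EG] [NormedSpace ℝ EG]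
  {Q : Type*} [TopologicalSpace Q] [ChartedSpace EQ Q] [IsManifold 𝓘(ℝ, EQ) ∞ Q]
  {S : Type*} [TopologicalSpace S] [ChartedSpace ES S] [IsManifold 𝓘(ℝ, ES) ∞ S]
  {G : Type*} [TopologicalSpace G] [ChartedSpace EG G] [Group G] [LieGroup 𝓘(ℝ, EG) ∞ G]
  (C : ChaplyginSystem EQ ES EG Q S G)

lemma contMDiffAt_proj_curve {γ : ℝ → Q} {t : ℝ} (hγ : ContMDiffAt 𝓘(ℝ, ℝ) 𝓘(ℝ, EQ) ∞ γ t) :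
    ContMDiffAt 𝓘(ℝ, ℝ) 𝓘(ℝ, ES) ∞ (fun s => C.proj (γ s, s)) t :=
  ContMDiffAt.comp t (g := C.proj) (C.proj_smooth _) (hγ.prodMk contMDiffAt_id)

lemma dProj_velocity {γ : ℝ → Q} {t : ℝ} (hγ : MDifferentiableAt 𝓘(ℝ, ℝ) 𝓘(ℝ, EQ) γ t) :
    C.dProj (γ t, t) ((velocity γ t, 1) : EQ × ℝ)
      = ((velocity (fun s => C.proj (γ s, s)) t, 1) : ES × ℝ) := by
  refine Prod.ext ?_ (C.dProj_snd _ _)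
  rw [C.dProj_fst]
  have h1 : HasMFDerivAt 𝓘(ℝ, ℝ) 𝓘(ℝ, ES) (fun s => C.proj (γ s, s)) t _ :=
    HasMFDerivAt.comp t (g := C.proj) ((C.proj_smooth _).mdifferentiableAt (by simp)).hasMFDerivAt
      (hγ.hasMFDerivAt.prodMk (hasMFDerivAt_id t))
  exact (congrArg (fun A : ℝ →L[ℝ] ES => A 1) h1.mfderiv).symm

/-- An admissible curve is an affine horizontal lift of its projection. -/
lemma velocity_eq_affineLift {γ : ℝ → Q} {t : ℝ} (hγ : MDifferentiableAt 𝓘(ℝ, ℝ) 𝓘(ℝ, EQ) γ t)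
    (h : velocity γ t ∈ C.constraint.space (γ t, t)) :
    (velocity γ t : EQ) = C.affineLift (γ t, t) (velocity (fun s => C.proj (γ s, s)) t) := by
  have h1 := C.hLift_dProj (γ t, t) ((C.mem_space_iff (γ t, t) _).1 h)
  have h2 := C.dProj_velocity hγ
  have h3 := (congrArg (C.hLift (γ t, t)) h2).symm.trans h1
  exact (congrArg Prod.fst h3).symm

variable [FiniteDimensional ℝ ES]

/-- Along an admissible curve `γ` with projection `Γ`, the variational derivative of `L` in the
direction of a horizontal lift is the variational derivative of the reduced Lagrangian minus the
curvature term. -/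
lemma variationalDerivative_horizontalLift {γ : ℝ → Q} {t : ℝ}
    (hγ : ContMDiffAt 𝓘(ℝ, ℝ) 𝓘(ℝ, EQ) ∞ γ t)
    (hadm : ∀ᶠ s in 𝓝 t, velocity γ s ∈ C.constraint.space (γ s, s)) (ξ : ES) :
    variationalDerivative C.lagrangian γ t (C.horizontalLift (γ t, t) ξ)
      = variationalDerivative C.reducedLagrangian (fun s => C.proj (γ s, s)) t ξ
        - C.jkAt (γ t, t) (velocity (fun s => C.proj (γ s, s)) t) ξ := by
  obtain ⟨p₀, hp₀⟩ : ∃ p₀ : Q × ℝ, p₀ = (γ t, t) := ⟨_, rfl⟩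
  obtain ⟨c, hc⟩ : ∃ c : ℝ → EQ, c = fun s => extChartAt 𝓘(ℝ, EQ) (γ t) (γ s) := ⟨_, rfl⟩
  obtain ⟨b, hb⟩ : ∃ b : ℝ → ES,
    b = fun s => extChartAt 𝓘(ℝ, ES) (C.proj (γ t, t)) (C.proj (γ s, s)) := ⟨_, rfl⟩
  have hcs : ContDiffAt ℝ ∞ c t := by
    rw [hc]
    exact contDiffAt_chart_comp hγ
  have hct : (c t, t) = center EQ p₀ := by
    rw [hc, hp₀]
    rfl
  have hbt : b t = extChartAt 𝓘(ℝ, ES) (C.proj (γ t, t)) (C.proj (γ t, t)) := by rw [hb]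
  have hct' : ContinuousAt (fun s => (c s, s)) t := hcs.continuousAt.prodMk continuousAt_id
  have hdom : ∀ᶠ s in 𝓝 t, (c s, s) ∈ C.localDomain p₀ :=
    hct'.eventually_mem (by
      rw [hct]; exact C.localDomain_mem_nhds p₀ (C.center_mem_localDomain p₀))
  have hsrc : ∀ᶠ s in 𝓝 t, γ s ∈ (extChartAt 𝓘(ℝ, EQ) (γ t)).source :=
    hγ.continuousAt.eventually_mem ((isOpen_extChartAt_source (I := 𝓘(ℝ, EQ)) (γ t)).mem_nhds
      (mem_extChartAt_source (γ t)))
  have hparam : ∀ᶠ s in 𝓝 t, param p₀ (c s, s) = (γ s, s) := hsrc.mono fun s hs => by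
    rw [hp₀, hc]
    exact Prod.ext ((extChartAt 𝓘(ℝ, EQ) (γ t)).left_inv hs) rfl
  have hbπ : b =ᶠ[𝓝 t] fun s => C.localProj p₀ (c s, s) := hparam.mono fun s hs => by
    rw [hb]
    change _ = extChartAt 𝓘(ℝ, ES) (C.proj p₀) (C.proj (param p₀ (c s, s)))
    rw [hs, hp₀]
  have hcdiff : ∀ᶠ s in 𝓝 t, DifferentiableAt ℝ c s := eventually_differentiableAt hcs
  have hadm' : ∀ᶠ s in 𝓝 t, deriv c s = (C.localLift p₀ (c s, s) (deriv b s, 1)).1 := by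
    filter_upwards [hadm, hparam, hdom, hsrc, hcdiff, hbπ.deriv, eventually_mdifferentiableAt hγ]
      with s hs hps hds hss hcd hbs hγs
    have h1 : (velocity γ s : EQ) = paramDeriv EQ p₀.1 (c s) (deriv c s) := by
      rw [velocity_eq_paramDeriv (γ t) hγs hss, hc, hp₀]
    have h2 : dParam p₀ (c s, s) (deriv c s, 1) = ((velocity γ s, 1) : EQ × ℝ) := by
      rw [dParam_apply]
      exact Prod.ext h1.symm rfl
    have h3 : dParam p₀ (c s, s) (deriv c s, 1) ∈ C.horizontal (param p₀ (c s, s)) := by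
      rw [h2, hps]
      exact (C.mem_space_iff (γ s, s) _).1 hs
    have h4 := C.eq_localLift p₀ hds h3
    have h5 : deriv b s = fderiv ℝ (C.localProj p₀) (c s, s) (deriv c s, 1) := by
      rw [hbs]
      have h6 : HasDerivAt (fun s => (c s, s)) (deriv c s, (1 : ℝ)) s :=
        hcd.hasDerivAt.prodMk (hasDerivAt_id s)
      exact (HasFDerivAt.comp_hasDerivAt (f := fun s => (c s, s)) s
        ((C.contDiffAt_localProj p₀ hds).differentiableAt (by simp)).hasFDerivAt h6).deriv
    rw [h5]
    exact (congrArg Prod.fst h4).symm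
  have hL : ContDiffAt ℝ ∞ (fun q : (EQ × EQ) × ℝ =>
      localLagrangian C.lagrangian (γ t) q.1.1 q.1.2 q.2) ((c t, deriv c t), t) := by
    have h1 : c t = extChartAt 𝓘(ℝ, EQ) (γ t) (γ t) := by rw [hc]
    rw [h1]
    exact contDiffAt_localLagrangian C.lagrangian_smooth (γ t) _ _
  have hR : ContDiffAt ℝ ∞ (fun q : (ES × ES) × ℝ =>
      localLagrangian C.reducedLagrangian (C.proj (γ t, t)) q.1.1 q.1.2 q.2)
        ((b t, deriv b t), t) := by
    rw [hbt]
    exact contDiffAt_localLagrangian C.contMDiff_reducedLagrangian (C.proj (γ t, t)) _ _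
  have hred : ∀ᶠ z in 𝓝 (c t, t), ∀ v,
      localLagrangian C.lagrangian (γ t) z.1 (C.localLift p₀ z (v, 1)).1 z.2
        = localLagrangian C.reducedLagrangian (C.proj (γ t, t)) (C.localProj p₀ z) v z.2 := by
    rw [hct]
    filter_upwards [C.localDomain_mem_nhds p₀ (C.center_mem_localDomain p₀)] with z hz v
    have h1 := C.reducedLagrangian_param p₀ hz v
    have h2 : (extChartAt 𝓘(ℝ, ES) (C.proj p₀)).symm (C.localProj p₀ z) = C.proj (param p₀ z) :=
      (extChartAt 𝓘(ℝ, ES) (C.proj p₀)).left_inv hz.2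
    have h3 : ∀ (y y' : S) (V : ES), y = y' →
        C.reducedLagrangian (⟨y, V⟩, z.2) = C.reducedLagrangian (⟨y', V⟩, z.2) := by
      rintro y _ V rfl
      rfl
    rw [localLagrangian_eq, localLagrangian_eq]
    subst hp₀
    exact h1.symm.trans (h3 _ _ _ h2.symm)
  have hz₀ := C.center_mem_localDomain p₀
  have hmain := eulerLagrange_reduction
    (L := fun q : (EQ × EQ) × ℝ => localLagrangian C.lagrangian (γ t) q.1.1 q.1.2 q.2)
    (R := fun q : (ES × ES) × ℝ =>
      localLagrangian C.reducedLagrangian (C.proj (γ t, t)) q.1.1 q.1.2 q.2)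
    hbπ hL hR (by rw [hct]; exact C.contDiffAt_localLift p₀)
    (by rw [hct]; exact C.contDiffAt_localProj p₀ hz₀) hcs (C.localLift_snd p₀)
    (by rw [hct]; exact C.fderiv_localProj_localLift p₀ hz₀) hadm' hred ξ
  have hlift : (C.localLift p₀ (c t, t) (ξ, 0)).1 = C.horizontalLift (γ t, t) ξ := by
    rw [hct, C.localLift_center, hp₀]
    exact (C.horizontalLift_eq _ ξ).symm
  have hvΓ : (velocity (fun s => C.proj (γ s, s)) t : ES) = deriv b t := by
    rw [hb]
    exact velocity_eq_deriv ((C.contMDiffAt_proj_curve hγ).mdifferentiableAt (by simp))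
  have hvγ : (C.hLift (γ t, t) (deriv b t, 1)).1 = deriv c t := by
    rw [hadm'.self_of_nhds, hct, C.localLift_center, hp₀]
  have hjk : C.jkAt (γ t, t) (velocity (fun s => C.proj (γ s, s)) t) ξ
      = -fderiv ℝ (fun v => localLagrangian C.lagrangian (γ t) (c t) v t) (deriv c t)
          (C.localBracket p₀ (deriv b t, 1) (ξ, 0)).1 := by
    have h1 : ∀ V : ES, V = deriv b t → C.jkAt (γ t, t) V ξ
        = -fderiv ℝ (fun v => localLagrangian C.lagrangian (γ t) (c t) v t) (deriv c t)
          (C.localBracket p₀ (deriv b t, 1) (ξ, 0)).1 := by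
      rintro _ rfl
      rw [C.jkAt_eq, hvγ]
      have h2 := fiberDerivative_eq_fderiv C.lagrangian_smooth (γ t) (deriv c t)
        (-C.localBracket (γ t, t) (deriv b t, 1) (ξ, 0)).1 t
      refine h2.trans ?_
      rw [Prod.fst_neg, map_neg, hp₀, hc]
    exact h1 _ hvΓ
  have eL := variationalDerivative_eq C.lagrangian γ t (C.localLift p₀ (c t, t) (ξ, 0)).1 hc
  have eR := variationalDerivative_eq C.reducedLagrangian (fun s => C.proj (γ s, s)) t ξ hb
  refine (congrArg (fun η : EQ => variationalDerivative C.lagrangian γ t η) hlift.symm).trans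
    (eL.trans (Eq.trans ?_ (congrArg₂ (fun x y : ℝ => x - y) eR hjk).symm))
  rw [sub_neg_eq_add, localBracket, ← hct]
  exact hmain

end ChaplyginSystem

/-! ### Equations of motion of the system and of the reduced system -/

lemma tangentLift_congr {E : Type*} [NormedAddCommGroup E] [NormedSpace ℝ E]
    {M : Type*} [TopologicalSpace M] [ChartedSpace E M] {γ γ' : ℝ → M} {t : ℝ}
    (h : γ =ᶠ[𝓝 t] γ') :
    (tangentLift γ t : TangentBundle 𝓘(ℝ, E) M) = tangentLift γ' t := by
  have h' : ∀ (x y : M) (v w : E), x = y → v = w →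
      (⟨x, v⟩ : TangentBundle 𝓘(ℝ, E) M) = ⟨y, w⟩ := by
    rintro x _ v _ rfl rfl
    rfl
  exact h' _ _ _ _ h.self_of_nhds (velocity_congr h)

namespace ChaplyginSystem

variable {EQ ES EG : Type*} [NormedAddCommGroup EQ] [NormedSpace ℝ EQ]
  [NormedAddCommGroup ES] [NormedSpace ℝ ES] [NormedAddCommGroup EG] [NormedSpace ℝ EG]
  {Q : Type*} [TopologicalSpace Q] [ChartedSpace EQ Q] [IsManifold 𝓘(ℝ, EQ) ∞ Q]
  {S : Type*} [TopologicalSpace S] [ChartedSpace ES S] [IsManifold 𝓘(ℝ, ES) ∞ S]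
  {G : Type*} [TopologicalSpace G] [ChartedSpace EG G] [Group G] [LieGroup 𝓘(ℝ, EG) ∞ G]
  (C : ChaplyginSystem EQ ES EG Q S G)

variable {C} in
lemma IsReducedSolution.congr {J : Set ℝ} {Γ Γ' : ℝ → S} (hJ : IsOpen J)
    (h : C.IsReducedSolution J Γ) (hΓ : Set.EqOn Γ' Γ J) : C.IsReducedSolution J Γ' := by
  refine ⟨h.1.congr hΓ, fun t ht ξ => ?_⟩
  have hev : Γ' =ᶠ[𝓝 t] Γ := hΓ.eventuallyEq_of_mem (hJ.mem_nhds ht)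
  have h1 : ∀ (w w' : TangentBundle 𝓘(ℝ, ES) S) (ξ : ES), w = w' →
      C.reducedForce w t ξ = C.reducedForce w' t ξ ∧ C.jkTerm w t ξ = C.jkTerm w' t ξ := by
    rintro w _ ξ rfl
    exact ⟨rfl, rfl⟩
  obtain ⟨h2, h3⟩ := h1 _ _ ξ (tangentLift_congr hev)
  exact (congrArg₂ (fun x y : ℝ => x + y) (variationalDerivative_congr C.reducedLagrangian hev ξ)
    h2).trans ((h.2 t ht ξ).trans h3.symm)

variable [FiniteDimensional ℝ ES]

/-- Along an admissible curve, the equation of motion in the direction of a horizontal lift is the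
reduced equation of motion of the projected curve. -/
lemma equation_horizontalLift {γ : ℝ → Q} {t : ℝ}
    (hγ : ContMDiffAt 𝓘(ℝ, ℝ) 𝓘(ℝ, EQ) ∞ γ t)
    (hadm : ∀ᶠ s in 𝓝 t, velocity γ s ∈ C.constraint.space (γ s, s)) (ξ : ES) :
    variationalDerivative C.lagrangian γ t (C.horizontalLift (γ t, t) ξ)
        + C.force (tangentLift γ t) t (C.horizontalLift (γ t, t) ξ)
      = variationalDerivative C.reducedLagrangian (fun s => C.proj (γ s, s)) t ξ
        + C.reducedForce (tangentLift (fun s => C.proj (γ s, s)) t) t ξ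
        - C.jkTerm (tangentLift (fun s => C.proj (γ s, s)) t) t ξ := by
  have h1 := C.variationalDerivative_horizontalLift hγ hadm ξ
  have h2 := C.reducedForce_eq (γ t, t) (velocity (fun s => C.proj (γ s, s)) t) ξ
  have h3 := C.jkTerm_eq (γ t, t) (velocity (fun s => C.proj (γ s, s)) t) ξ
  have h4 := C.velocity_eq_affineLift (hγ.mdifferentiableAt (by simp)) hadm.self_of_nhds
  have h5 : ∀ v w η : EQ, v = w → C.force ⟨γ t, v⟩ t η = C.force ⟨γ t, w⟩ t η := by
    rintro v _ η rfl
    rfl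
  have h6 := h5 _ _ (C.horizontalLift (γ t, t) ξ) h4
  refine (congrArg₂ (fun x y : ℝ => x + y) h1 (h6.trans h2.symm)).trans ?_
  refine Eq.trans ?_ (congrArg (fun x : ℝ => variationalDerivative C.reducedLagrangian
    (fun s => C.proj (γ s, s)) t ξ
      + C.reducedForce (tangentLift (fun s => C.proj (γ s, s)) t) t ξ - x) h3).symm
  exact sub_add_eq_add_sub _ _ _

/-- Solutions project to solutions of the reduced system. -/
lemma isReducedSolution_of_isSolution {J : Set ℝ} {γ : ℝ → Q} (hJ : IsOpen J)
    (h : C.IsSolution J γ) : C.IsReducedSolution J (fun t => C.proj (γ t, t)) := by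
  have hγ : ∀ t ∈ J, ContMDiffAt 𝓘(ℝ, ℝ) 𝓘(ℝ, EQ) ∞ γ t := fun t ht =>
    h.1.contMDiffAt (hJ.mem_nhds ht)
  refine ⟨fun t ht => (C.contMDiffAt_proj_curve (hγ t ht)).contMDiffWithinAt, fun t ht ξ => ?_⟩
  have hadm : ∀ᶠ s in 𝓝 t, velocity γ s ∈ C.constraint.space (γ s, s) := by
    filter_upwards [hJ.mem_nhds ht] with s hs
    exact (h.2 s hs).1
  have h1 := C.equation_horizontalLift (hγ t ht) hadm ξ
  have h2 := (h.2 t ht).2 _ (C.horizontalLift_mem (γ t, t) ξ)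
  exact sub_eq_zero.1 (h1.symm.trans h2)

/-- Lifts of solutions of the reduced system are solutions, since every virtual displacement is a
horizontal lift. -/
lemma isSolution_of_isAffineHorizontalLift {J : Set ℝ} {Γ : ℝ → S} {γ : ℝ → Q} (hJ : IsOpen J)
    (h : C.IsAffineHorizontalLift J Γ γ) (hΓ : C.IsReducedSolution J Γ) : C.IsSolution J γ := by
  have hadm : ∀ t ∈ J, velocity γ t ∈ C.constraint.space (γ t, t) := by
    intro t ht
    rw [(h.2 t ht).2]
    exact C.affineLift_mem _ _
  have hΓ' := hΓ.congr hJ (Γ' := fun t => C.proj (γ t, t)) fun t ht => (h.2 t ht).1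
  refine ⟨h.1, fun t ht => ⟨hadm t ht, fun η hη => ?_⟩⟩
  have h1 := C.equation_horizontalLift (h.1.contMDiffAt (hJ.mem_nhds ht))
    (Filter.mem_of_superset (hJ.mem_nhds ht) hadm) (C.dproj (γ t, t) η)
  have h2 := C.horizontalLift_dproj hη
  have h3 := h1.trans (sub_eq_zero.2 (hΓ'.2 t ht (C.dproj (γ t, t) η)))
  rw [← h2]
  exact h3

end ChaplyginSystem

/-! ### Local theory of affine horizontal lifts -/

/-- Solutions of an autonomous differential equation are smooth where the vector field is. -/
lemma contDiffAt_of_hasDerivAt {E : Type*} [NormedAddCommGroup E] [NormedSpace ℝ E]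
    [CompleteSpace E] {F : E → E} {α : ℝ → E} {t₀ : ℝ} (hF : ContDiffAt ℝ ∞ F (α t₀))
    (hα : ∀ᶠ t in 𝓝 t₀, HasDerivAt α (F (α t)) t) : ContDiffAt ℝ ∞ α t₀ := by
  rw [contDiffAt_infty]
  intro n
  obtain ⟨u, hu, hFu⟩ := (hF.of_le (m := n) (by exact_mod_cast le_top)).contDiffOn le_rfl (by simp)
  have hu' : u ∈ 𝓝 (α t₀) := by simpa using hu
  have hev := hα.and (hα.self_of_nhds.continuousAt.eventually_mem hu')
  obtain ⟨ε, hε, hball⟩ := Metric.nhds_basis_closedBall.eventually_iff.1 hev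
  rw [Real.closedBall_eq_Icc] at hball
  have h1 : ContDiffOn ℝ (n : ℕ∞) α (Set.Icc (t₀ - ε) (t₀ + ε)) :=
    ODE.contDiffOn_enat_Icc_of_hasDerivWithinAt (f := fun _ => F) (u := u)
      (hFu.comp contDiff_snd.contDiffOn fun x hx => hx.2)
      (fun t ht => (hball ht).1.hasDerivWithinAt) fun t ht => (hball ht).2
  exact h1.contDiffAt (Icc_mem_nhds (by linarith) (by linarith))

namespace ChaplyginSystem

variable {EQ ES EG : Type*} [NormedAddCommGroup EQ] [NormedSpace ℝ EQ]
  [NormedAddCommGroup ES] [NormedSpace ℝ ES] [NormedAddCommGroup EG] [NormedSpace ℝ EG]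
  {Q : Type*} [TopologicalSpace Q] [ChartedSpace EQ Q] [IsManifold 𝓘(ℝ, EQ) ∞ Q]
  {S : Type*} [TopologicalSpace S] [ChartedSpace ES S] [IsManifold 𝓘(ℝ, ES) ∞ S]
  {G : Type*} [TopologicalSpace G] [ChartedSpace EG G] [Group G] [LieGroup 𝓘(ℝ, EG) ∞ G]
  (C : ChaplyginSystem EQ ES EG Q S G)

/-- `γ` satisfies at time `t` the conditions of an affine horizontal lift of `Γ`, stated in
space-time. Only differentiability is required; smoothness follows, see
`contMDiffAt_of_isLiftAt`. -/
def IsLiftAt (Γ : ℝ → S) (γ : ℝ → Q) (t : ℝ) : Prop :=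
  MDifferentiableAt 𝓘(ℝ, ℝ) 𝓘(ℝ, EQ) γ t ∧ C.proj (γ t, t) = Γ t ∧
    ((velocity γ t, 1) : EQ × ℝ) = C.hLift (γ t, t) (velocity Γ t, 1)

variable {C} in
lemma IsLiftAt.congr {Γ : ℝ → S} {γ γ' : ℝ → Q} {t : ℝ} (h : C.IsLiftAt Γ γ t)
    (hγ : γ' =ᶠ[𝓝 t] γ) : C.IsLiftAt Γ γ' t := by
  have h1 : ((velocity γ' t, 1) : EQ × ℝ) = (velocity γ t, 1) :=
    Prod.ext (velocity_congr hγ) rfl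
  refine ⟨h.1.congr_of_eventuallyEq hγ, ?_, h1.trans (h.2.2.trans ?_)⟩
  · rw [hγ.self_of_nhds]
    exact h.2.1
  · rw [hγ.self_of_nhds]

/-- The group maps lifts to lifts. -/
lemma isLiftAt_act (g : G) {Γ : ℝ → S} {γ : ℝ → Q} {t : ℝ} (h : C.IsLiftAt Γ γ t) :
    C.IsLiftAt Γ (fun s => C.act g (γ s, s)) t := by
  have h1 : HasMFDerivAt 𝓘(ℝ, ℝ) 𝓘(ℝ, EQ) (fun s => C.act g (γ s, s)) t _ :=
    HasMFDerivAt.comp t (g := C.act g)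
      ((C.contMDiff_act g _).mdifferentiableAt (by simp)).hasMFDerivAt
      (h.1.hasMFDerivAt.prodMk (hasMFDerivAt_id t))
  have h2 : ((velocity (fun s => C.act g (γ s, s)) t, 1) : EQ × ℝ)
      = C.dAct g (γ t, t) ((velocity γ t, 1) : EQ × ℝ) :=
    Prod.ext (congrArg (fun A : ℝ →L[ℝ] EQ => A 1) h1.mfderiv) rfl
  refine ⟨h1.mdifferentiableAt, (C.proj_actST g (γ t, t)).trans h.2.1, ?_⟩
  exact h2.trans ((congrArg (C.dAct g (γ t, t)) h.2.2).trans
    (C.hLift_actST g (γ t, t) (velocity Γ t, 1)).symm)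

lemma contDiffAt_chart_proj_comp {Γ : ℝ → S} {p₀ : Q × ℝ}
    (hΓ : ContMDiffAt 𝓘(ℝ, ℝ) 𝓘(ℝ, ES) ∞ Γ p₀.2) (h0 : C.proj p₀ = Γ p₀.2) :
    ContDiffAt ℝ ∞ (fun s => extChartAt 𝓘(ℝ, ES) (C.proj p₀) (Γ s)) p₀.2 := by
  rw [h0]
  exact contDiffAt_chart_comp hΓ

variable [FiniteDimensional ℝ ES]

/-- The equation of an affine horizontal lift, in charts. -/
lemma velocity_eq_hLift_iff (p₀ : Q × ℝ) {Γ : ℝ → S} {γ : ℝ → Q} {s : ℝ}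
    (hγ : MDifferentiableAt 𝓘(ℝ, ℝ) 𝓘(ℝ, EQ) γ s) (hΓ : MDifferentiableAt 𝓘(ℝ, ℝ) 𝓘(ℝ, ES) Γ s)
    (hγs : γ s ∈ (extChartAt 𝓘(ℝ, EQ) p₀.1).source)
    (hΓs : Γ s ∈ (extChartAt 𝓘(ℝ, ES) (C.proj p₀)).source) (hproj : C.proj (γ s, s) = Γ s) :
    ((velocity γ s, 1) : EQ × ℝ) = C.hLift (γ s, s) (velocity Γ s, 1) ↔
      (deriv (fun r => extChartAt 𝓘(ℝ, EQ) p₀.1 (γ r)) s, (1 : ℝ))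
        = C.localLift p₀ (extChartAt 𝓘(ℝ, EQ) p₀.1 (γ s), s)
          (deriv (fun r => extChartAt 𝓘(ℝ, ES) (C.proj p₀) (Γ r)) s, 1) := by
  obtain ⟨z, hz⟩ : ∃ z : EQ × ℝ, z = (extChartAt 𝓘(ℝ, EQ) p₀.1 (γ s), s) := ⟨_, rfl⟩
  have hparam : param p₀ z = (γ s, s) := by
    rw [hz]
    exact Prod.ext ((extChartAt 𝓘(ℝ, EQ) p₀.1).left_inv hγs) rfl
  have hdom : z ∈ C.localDomain p₀ := by
    refine ⟨?_, ?_⟩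
    · rw [hz]
      exact (extChartAt 𝓘(ℝ, EQ) p₀.1).map_source hγs
    · rw [hparam, hproj]
      exact hΓs
  have hext : C.localExtProj p₀ z = (extChartAt 𝓘(ℝ, ES) (C.proj p₀) (Γ s), s) := by
    rw [localExtProj, localProj, hparam, hproj, hz]
  have h1 : ((velocity γ s, 1) : EQ × ℝ)
      = dParam p₀ z (deriv (fun r => extChartAt 𝓘(ℝ, EQ) p₀.1 (γ r)) s, 1) := by
    rw [dParam_apply, hz]
    exact Prod.ext (velocity_eq_paramDeriv p₀.1 hγ hγs) rfl
  have h2 : ((velocity Γ s, 1) : ES × ℝ) = dParam (C.extendedProj p₀) (C.localExtProj p₀ z)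
      (deriv (fun r => extChartAt 𝓘(ℝ, ES) (C.proj p₀) (Γ r)) s, 1) := by
    rw [dParam_apply, hext]
    exact Prod.ext (velocity_eq_paramDeriv (C.proj p₀) hΓ hΓs) rfl
  have h3 : C.hLift (γ s, s) (velocity Γ s, 1) = dParam p₀ z (C.localLift p₀ z
      (deriv (fun r => extChartAt 𝓘(ℝ, ES) (C.proj p₀) (Γ r)) s, 1)) := by
    rw [C.dParam_localLift p₀ hdom, ← hparam]
    exact congrArg (C.hLift (param p₀ z)) h2
  rw [← hz]
  constructor
  · intro h
    exact dParam_injective p₀ hdom.1 (h1.symm.trans (h.trans h3))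
  · intro h
    exact h1.trans ((congrArg (dParam p₀ z) h).trans h3.symm)

/-- The differential equation of the lifts of a curve, in the chart at `p₀`, with time as an
additional variable. Here `β` is the curve in the chart at the projection of `p₀`. -/
def liftField (p₀ : Q × ℝ) (β : ℝ → ES) (z : EQ × ℝ) : EQ × ℝ :=
  C.localLift p₀ z (deriv β z.2, 1)

/-- A lift satisfies the differential equation in the chart. -/
lemma hasDerivAt_of_isLiftAt {Γ : ℝ → S} {γ : ℝ → Q} {t₀ : ℝ}
    (hΓ : ContMDiffAt 𝓘(ℝ, ℝ) 𝓘(ℝ, ES) ∞ Γ t₀) (hγ : ∀ᶠ t in 𝓝 t₀, C.IsLiftAt Γ γ t) :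
    ∀ᶠ t in 𝓝 t₀, HasDerivAt (fun s => (extChartAt 𝓘(ℝ, EQ) (γ t₀) (γ s), s))
      (C.liftField (γ t₀, t₀) (fun s => extChartAt 𝓘(ℝ, ES) (C.proj (γ t₀, t₀)) (Γ s))
        (extChartAt 𝓘(ℝ, EQ) (γ t₀) (γ t), t)) t := by
  have h0 := hγ.self_of_nhds
  have hγs : ∀ᶠ s in 𝓝 t₀, γ s ∈ (extChartAt 𝓘(ℝ, EQ) (γ t₀)).source :=
    h0.1.continuousAt.eventually_mem
      ((isOpen_extChartAt_source (I := 𝓘(ℝ, EQ)) (γ t₀)).mem_nhds (mem_extChartAt_source (γ t₀)))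
  have hΓs : ∀ᶠ s in 𝓝 t₀, Γ s ∈ (extChartAt 𝓘(ℝ, ES) (C.proj (γ t₀, t₀))).source := by
    refine hΓ.continuousAt.eventually_mem
      ((isOpen_extChartAt_source (I := 𝓘(ℝ, ES)) (C.proj (γ t₀, t₀))).mem_nhds ?_)
    rw [← h0.2.1]
    exact mem_extChartAt_source _
  filter_upwards [hγ, hγs, hΓs, eventually_mdifferentiableAt hΓ] with t h h1 h2 h3
  have h4 := (C.velocity_eq_hLift_iff (γ t₀, t₀) h.1 h3 h1 h2 h.2.1).1 h.2.2
  have h5 : HasDerivAt (fun s => (extChartAt 𝓘(ℝ, EQ) (γ t₀) (γ s), s))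
      (deriv (fun s => extChartAt 𝓘(ℝ, EQ) (γ t₀) (γ s)) t, (1 : ℝ)) t :=
    (differentiableAt_chart_comp (γ t₀) h.1 h1).hasDerivAt.prodMk (hasDerivAt_id t)
  rw [h4] at h5
  exact h5

lemma contDiffAt_liftField {Γ : ℝ → S} {p₀ : Q × ℝ}
    (hΓ : ContMDiffAt 𝓘(ℝ, ℝ) 𝓘(ℝ, ES) ∞ Γ p₀.2) (h0 : C.proj p₀ = Γ p₀.2) :
    ContDiffAt ℝ ∞ (C.liftField p₀ (fun s => extChartAt 𝓘(ℝ, ES) (C.proj p₀) (Γ s)))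
      (center EQ p₀) := by
  obtain ⟨β, hβ⟩ : ∃ β : ℝ → ES, β = fun s => extChartAt 𝓘(ℝ, ES) (C.proj p₀) (Γ s) := ⟨_, rfl⟩
  have h1 : ContDiffAt ℝ ∞ β p₀.2 := by
    rw [hβ]
    exact C.contDiffAt_chart_proj_comp hΓ h0
  have h2 : ContDiffAt ℝ ∞ (deriv β) p₀.2 := by
    have h : ContDiffAt ℝ ∞ (fderiv ℝ β) p₀.2 := h1.fderiv_right (by simp)
    exact h.clm_apply contDiffAt_const
  have h3 : ContDiffAt ℝ ∞ (fun z : EQ × ℝ => deriv β z.2) (center EQ p₀) :=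
    ContDiffAt.comp (center EQ p₀) (g := deriv β) h2 contDiffAt_snd
  rw [← hβ]
  exact (C.contDiffAt_localLift p₀).clm_apply (h3.prodMk contDiffAt_const)

/-- Affine horizontal lifts are smooth. -/
lemma contMDiffAt_of_isLiftAt [CompleteSpace EQ] {Γ : ℝ → S} {γ : ℝ → Q} {t₀ : ℝ}
    (hΓ : ContMDiffAt 𝓘(ℝ, ℝ) 𝓘(ℝ, ES) ∞ Γ t₀) (hγ : ∀ᶠ t in 𝓝 t₀, C.IsLiftAt Γ γ t) :
    ContMDiffAt 𝓘(ℝ, ℝ) 𝓘(ℝ, EQ) ∞ γ t₀ := by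
  have h0 := hγ.self_of_nhds
  have h1 : ContDiffAt ℝ ∞ (fun s => (extChartAt 𝓘(ℝ, EQ) (γ t₀) (γ s), s)) t₀ :=
    contDiffAt_of_hasDerivAt (C.contDiffAt_liftField (p₀ := (γ t₀, t₀)) hΓ h0.2.1)
      (C.hasDerivAt_of_isLiftAt hΓ hγ)
  have h2 : ContMDiffAt 𝓘(ℝ, ℝ) 𝓘(ℝ, EQ) ∞
      (fun s => (extChartAt 𝓘(ℝ, EQ) (γ t₀)).symm (extChartAt 𝓘(ℝ, EQ) (γ t₀) (γ s))) t₀ :=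
    ((contMDiffOn_extChartAt_symm (γ t₀)).contMDiffAt
      ((isOpen_extChartAt_target (γ t₀)).mem_nhds (mem_extChartAt_target (γ t₀)))).comp t₀
      h1.fst.contMDiffAt
  refine h2.congr_of_eventuallyEq ?_
  filter_upwards [h0.1.continuousAt.eventually_mem
    ((isOpen_extChartAt_source (I := 𝓘(ℝ, EQ)) (γ t₀)).mem_nhds (mem_extChartAt_source (γ t₀)))]
    with s hs
  exact ((extChartAt 𝓘(ℝ, EQ) (γ t₀)).left_inv hs).symm

/-- Two lifts of a curve that agree at `t₀` agree near `t₀`. -/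
lemma eventuallyEq_of_isLiftAt {Γ : ℝ → S} {γ γ' : ℝ → Q} {t₀ : ℝ}
    (hΓ : ContMDiffAt 𝓘(ℝ, ℝ) 𝓘(ℝ, ES) ∞ Γ t₀) (hγ : ∀ᶠ t in 𝓝 t₀, C.IsLiftAt Γ γ t)
    (hγ' : ∀ᶠ t in 𝓝 t₀, C.IsLiftAt Γ γ' t) (h : γ t₀ = γ' t₀) : γ =ᶠ[𝓝 t₀] γ' := by
  have h0 := hγ.self_of_nhds
  have h0' := hγ'.self_of_nhds
  have hF := C.contDiffAt_liftField (p₀ := (γ t₀, t₀)) hΓ h0.2.1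
  have hd := C.hasDerivAt_of_isLiftAt hΓ hγ
  have hd' := C.hasDerivAt_of_isLiftAt hΓ hγ'
  rw [← h] at hd'
  obtain ⟨K, u, hu, hK⟩ := (hF.of_le (m := 1) (by simp)).exists_lipschitzOnWith
  have hsrc : ∀ {σ : ℝ → Q}, ContinuousAt σ t₀ → σ t₀ = γ t₀ →
      (∀ᶠ s in 𝓝 t₀, σ s ∈ (extChartAt 𝓘(ℝ, EQ) (γ t₀)).source) := by
    intro σ hσ hσ0
    refine hσ.eventually_mem ((isOpen_extChartAt_source (I := 𝓘(ℝ, EQ)) (γ t₀)).mem_nhds ?_)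
    rw [hσ0]
    exact mem_extChartAt_source (γ t₀)
  have hmem : ∀ᶠ s in 𝓝 t₀, (extChartAt 𝓘(ℝ, EQ) (γ t₀) (γ s), s) ∈ u :=
    hd.self_of_nhds.continuousAt.eventually_mem hu
  have hmem' : ∀ᶠ s in 𝓝 t₀, (extChartAt 𝓘(ℝ, EQ) (γ t₀) (γ' s), s) ∈ u := by
    refine hd'.self_of_nhds.continuousAt.eventually_mem ?_
    rw [← h]
    exact hu
  have heq := ODE_solution_unique_of_eventually
    (v := fun _ => C.liftField (γ t₀, t₀)
      (fun s => extChartAt 𝓘(ℝ, ES) (C.proj (γ t₀, t₀)) (Γ s))) (s := fun _ => u) (K := K)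
    (Filter.Eventually.of_forall fun _ => hK) (hd.and hmem) (hd'.and hmem') (by rw [h])
  filter_upwards [heq, hsrc h0.1.continuousAt rfl, hsrc h0'.1.continuousAt h.symm]
    with s hs h1 h2
  exact (extChartAt 𝓘(ℝ, EQ) (γ t₀)).injOn h1 h2 (congrArg Prod.fst hs)

/-- A curve has a lift through any point over it, for a short time. -/
lemma exists_isLiftAt [CompleteSpace EQ] {Γ : ℝ → S} {t₀ : ℝ} {q₀ : Q}
    (hΓ : ContMDiffAt 𝓘(ℝ, ℝ) 𝓘(ℝ, ES) ∞ Γ t₀) (h0 : C.proj (q₀, t₀) = Γ t₀) :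
    ∃ γ : ℝ → Q, γ t₀ = q₀ ∧ ∀ᶠ t in 𝓝 t₀, C.IsLiftAt Γ γ t := by
  obtain ⟨p₀, hp₀⟩ : ∃ p₀ : Q × ℝ, p₀ = (q₀, t₀) := ⟨_, rfl⟩
  obtain ⟨β, hβ⟩ : ∃ β : ℝ → ES, β = fun s => extChartAt 𝓘(ℝ, ES) (C.proj p₀) (Γ s) := ⟨_, rfl⟩
  have hp2 : p₀.2 = t₀ := by rw [hp₀]
  have hβs : ContDiffAt ℝ ∞ β t₀ := by
    rw [hβ, hp₀]
    exact C.contDiffAt_chart_proj_comp (p₀ := (q₀, t₀)) hΓ h0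
  have hF : ContDiffAt ℝ ∞ (C.liftField p₀ β) (center EQ p₀) := by
    rw [hβ, hp₀]
    exact C.contDiffAt_liftField (p₀ := (q₀, t₀)) hΓ h0
  obtain ⟨α, hα0, ε, hε, hα⟩ :=
    (hF.of_le (m := 1) (by simp)).exists_forall_mem_closedBall_exists_eq_forall_mem_Ioo_hasDerivAt₀
      t₀
  have hα : ∀ᶠ t in 𝓝 t₀, HasDerivAt α (C.liftField p₀ β (α t)) t := by
    filter_upwards [Ioo_mem_nhds (by linarith : t₀ - ε < t₀) (by linarith : t₀ < t₀ + ε)]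
      with t ht using hα t ht
  -- the second component of the solution is time
  have htime : (fun t => (α t).2) =ᶠ[𝓝 t₀] fun t => t := by
    refine ODE_solution_unique_of_eventually (v := fun _ _ => (1 : ℝ)) (s := fun _ => Set.univ)
      (K := 0) (Filter.Eventually.of_forall fun _ => LipschitzWith.lipschitzOnWith
        (LipschitzWith.const _)) (hα.mono fun t ht => ⟨?_, Set.mem_univ _⟩)
      (Filter.Eventually.of_forall fun t => ⟨hasDerivAt_id t, Set.mem_univ _⟩) ?_
    · exact (hasFDerivAt_snd (𝕜 := ℝ) (p := α t)).comp_hasDerivAt t ht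
    · rw [hα0]
      exact hp2
  obtain ⟨c, hc⟩ : ∃ c : ℝ → EQ, c = fun t => (α t).1 := ⟨_, rfl⟩
  have hαc : ∀ᶠ t in 𝓝 t₀, α t = (c t, t) := htime.mono fun t ht => by
    rw [hc]
    exact Prod.ext rfl ht
  have hcd : ∀ᶠ t in 𝓝 t₀, HasDerivAt (fun t => (c t, t)) (C.localLift p₀ (c t, t) (deriv β t, 1))
      t := by
    filter_upwards [hα, hαc.eventually_nhds] with t ht hαt
    have h1 := ht.congr_of_eventuallyEq (hαt.mono fun _ h => h.symm)
    rw [hαt.self_of_nhds] at h1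
    exact h1
  have hct : (c t₀, t₀) = center EQ p₀ := by rw [← hα0, hαc.self_of_nhds]
  have hct' : ContinuousAt (fun s => (c s, s)) t₀ := hcd.self_of_nhds.continuousAt
  have hdom : ∀ᶠ s in 𝓝 t₀, (c s, s) ∈ C.localDomain p₀ :=
    hct'.eventually_mem (by
      rw [hct]; exact C.localDomain_mem_nhds p₀ (C.center_mem_localDomain p₀))
  -- the solution projects to the curve
  have hproj : (fun s => C.localProj p₀ (c s, s)) =ᶠ[𝓝 t₀] β := by
    refine ODE_solution_unique_of_eventually (v := fun t _ => deriv β t) (s := fun _ => Set.univ)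
      (K := 0) (Filter.Eventually.of_forall fun _ => LipschitzWith.lipschitzOnWith
        (LipschitzWith.const _)) ((hcd.and hdom).mono fun t ht => ⟨?_, Set.mem_univ _⟩)
      ((eventually_differentiableAt hβs).mono fun t ht => ⟨ht.hasDerivAt, Set.mem_univ _⟩) ?_
    · have h1 := HasFDerivAt.comp_hasDerivAt (f := fun s => (c s, s)) t
        ((C.contDiffAt_localProj p₀ ht.2).differentiableAt (by simp)).hasFDerivAt ht.1
      rw [C.fderiv_localProj_localLift p₀ ht.2] at h1
      exact h1
    · rw [hct, localProj, param_center, hβ]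
      dsimp only
      rw [← h0, hp₀]
  have hΓs : ∀ᶠ s in 𝓝 t₀, Γ s ∈ (extChartAt 𝓘(ℝ, ES) (C.proj p₀)).source := by
    refine hΓ.continuousAt.eventually_mem
      ((isOpen_extChartAt_source (I := 𝓘(ℝ, ES)) (C.proj p₀)).mem_nhds ?_)
    rw [← h0, hp₀]
    exact mem_extChartAt_source _
  refine ⟨fun s => (extChartAt 𝓘(ℝ, EQ) p₀.1).symm (c s), ?_, ?_⟩
  · have h1 : c t₀ = extChartAt 𝓘(ℝ, EQ) p₀.1 p₀.1 := congrArg Prod.fst hct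
    dsimp only
    rw [h1, extChartAt_to_inv, hp₀]
  · filter_upwards [hcd, hdom.eventually_nhds, hproj, hΓs, eventually_mdifferentiableAt hΓ]
      with t h1 h2 h3 h4 h5
    have h2t := h2.self_of_nhds
    have h6 : MDifferentiableAt 𝓘(ℝ, ℝ) 𝓘(ℝ, EQ)
        (fun s => (extChartAt 𝓘(ℝ, EQ) p₀.1).symm (c s)) t :=
      (hasMFDerivAt_chart_symm p₀.1 h2t.1).mdifferentiableAt.comp t
        (h1.differentiableAt.fst).mdifferentiableAt
    have h7 : C.proj ((extChartAt 𝓘(ℝ, EQ) p₀.1).symm (c t), t) = Γ t := by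
      refine (extChartAt 𝓘(ℝ, ES) (C.proj p₀)).injOn h2t.2 h4 ?_
      rw [hβ] at h3
      exact h3
    have h8 : (fun r => extChartAt 𝓘(ℝ, EQ) p₀.1 ((extChartAt 𝓘(ℝ, EQ) p₀.1).symm (c r)))
        =ᶠ[𝓝 t] c := h2.mono fun s hs => (extChartAt 𝓘(ℝ, EQ) p₀.1).right_inv hs.1
    refine ⟨h6, h7, (C.velocity_eq_hLift_iff p₀ h6 h5
      ((extChartAt 𝓘(ℝ, EQ) p₀.1).map_target h2t.1) h4 h7).2 ?_⟩
    rw [h8.deriv_eq, (extChartAt 𝓘(ℝ, EQ) p₀.1).right_inv h2t.1, ← hβ]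
    have h9 : HasDerivAt c _ t := (hasFDerivAt_fst (𝕜 := ℝ) (p := (c t, t))).comp_hasDerivAt
      (f := fun t => (c t, t)) t h1
    exact Prod.ext h9.deriv (C.localLift_snd p₀ (c t, t) (deriv β t, 1)).symm

end ChaplyginSystem

/-! ### Global affine horizontal lifts -/

namespace ChaplyginSystem

variable {EQ ES EG : Type*} [NormedAddCommGroup EQ] [NormedSpace ℝ EQ]
  [NormedAddCommGroup ES] [NormedSpace ℝ ES] [NormedAddCommGroup EG] [NormedSpace ℝ EG]
  {Q : Type*} [TopologicalSpace Q] [ChartedSpace EQ Q] [IsManifold 𝓘(ℝ, EQ) ∞ Q]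
  {S : Type*} [TopologicalSpace S] [ChartedSpace ES S] [IsManifold 𝓘(ℝ, ES) ∞ S]
  {G : Type*} [TopologicalSpace G] [ChartedSpace EG G] [Group G] [LieGroup 𝓘(ℝ, EG) ∞ G]
  (C : ChaplyginSystem EQ ES EG Q S G)

/-- The lift starts with the lift of the initial velocity. -/
lemma tangentLift_eq_of_isAffineHorizontalLift {J : Set ℝ} {Γ : ℝ → S} {γ : ℝ → Q} {t : ℝ} {q : Q}
    (h : C.IsAffineHorizontalLift J Γ γ) (ht : t ∈ J) (hq : γ t = q) {y : S}
    {Y : TangentSpace 𝓘(ℝ, ES) y} (hY : tangentLift Γ t = (⟨y, Y⟩ : TangentBundle 𝓘(ℝ, ES) S)) :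
    tangentLift γ t = (⟨q, C.affineLift (q, t) Y⟩ : TangentBundle 𝓘(ℝ, EQ) Q) := by
  have h1 : ∀ (w : TangentBundle 𝓘(ℝ, ES) S), w = ⟨y, Y⟩ → (w.2 : ES) = Y := by
    rintro _ rfl
    rfl
  have h2 : (velocity Γ t : ES) = Y := h1 _ hY
  have h3 : ∀ (q' : Q) (v : EQ) (V : ES), q' = q → v = C.affineLift (q', t) V → V = Y →
      (⟨q', v⟩ : TangentBundle 𝓘(ℝ, EQ) Q) = ⟨q, C.affineLift (q, t) Y⟩ := by
    rintro _ _ _ rfl rfl rfl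
    rfl
  exact h3 _ _ _ hq (h.2 t ht).2 h2

variable [FiniteDimensional ℝ ES]

lemma isAffineHorizontalLift_iff [CompleteSpace EQ] {J : Set ℝ} {Γ : ℝ → S} {γ : ℝ → Q}
    (hJ : IsOpen J) (hΓ : ∀ t ∈ J, ContMDiffAt 𝓘(ℝ, ℝ) 𝓘(ℝ, ES) ∞ Γ t) :
    C.IsAffineHorizontalLift J Γ γ ↔ ∀ t ∈ J, C.IsLiftAt Γ γ t := by
  constructor
  · intro h t ht
    refine ⟨(h.1.contMDiffAt (hJ.mem_nhds ht)).mdifferentiableAt (by simp), (h.2 t ht).1, ?_⟩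
    exact Prod.ext (h.2 t ht).2 (C.hLift_snd (γ t, t) (velocity Γ t, 1)).symm
  · intro h
    refine ⟨fun t ht => (C.contMDiffAt_of_isLiftAt (hΓ t ht)
      (Filter.mem_of_superset (hJ.mem_nhds ht) h)).contMDiffWithinAt,
      fun t ht => ⟨(h t ht).2.1, ?_⟩⟩
    exact congrArg Prod.fst (h t ht).2.2

variable [T2Space Q]

/-- Two lifts of a curve on an interval that agree at one time agree. -/
lemma eqOn_of_isLiftAt {J : Set ℝ} {Γ : ℝ → S} {γ γ' : ℝ → Q} {a : ℝ} (hJ : IsOpen J)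
    (hJ' : J.OrdConnected) (hΓ : ∀ t ∈ J, ContMDiffAt 𝓘(ℝ, ℝ) 𝓘(ℝ, ES) ∞ Γ t)
    (hγ : ∀ t ∈ J, C.IsLiftAt Γ γ t) (hγ' : ∀ t ∈ J, C.IsLiftAt Γ γ' t) (ha : a ∈ J)
    (h : γ a = γ' a) : Set.EqOn γ γ' J := by
  have hloc : ∀ t ∈ J, γ t = γ' t → γ =ᶠ[𝓝 t] γ' := fun t ht h =>
    C.eventuallyEq_of_isLiftAt (hΓ t ht) (Filter.mem_of_superset (hJ.mem_nhds ht) hγ)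
      (Filter.mem_of_superset (hJ.mem_nhds ht) hγ') h
  have hsub : J ⊆ {t | γ =ᶠ[𝓝 t] γ'} := by
    refine hJ'.isPreconnected.subset_of_closure_inter_subset
      (isOpen_iff_mem_nhds.2 fun t ht => Filter.Eventually.eventually_nhds ht)
      ⟨a, ha, hloc a ha h⟩ ?_
    rintro t ⟨ht, htJ⟩
    refine hloc t htJ ?_
    by_contra hne
    have h1 : ∀ᶠ s in 𝓝 t, γ s ≠ γ' s :=
      ((hγ t htJ).1.continuousAt.prodMk (hγ' t htJ).1.continuousAt).eventually_mem
        (isClosed_diagonal.isOpen_compl.mem_nhds hne)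
    obtain ⟨s, hs, hs'⟩ := mem_closure_iff_nhds.1 ht _ h1
    exact hs hs'.self_of_nhds
  exact fun t ht => (hsub ht).self_of_nhds

/-- A curve on an interval has a lift through any point over it. The lift exists on the whole
interval, since translates by the group of one local lift pass through all points of a fiber. -/
lemma exists_isLiftAt_forall [CompleteSpace EQ] {J : Set ℝ} {Γ : ℝ → S} {a : ℝ} {q : Q}
    (hJ : IsOpen J) (hJ' : J.OrdConnected)
    (hΓ : ∀ t ∈ J, ContMDiffAt 𝓘(ℝ, ℝ) 𝓘(ℝ, ES) ∞ Γ t) (ha : a ∈ J) (hq : C.proj (q, a) = Γ a) :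
    ∃ γ : ℝ → Q, γ a = q ∧ ∀ t ∈ J, C.IsLiftAt Γ γ t := by
  -- a local lift at each time, on an interval contained in `J`
  have hlocal : ∀ t ∈ J, ∀ q, C.proj (q, t) = Γ t → ∃ (V : Set ℝ) (γ : ℝ → Q), IsOpen V ∧
      V.OrdConnected ∧ t ∈ V ∧ V ⊆ J ∧ γ t = q ∧ ∀ s ∈ V, C.IsLiftAt Γ γ s := by
    intro t ht q hq
    obtain ⟨γ, hγ, hev⟩ := C.exists_isLiftAt (hΓ t ht) hq
    obtain ⟨ε, hε, hball⟩ := Metric.nhds_basis_ball.eventually_iff.1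
      (hev.and (hJ.mem_nhds ht : ∀ᶠ s in 𝓝 t, s ∈ J))
    refine ⟨Metric.ball t ε, γ, Metric.isOpen_ball, ?_, Metric.mem_ball_self hε,
      fun s hs => (hball hs).2, hγ, fun s hs => (hball hs).1⟩
    rw [Real.ball_eq_Ioo]
    exact Set.ordConnected_Ioo
  let A : ℝ → Set ℝ → (ℝ → Q) → Prop := fun t V γ => IsOpen V ∧ V.OrdConnected ∧ a ∈ V ∧ t ∈ V ∧
    V ⊆ J ∧ γ a = q ∧ ∀ s ∈ V, C.IsLiftAt Γ γ s
  have hsub : J ⊆ {t | ∃ V γ, A t V γ} := by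
    refine hJ'.isPreconnected.subset_of_closure_inter_subset ?_ ?_ ?_
    · refine isOpen_iff_mem_nhds.2 ?_
      rintro t ⟨V, γ, hV, hV', haV, htV, hVJ, h⟩
      exact Filter.mem_of_superset (hV.mem_nhds htV) fun s hs => ⟨V, γ, hV, hV', haV, hs, hVJ, h⟩
    · obtain ⟨V, γ, hV, hV', haV, hVJ, hγ, h⟩ := hlocal a ha q hq
      exact ⟨a, ha, V, γ, hV, hV', haV, haV, hVJ, hγ, h⟩
    · rintro t ⟨ht, htJ⟩
      obtain ⟨q', hq'⟩ := C.proj_surjective t (Γ t)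
      obtain ⟨W, σ, hW, hW', htW, hWJ, -, hσ⟩ := hlocal t htJ q' hq'
      obtain ⟨s, hsW, V, γ, hV, hV', haV, hsV, hVJ, hγa, hγ⟩ :=
        mem_closure_iff_nhds.1 ht W (hW.mem_nhds htW)
      -- a translate of the local lift at `t` continues the lift found so far
      obtain ⟨g, hg⟩ := (C.proj_eq_iff (σ s) (γ s) s).1
        ((hσ s hsW).2.1.trans (hγ s hsV).2.1.symm)
      have hσ' : ∀ r ∈ W, C.IsLiftAt Γ (fun r => C.act g (σ r, r)) r := fun r hr =>
        C.isLiftAt_act g (hσ r hr)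
      have heq : Set.EqOn γ (fun r => C.act g (σ r, r)) (V ∩ W) :=
        C.eqOn_of_isLiftAt (hV.inter hW) (hV'.inter hW') (fun r hr => hΓ r (hVJ hr.1))
          (fun r hr => hγ r hr.1) (fun r hr => hσ' r hr.2) ⟨hsV, hsW⟩ hg.symm
      classical
      have e1 : Set.EqOn (V.piecewise γ fun r => C.act g (σ r, r)) γ V := fun r hr =>
        Set.piecewise_eq_of_mem _ _ _ hr
      have e2 : Set.EqOn (V.piecewise γ fun r => C.act g (σ r, r)) (fun r => C.act g (σ r, r)) W :=
        fun r hr => by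
          by_cases hrV : r ∈ V
          · exact (e1 hrV).trans (heq ⟨hrV, hr⟩)
          · exact Set.piecewise_eq_of_notMem _ _ _ hrV
      refine ⟨V ∪ W, V.piecewise γ fun r => C.act g (σ r, r), hV.union hW,
        (IsPreconnected.union s hsV hsW hV'.isPreconnected hW'.isPreconnected).ordConnected,
        Or.inl haV, Or.inr htW, Set.union_subset hVJ hWJ, (e1 haV).trans hγa, ?_⟩
      rintro r (hr | hr)
      · exact (hγ r hr).congr (e1.eventuallyEq_of_mem (hV.mem_nhds hr))
      · exact (hσ' r hr).congr (e2.eventuallyEq_of_mem (hW.mem_nhds hr))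
  have hsub' : ∀ t : J, ∃ V γ, A t V γ := fun t => hsub t.2
  choose V σ hV using hsub'
  classical
  refine ⟨fun t => if ht : t ∈ J then σ ⟨t, ht⟩ t else q, ?_, ?_⟩
  · dsimp only
    rw [dif_pos ha]
    exact (hV ⟨a, ha⟩).2.2.2.2.2.1
  · intro t ht
    obtain ⟨h1, h2, h3, h4, h5, h6, h7⟩ := hV ⟨t, ht⟩
    refine (h7 t h4).congr (Filter.mem_of_superset (h1.mem_nhds h4) fun s hs => ?_)
    obtain ⟨k1, k2, k3, k4, k5, k6, k7⟩ := hV ⟨s, h5 hs⟩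
    change (if ht : s ∈ J then σ ⟨s, ht⟩ s else q) = σ ⟨t, ht⟩ s
    rw [dif_pos (h5 hs)]
    exact C.eqOn_of_isLiftAt (h1.inter k1) (h2.inter k2) (fun r hr => hΓ r (h5 hr.1))
      (fun r hr => k7 r hr.2) (fun r hr => h7 r hr.1) ⟨h3, k3⟩ (k6.trans h6.symm) ⟨hs, k4⟩

end ChaplyginSystem

end Chaplygin

end

theorem theorem6p1
    {EQ ES EG : Type*} [NormedAddCommGroup EQ] [NormedSpace ℝ EQ] [FiniteDimensional ℝ EQ]
    [NormedAddCommGroup ES] [NormedSpace ℝ ES] [FiniteDimensional ℝ ES]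
    [NormedAddCommGroup EG] [NormedSpace ℝ EG] [FiniteDimensional ℝ EG]
    {Q : Type*} [TopologicalSpace Q] [T2Space Q] [ChartedSpace EQ Q] [IsManifold 𝓘(ℝ, EQ) ∞ Q]
    {S : Type*} [TopologicalSpace S] [T2Space S] [ChartedSpace ES S] [IsManifold 𝓘(ℝ, ES) ∞ S]
    {G : Type*} [TopologicalSpace G] [T2Space G] [ChartedSpace EG G] [Group G]
    [LieGroup 𝓘(ℝ, EG) ∞ G]
    (C : Chaplygin.ChaplyginSystem EQ ES EG Q S G) :
    -- the reduced system is well defined: any point of the fiber may be used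
    ContMDiff (𝓘(ℝ, ES).tangent.prod 𝓘(ℝ, ℝ)) 𝓘(ℝ, ℝ) ∞ C.reducedLagrangian ∧
    (∀ (p : Q × ℝ) (Y : TangentSpace 𝓘(ℝ, ES) (C.proj p)),
      C.reducedLagrangian (⟨C.proj p, Y⟩, p.2) = C.lagrangian (⟨p.1, C.affineLift p Y⟩, p.2)) ∧
    (∀ (p : Q × ℝ) (Y ξ : TangentSpace 𝓘(ℝ, ES) (C.proj p)),
      C.reducedForce ⟨C.proj p, Y⟩ p.2 ξ
        = C.force ⟨p.1, C.affineLift p Y⟩ p.2 (C.horizontalLift p ξ)) ∧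
    (∀ (p : Q × ℝ) (Y ξ : TangentSpace 𝓘(ℝ, ES) (C.proj p)),
      C.jkTerm ⟨C.proj p, Y⟩ p.2 ξ = C.jkAt p Y ξ) ∧
    -- solutions project to solutions of the reduced system
    (∀ (J : Set ℝ) (γ : ℝ → Q), IsOpen J → J.OrdConnected → C.IsSolution J γ →
      C.IsReducedSolution J (fun t => C.proj (γ t, t))) ∧
    -- affine horizontal lifts of solutions of the reduced system are solutions
    (∀ (J : Set ℝ) (Γ : ℝ → S) (y₀ : S) (Y₀ : TangentSpace 𝓘(ℝ, ES) y₀) (q₀ : Q),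
      IsOpen J → J.OrdConnected → (0 : ℝ) ∈ J → C.IsReducedSolution J Γ →
      Chaplygin.tangentLift Γ 0 = (⟨y₀, Y₀⟩ : TangentBundle 𝓘(ℝ, ES) S) → C.proj (q₀, 0) = y₀ →
      ∃ γ : ℝ → Q, (C.IsAffineHorizontalLift J Γ γ ∧ γ 0 = q₀) ∧
        (∀ γ' : ℝ → Q, C.IsAffineHorizontalLift J Γ γ' ∧ γ' 0 = q₀ → Set.EqOn γ' γ J) ∧
        C.IsSolution J γ ∧
        C.affineLift (q₀, 0) Y₀ ∈ C.constraint.space (q₀, 0) ∧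
        Chaplygin.tangentLift γ 0 = (⟨q₀, C.affineLift (q₀, 0) Y₀⟩ : TangentBundle 𝓘(ℝ, EQ) Q)) := by
  have : CompleteSpace EQ := FiniteDimensional.complete ℝ EQ
  refine ⟨C.contMDiff_reducedLagrangian, C.reducedLagrangian_eq, C.reducedForce_eq, C.jkTerm_eq,
    fun J γ hJ _ h => C.isReducedSolution_of_isSolution hJ h, ?_⟩
  intro J Γ y₀ Y₀ q₀ hJ hJ' h0 hΓ hY hq
  have hΓs : ∀ t ∈ J, ContMDiffAt 𝓘(ℝ, ℝ) 𝓘(ℝ, ES) ∞ Γ t := fun t ht =>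
    hΓ.1.contMDiffAt (hJ.mem_nhds ht)
  have hΓ0 : Γ 0 = y₀ := congrArg Bundle.TotalSpace.proj hY
  obtain ⟨γ, hγ0, hγ⟩ := C.exists_isLiftAt_forall hJ hJ' hΓs h0 (hq.trans hΓ0.symm)
  have hlift := (C.isAffineHorizontalLift_iff hJ hΓs).2 hγ
  refine ⟨γ, ⟨hlift, hγ0⟩, ?_, C.isSolution_of_isAffineHorizontalLift hJ hlift hΓ, ?_, ?_⟩
  · rintro γ' ⟨hγ', hγ'0⟩
    exact C.eqOn_of_isLiftAt hJ hJ' hΓs ((C.isAffineHorizontalLift_iff hJ hΓs).1 hγ') hγ h0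
      (hγ'0.trans hγ0.symm)
  · subst hq
    exact C.affineLift_mem (q₀, 0) Y₀
  · exact C.tangentLift_eq_of_isAffineHorizontalLift hlift h0 hγ0 hY
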